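/- **Protocol.** For each security parameter $\eta$ and number of vertices $n$ let $\mathbb F_Q$ be a finite field with $Q=Q(\eta,n)$ elements, where $\log Q$ is bounded by a polynomial in $\eta+n$ and, for each fixed $n$, $1/Q(\eta,n)$ is negligible in $\eta$. The public input is a simple graph $G$ on $[n]$; a witness is a Hamiltonian cycle $w$ of $G$, viewed as a cyclic permutation of all $n\ge 3$ vertices with $\{u,w(u)\}$ an edge for all $u$. The two provers do not communicate. Honest provers share a uniformly random permutation $\Pi$ of $[n]$ and a uniformly random matrix $A\in\mathbb F_Q^{n\times n}$; let $M_{\Pi(G)}$ be the adjacency matrix of $\Pi(G)$. 1. $V$ sends a uniform $B\in\mathbb F_Q^{n\times n}$ to $P_1$, who answers $Y$ with $Y_{ij}=A_{ij}+B_{ij}(M_{\Pi(G)})_{ij}$. 2. $V$ sends a uniform bit $ch$ to $P_2$. If $ch=0$, $P_2$ answers $(\Pi,A)$. If $ch=1$, $P_2$ answers the cycle $C'=\Pi w\Pi^{-1}$ together with $A_{uv}$ for all edges $(u,v)$ of $C'$. 3. If $ch=0$, $V$ accepts iff $\Pi$ is a permutation and $Y_{ij}=A_{ij}+B_{ij}(M_{\Pi(G)})_{ij}$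 for all $i,j$. If $ch=1$, $V$ accepts iff $C'$ is a cycle through all $n\ge 3$ vertices and $Y_{uv}=A_{uv}+B_{uv}$ for all edges $(u,v)$ of $C'$. Malicious provers $P^*=(P_1^*,P_2^*)$ are computationally unbounded: they share an arbitrary entangled pure state on two finite-dimensional registers, and each of them, on its message, applies a unitary to its own register and then makes a projective measurement on it whose outcome is its answer. An extractor $K$ is given $\eta$, $G$ and oracle access to $P^*$; it may activate either prover, measure its answer, and undo activations (rewind). **Theorem.** There are functions $\xi(n,\eta)$ with $0\le\xi(n,\eta)\le\sqrt{n!/(2Q(\eta,n))}$, negligible in $\eta$ for each $n$, such that the protocol is a perfect zero-knowledge quantum proof of knowledge for Hamiltonian Cycle with knowledge error $\kappa=\tfrac12+\xi$. That is: * *(Non-triviality.)* If $w$ is a Hamiltonian cycle of $G$, the honest provers are accepted with probability one. * *(Validity.)* There are one oracle machine $K$, with running time polynomial in $\eta+n$ (an oracle call being charged the length of the message), and an integer $d>0$ such that for each $n$ there is a positive polynomially bounded function $p_n$ for which, for all $\eta$, all graphs $G$ on $[n]$ and all $P^*$, $$\Pr[V\text{ accepts }P^*]>\kappa\ \Longrightarrow\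 \Pr[K^{P^*}(\eta,G)\text{ outputs a Hamiltonian cycle of }G]\ \ge\ \frac1{p_n(\eta)}\bigl(\Pr[V\text{ accepts }P^*]-\kappa\bigr)^d .$$ Moreover, for the same $K$ and $d$ there is a single positive polynomially bounded function $p$, independent of $n$, such that $p_n(\eta)$ can be replaced by $p(\eta)\cdot r$, where $r\le n!$ is the maximum over $B,Y,ch$ of the number of accepted responses that the measurement of $P_2^*$ can output. * *(Perfect zero knowledge.)* There is one probabilistic simulator, running in time polynomial in $\eta+n$ and given only $\eta$ and $G$, which plays both provers towards any malicious quantum verifier (with arbitrary quantum auxiliary input, contacting the two provers in either order, with messages chosen adaptively, used as a black box without rewinding) such that the joint state of transcript and verifier is exactly equal to the one in the interaction with the honest provers, whenever $G$ has a Hamiltonian cycle and the honest provers use any such cycle. -/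

import Mathlib

open scoped Matrix Kronecker Nat

noncomputable section

namespace RelHC

/-! ### The relation and the messages -/

/-- `σ` is a single cycle through all `n` vertices; the cycle is the set of ordered pairs
`(u, σ u)`.  As in every simple graph, a cycle has at least three vertices. -/
def IsFullCycle {n : ℕ} (σ : Equiv.Perm (Fin n)) : Prop :=
  3 ≤ n ∧ σ.IsCycle ∧ σ.support = Finset.univ

/-- The witness relation: `σ` is a Hamiltonian cycle of the graph `G`. -/
def IsHamCycle {n : ℕ} (G : SimpleGraph (Fin n)) (σ : Equiv.Perm (Fin n)) : Prop :=
  IsFullCycle σ ∧ ∀ u, G.Adj u (σ u)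

open Classical in
/-- Adjacency matrix of the permuted graph `Π(G)`, whose edges are the pairs `(Π u, Π v)` for the
edges `(u, v)` of `G`. -/
def permAdj (F : Type) [Field F] {n : ℕ} (G : SimpleGraph (Fin n)) (Pi : Equiv.Perm (Fin n)) :
    Matrix (Fin n) (Fin n) F :=
  (G.comap (fun v => Pi.symm v)).adjMatrix F

/-- Messages to and from the first prover: `n × n` matrices over the field. -/
abbrev Mat (F : Type) (n : ℕ) : Type := Matrix (Fin n) (Fin n) F

/-- Responses of the second prover: either a permutation together with the opening of every matrix
entry, or a cycle `σ` together with one opening `a u` for each of its edges `(u, σ u)`. -/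
inductive Resp (F : Type) (n : ℕ) : Type
  | openAll (Pi : Equiv.Perm (Fin n)) (A : Mat F n)
  | openCycle (σ : Equiv.Perm (Fin n)) (a : Fin n → F)

/-- Responses as a disjoint union. -/
def Resp.equivSum (F : Type) (n : ℕ) :
    Resp F n ≃ (Equiv.Perm (Fin n) × Mat F n) ⊕ (Equiv.Perm (Fin n) × (Fin n → F)) where
  toFun
    | .openAll p A => .inl (p, A)
    | .openCycle s a => .inr (s, a)
  invFun
    | .inl x => .openAll x.1 x.2
    | .inr x => .openCycle x.1 x.2
  left_inv := by rintro (_ | _) <;> rfl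
  right_inv := by rintro (_ | _) <;> rfl

instance instFintypeMat (F : Type) [Fintype F] (n : ℕ) : Fintype (Mat F n) := by
  classical
  exact inferInstanceAs (Fintype (Fin n → Fin n → F))

instance instFintypeResp (F : Type) [Fintype F] (n : ℕ) : Fintype (Resp F n) := by
  classical
  exact Fintype.ofEquiv _ (Resp.equivSum F n).symm

/-! ### The protocol -/

section Protocol

variable {F : Type} [Field F] {n : ℕ}

/-- The verifier's check.  The challenge `false` is `ch = 0`, the challenge `true` is `ch = 1`. -/
def Accepts (G : SimpleGraph (Fin n)) (B Y : Mat F n) : Bool → Resp F n → Prop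
  | false, .openAll Pi A => ∀ i j, Y i j = A i j + B i j * permAdj F G Pi i j
  | true, .openCycle σ a => IsFullCycle σ ∧ ∀ u, Y u (σ u) = a u + B u (σ u)
  | _, _ => False

/-- The honest first prover, with shared randomness `Pi`, `A`. -/
def honestCom (G : SimpleGraph (Fin n)) (Pi : Equiv.Perm (Fin n)) (A B : Mat F n) : Mat F n :=
  fun i j => A i j + B i j * permAdj F G Pi i j

/-- The honest second prover, with witness `w` and shared randomness `Pi`, `A`; the permuted cycle
consists of the pairs `(Pi u, Pi (w u))`. -/
def honestResp (w Pi : Equiv.Perm (Fin n)) (A : Mat F n) : Bool → Resp F n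
  | false => .openAll Pi A
  | true => .openCycle (Pi * w * Pi⁻¹) (fun u => A u ((Pi * w * Pi⁻¹) u))

open Classical in
/-- Probability that the verifier accepts the honest provers with witness `w`. -/
def honestAcceptProb [Fintype F] (G : SimpleGraph (Fin n)) (w : Equiv.Perm (Fin n)) : ℝ :=
  (∑ Pi : Equiv.Perm (Fin n), ∑ A : Mat F n, ∑ B : Mat F n, ∑ ch : Bool,
      if Accepts G B (honestCom G Pi A B) ch (honestResp w Pi A ch) then (1 : ℝ) else 0) /
    ((n ! : ℝ) * (Fintype.card (Mat F n) : ℝ) * (Fintype.card (Mat F n) : ℝ) * 2)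

end Protocol

/-! ### Malicious provers -/

/-- Squared Euclidean norm. -/
def normSq {ι : Type} [Fintype ι] (v : ι → ℂ) : ℝ := ∑ i, ‖v i‖ ^ 2

/-- A projective measurement with outcomes in `R`. -/
def IsProjectiveMeasurement {R S : Type} [Fintype R] [Fintype S] [DecidableEq S]
    (W : R → Matrix S S ℂ) : Prop :=
  (∀ r, (W r).IsHermitian) ∧ (∀ r, W r * W r = W r) ∧ (∀ r s, r ≠ s → W r * W s = 0) ∧
    ∑ r, W r = 1

/-- A pair of (possibly malicious, computationally unbounded) quantum provers which share the
entangled state `Φ` and do not communicate.  On the classical message `m`, prover `i` applies the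
unitary `Ui m` to its own register and then measures `Wi`; the outcome is its answer. -/
structure Provers (F : Type) [Fintype F] (n : ℕ) where
  S1 : Type
  S2 : Type
  [fin1 : Fintype S1]
  [fin2 : Fintype S2]
  [dec1 : DecidableEq S1]
  [dec2 : DecidableEq S2]
  Φ : S1 × S2 → ℂ
  norm_Φ : normSq Φ = 1
  U1 : Mat F n → Matrix.unitaryGroup S1 ℂ
  W1 : Mat F n → Matrix S1 S1 ℂ
  meas1 : IsProjectiveMeasurement W1
  U2 : Bool → Matrix.unitaryGroup S2 ℂ
  W2 : Resp F n → Matrix S2 S2 ℂ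
  meas2 : IsProjectiveMeasurement W2

attribute [instance] Provers.fin1 Provers.fin2 Provers.dec1 Provers.dec2

namespace Provers

variable {F : Type} [Fintype F] {n : ℕ} (P : Provers F n)

/-- An operator on the first prover's register, applied to the joint state. -/
def on1 (M : Matrix P.S1 P.S1 ℂ) (v : P.S1 × P.S2 → ℂ) : P.S1 × P.S2 → ℂ :=
  (M ⊗ₖ (1 : Matrix P.S2 P.S2 ℂ)) *ᵥ v

/-- An operator on the second prover's register, applied to the joint state. -/
def on2 (M : Matrix P.S2 P.S2 ℂ) (v : P.S1 × P.S2 → ℂ) : P.S1 × P.S2 → ℂ :=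
  ((1 : Matrix P.S1 P.S1 ℂ) ⊗ₖ M) *ᵥ v

open Classical in
/-- Probability that the honest verifier, with uniform `B` and `ch`, accepts the provers. -/
def acceptProb [Field F] (G : SimpleGraph (Fin n)) : ℝ :=
  (∑ B : Mat F n, ∑ ch : Bool, ∑ Y : Mat F n, ∑ resp : Resp F n,
      if Accepts G B Y ch resp then
        normSq (P.on2 (P.W2 resp * (P.U2 ch : Matrix P.S2 P.S2 ℂ))
          (P.on1 (P.W1 Y * (P.U1 B : Matrix P.S1 P.S1 ℂ)) P.Φ))
      else 0) /
    ((Fintype.card (Mat F n) : ℝ) * 2)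

open Classical in
/-- The largest number, over `B`, `Y` and `ch`, of acceptable responses that the second prover's
measurement can produce. It is at most `n!`. -/
def numAcceptable [Field F] (G : SimpleGraph (Fin n)) : ℕ :=
  Finset.univ.sup fun x : Mat F n × Mat F n × Bool =>
    (Finset.univ.filter fun resp : Resp F n =>
      Accepts G x.1 x.2.1 x.2.2 resp ∧ P.W2 resp ≠ 0).card

end Provers

/-! ### A randomized random-access machine with logarithmic cost

Memory cells hold natural numbers or field elements and are addressed by the number of an array and
two indices. Operations on natural numbers are charged the bit lengths of the values involved,
operations on field elements a quadratic polynomial in the bit length of the field size. -/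

/-- Memory contents and the time used so far. -/
structure Mem (F : Type) where
  nat : ℕ → ℕ → ℕ → ℕ
  fld : ℕ → ℕ → ℕ → F
  cost : ℕ

namespace Mem

variable {F : Type}

def setNat (m : Mem F) (a i j x : ℕ) : Mem F :=
  { m with nat := fun a' i' j' => if a' = a ∧ i' = i ∧ j' = j then x else m.nat a' i' j' }

def setFld (m : Mem F) (a i j : ℕ) (x : F) : Mem F :=
  { m with fld := fun a' i' j' => if a' = a ∧ i' = i ∧ j' = j then x else m.fld a' i' j' }

def tick (m : Mem F) (k : ℕ) : Mem F := { m with cost := m.cost + k }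

end Mem

/-- Expressions with values in the natural numbers (comparisons have value `0` or `1`). -/
inductive NExpr : Type
  | const (c : ℕ)
  | get (a : ℕ) (i j : NExpr)
  | add (x y : NExpr)
  | sub (x y : NExpr)
  | mul (x y : NExpr)
  | lt (x y : NExpr)
  | eq (x y : NExpr)

/-- Expressions with values in the field. -/
inductive FExpr : Type
  | zero
  | one
  | get (a : ℕ) (i j : NExpr)
  | add (x y : FExpr)
  | sub (x y : FExpr)
  | mul (x y : FExpr)

def NExpr.eval {F : Type} (m : Mem F) : NExpr → ℕ
  | .const c => c
  | .get a i j => m.nat a (i.eval m) (j.eval m)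
  | .add x y => x.eval m + y.eval m
  | .sub x y => x.eval m - y.eval m
  | .mul x y => x.eval m * y.eval m
  | .lt x y => if x.eval m < y.eval m then 1 else 0
  | .eq x y => if x.eval m = y.eval m then 1 else 0

/-- Every node of the expression costs one plus the bit length of its value. -/
def NExpr.cost {F : Type} (m : Mem F) : NExpr → ℕ
  | .const c => 1 + Nat.size c
  | .get a i j => 1 + Nat.size (m.nat a (i.eval m) (j.eval m)) + i.cost m + j.cost m
  | .add x y => 1 + Nat.size (x.eval m + y.eval m) + x.cost m + y.cost m
  | .sub x y => 1 + Nat.size (x.eval m - y.eval m) + x.cost m + y.cost m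
  | .mul x y => 1 + Nat.size (x.eval m * y.eval m) + x.cost m + y.cost m
  | .lt x y => 2 + x.cost m + y.cost m
  | .eq x y => 2 + x.cost m + y.cost m

def FExpr.eval {F : Type} [Field F] (m : Mem F) : FExpr → F
  | .zero => 0
  | .one => 1
  | .get a i j => m.fld a (i.eval m) (j.eval m)
  | .add x y => x.eval m + y.eval m
  | .sub x y => x.eval m - y.eval m
  | .mul x y => x.eval m * y.eval m

/-- Cost of one operation on field elements. -/
def fieldCost (F : Type) [Fintype F] : ℕ := 1 + Nat.size (Fintype.card F) ^ 2

def FExpr.cost {F : Type} [Fintype F] (m : Mem F) : FExpr → ℕ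
  | .zero => fieldCost F
  | .one => fieldCost F
  | .get _ i j => fieldCost F + i.cost m + j.cost m
  | .add x y => fieldCost F + x.cost m + y.cost m
  | .sub x y => fieldCost F + x.cost m + y.cost m
  | .mul x y => fieldCost F + x.cost m + y.cost m

/-- Programs. The syntax does not depend on the field, the security parameter or the input. The
commands `call o` interact with the environment. -/
inductive Prog (Op : Type) : Type
  | skip
  | assign (a : ℕ) (i j e : NExpr)
  | fassign (a : ℕ) (i j : NExpr) (e : FExpr)
  /-- a uniformly random number below the value of `e` -/
  | sample (a : ℕ) (i j e : NExpr)
  /-- a uniformly random field element -/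
  | fsample (a : ℕ) (i j : NExpr)
  | seq (s t : Prog Op)
  /-- run `s` if the value of `c` is not `0`, otherwise `t` -/
  | ite (c : NExpr) (s t : Prog Op)
  /-- run the body for the values `0, …, e - 1` of the counter, kept in cell `(a, 0, 0)` -/
  | loop (a : ℕ) (e : NExpr) (body : Prog Op)
  | call (o : Op)

/-- A finite family of weighted branches. -/
abbrev Branches (α : Type) : Type := List (ℝ × α)

namespace Branches

variable {α β : Type}

def pure (x : α) : Branches α := [(1, x)]

def bind (l : Branches α) (f : α → Branches β) : Branches β :=
  l.flatMap fun p => (f p.2).map fun q => (p.1 * q.1, q.2)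

/-- `iter k f x` runs `f 0`, …, `f (k - 1)` one after the other. -/
def iter (f : ℕ → α → Branches α) : ℕ → α → Branches α
  | 0, x => pure x
  | k + 1, x => bind (iter f k x) (f k)

/-- Weighted sum over all branches. -/
def sum (l : Branches α) (g : α → ℝ) : ℝ := (l.map fun p => p.1 * g p.2).sum

end Branches

/-- Semantics of programs: the branches arising from random choices and from the interaction with
an environment with state space `E`, which is described by `h`. -/
def Prog.run {Op F E : Type} [Field F] [Fintype F] (h : Op → Mem F × E → Branches (Mem F × E)) :
    Prog Op → Mem F × E → Branches (Mem F × E)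
  | .skip, s => Branches.pure s
  | .assign a i j e, (m, x) =>
      Branches.pure ((m.setNat a (i.eval m) (j.eval m) (e.eval m)).tick
        (1 + i.cost m + j.cost m + e.cost m), x)
  | .fassign a i j e, (m, x) =>
      Branches.pure ((m.setFld a (i.eval m) (j.eval m) (e.eval m)).tick
        (1 + i.cost m + j.cost m + e.cost m), x)
  | .sample a i j e, (m, x) =>
      (List.range (e.eval m)).map fun k =>
        ((1 : ℝ) / (e.eval m : ℝ), ((m.setNat a (i.eval m) (j.eval m) k).tick
          (1 + i.cost m + j.cost m + e.cost m), x))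
  | .fsample a i j, (m, x) =>
      (Finset.univ : Finset F).toList.map fun y =>
        ((1 : ℝ) / (Fintype.card F : ℝ), ((m.setFld a (i.eval m) (j.eval m) y).tick
          (1 + i.cost m + j.cost m + fieldCost F), x))
  | .seq s t, y => Branches.bind (s.run h y) (t.run h)
  | .ite c s t, (m, x) =>
      if c.eval m ≠ 0 then s.run h (m.tick (1 + c.cost m), x)
      else t.run h (m.tick (1 + c.cost m), x)
  | .loop a e body, (m, x) =>
      Branches.iter
        (fun k y => body.run h ((y.1.setNat a 0 0 k).tick (1 + Nat.size k), y.2))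
        (e.eval m) (m.tick (1 + e.cost m), x)
  | .call o, y => h o y

/-! ### Layout of inputs, messages and outputs in memory -/

/-- Arrays of numbers: security parameter, number of vertices, adjacency matrix, challenge, kind
of response (`0` or `1`), permutation or cycle contained in the response, output. -/
abbrev aEta : ℕ := 0
abbrev aSize : ℕ := 1
abbrev aAdj : ℕ := 2
abbrev aCh : ℕ := 3
abbrev aKind : ℕ := 4
abbrev aPerm : ℕ := 5
abbrev aOut : ℕ := 6
/-- Arrays of field elements: message to the first prover, its answer, openings. -/
abbrev fRand : ℕ := 0
abbrev fCom : ℕ := 1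
abbrev fOpen : ℕ := 2

section Layout

variable {F : Type} {n : ℕ}

open Classical in
/-- Initial memory: only the security parameter and the graph. -/
def initMem [Field F] (η : ℕ) (G : SimpleGraph (Fin n)) : Mem F where
  nat := fun a i j =>
    if a = aEta then η
    else if a = aSize then n
    else if a = aAdj ∧ ∃ (hi : i < n) (hj : j < n), G.Adj ⟨i, hi⟩ ⟨j, hj⟩ then 1
    else 0
  fld := fun _ _ _ => 0
  cost := 0

def Mem.putMat (m : Mem F) (a : ℕ) (B : Mat F n) : Mem F :=
  { m with fld := fun a' i j =>
      if h : a' = a ∧ i < n ∧ j < n then B ⟨i, h.2.1⟩ ⟨j, h.2.2⟩ else m.fld a' i j }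

def Mem.getMat (m : Mem F) (n a : ℕ) : Mat F n := fun i j => m.fld a i j

def Mem.putCh (m : Mem F) (ch : Bool) : Mem F := m.setNat aCh 0 0 (if ch then 1 else 0)

def Mem.getCh (m : Mem F) : Bool := decide (m.nat aCh 0 0 ≠ 0)

def Mem.putPerm (m : Mem F) (p : Equiv.Perm (Fin n)) : Mem F :=
  { m with nat := fun a i j =>
      if h : a = aPerm ∧ i = 0 ∧ j < n then (p ⟨j, h.2.2⟩ : ℕ) else m.nat a i j }

def Mem.putResp (m : Mem F) : Resp F n → Mem F
  | .openAll Pi A => ((m.setNat aKind 0 0 0).putPerm Pi).putMat fOpen A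
  | .openCycle σ a =>
      let m' := (m.setNat aKind 0 0 1).putPerm σ
      { m' with fld := fun b i j =>
          if h : b = fOpen ∧ i = 0 ∧ j < n then a ⟨j, h.2.2⟩ else m'.fld b i j }

/-- The memory contains the response `r`. -/
def Mem.HoldsResp (m : Mem F) : Resp F n → Prop
  | .openAll Pi A => m.nat aKind 0 0 = 0 ∧ (∀ i : Fin n, m.nat aPerm 0 i = (Pi i : ℕ)) ∧
      ∀ i j : Fin n, m.fld fOpen i j = A i j
  | .openCycle σ a => m.nat aKind 0 0 = 1 ∧ (∀ i : Fin n, m.nat aPerm 0 i = (σ i : ℕ)) ∧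
      ∀ i : Fin n, m.fld fOpen 0 i = a i

/-- The output array contains a Hamiltonian cycle of `G`. -/
def Mem.HoldsWitness (m : Mem F) (G : SimpleGraph (Fin n)) : Prop :=
  ∃ w : Equiv.Perm (Fin n), IsHamCycle G w ∧ ∀ i : Fin n, m.nat aOut 0 i = (w i : ℕ)

end Layout

/-- Cost of transferring one message. -/
def msgCost (F : Type) [Fintype F] (n : ℕ) : ℕ := (1 + n + n ^ 2) * (fieldCost F + Nat.size n)

/-! ### Knowledge extractors -/

/-- Oracle commands of an extractor: activate prover `i` on the current message, measure its answer
into the memory, and undo the activation (rewinding). -/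
inductive ExtOp : Type
  | act1 | measure1 | undo1 | act2 | measure2 | undo2

/-- Effect of the oracle commands.  The quantum state is kept unnormalized: a measurement has one
branch for each outcome, and the probability of a branch is its weight times the squared norm of
its state. -/
def extHandler {F : Type} [Field F] [Fintype F] {n : ℕ} (P : Provers F n) :
    ExtOp → Mem F × (P.S1 × P.S2 → ℂ) → Branches (Mem F × (P.S1 × P.S2 → ℂ))
  | .act1, (m, v) =>
      Branches.pure (m.tick (msgCost F n),
        P.on1 (P.U1 (m.getMat n fRand) : Matrix P.S1 P.S1 ℂ) v)
  | .undo1, (m, v) =>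
      Branches.pure (m.tick (msgCost F n),
        P.on1 (P.U1 (m.getMat n fRand) : Matrix P.S1 P.S1 ℂ)ᴴ v)
  | .measure1, (m, v) =>
      (Finset.univ : Finset (Mat F n)).toList.map fun Y =>
        (1, ((m.putMat fCom Y).tick (msgCost F n), P.on1 (P.W1 Y) v))
  | .act2, (m, v) =>
      Branches.pure (m.tick (msgCost F n), P.on2 (P.U2 m.getCh : Matrix P.S2 P.S2 ℂ) v)
  | .undo2, (m, v) =>
      Branches.pure (m.tick (msgCost F n), P.on2 (P.U2 m.getCh : Matrix P.S2 P.S2 ℂ)ᴴ v)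
  | .measure2, (m, v) =>
      (Finset.univ : Finset (Resp F n)).toList.map fun r =>
        (1, ((m.putResp r).tick (msgCost F n), P.on2 (P.W2 r) v))

/-- An extractor: a polynomial-time oracle machine with classical control and classical queries,
which can rewind the provers. (It is a special quantum oracle machine.) -/
abbrev Extractor : Type := Prog ExtOp

section Extraction

variable {F : Type} [Field F] [Fintype F] {n : ℕ}

def Extractor.branches (K : Extractor) (η : ℕ) (G : SimpleGraph (Fin n)) (P : Provers F n) :
    Branches (Mem F × (P.S1 × P.S2 → ℂ)) :=
  K.run (extHandler P) (initMem η G, P.Φ)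

open Classical in
/-- Probability that the extractor outputs a Hamiltonian cycle of `G`. -/
def Extractor.successProb (K : Extractor) (η : ℕ) (G : SimpleGraph (Fin n)) (P : Provers F n) :
    ℝ :=
  (K.branches η G P).sum fun s => if s.1.HoldsWitness G then normSq s.2 else 0

end Extraction

/-- `f` is positive and polynomially bounded. -/
def PolyBounded (f : ℕ → ℝ) : Prop :=
  (∀ η, 0 < f η) ∧ ∃ C k : ℕ, ∀ η, f η ≤ C * ((η : ℝ) + 1) ^ k

/-- `f` is negligible. -/
def Negligible (f : ℕ → ℝ) : Prop :=
  Asymptotics.SuperpolynomialDecay Filter.atTop (fun η : ℕ => (η : ℝ)) f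

section Family

/- The field used with security parameter `η` and graphs on `n` vertices. -/
variable (F : ℕ → ℕ → Type) [∀ η n, Field (F η n)] [∀ η n, Fintype (F η n)]

/-- The running time of the extractor is polynomial in the security parameter and the size of the
graph, whatever the provers do. -/
def Extractor.IsPolyTime (K : Extractor) : Prop :=
  ∃ C k : ℕ, ∀ (n η : ℕ) (G : SimpleGraph (Fin n)) (P : Provers (F η n) n),
    ∀ b ∈ K.branches η G P, b.2.1.cost ≤ C * (n + η + 1) ^ k

/-- Validity, on graphs with `n` vertices, of the extractor `K` with knowledge error `κ`, exponent
`d` and loss factor `L`. -/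
def Extractor.IsValid (K : Extractor) (d n : ℕ) (κ : ℕ → ℝ)
    (L : (η : ℕ) → SimpleGraph (Fin n) → Provers (F η n) n → ℝ) : Prop :=
  ∀ (η : ℕ) (G : SimpleGraph (Fin n)) (P : Provers (F η n) n), κ η < P.acceptProb G →
    (1 / L η G P) * (P.acceptProb G - κ η) ^ d ≤ K.successProb η G P

/-- Non-triviality: honest provers are accepted with probability one. -/
def NonTrivial : Prop :=
  ∀ (n η : ℕ) (G : SimpleGraph (Fin n)) (w : Equiv.Perm (Fin n)), IsHamCycle G w →
    honestAcceptProb (F := F η n) G w = 1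

/-- The protocol is a quantum proof of knowledge with knowledge error `κ n η` for graphs on `n`
vertices and security parameter `η`, as witnessed by the extractor `K` and the exponent `d`. The
loss factor is polynomially bounded in the security parameter, for each number of vertices. -/
def IsQPoK (K : Extractor) (d : ℕ) (κ : ℕ → ℕ → ℝ) : Prop :=
  0 < d ∧ K.IsPolyTime F ∧ NonTrivial F ∧
    ∀ n, ∃ p : ℕ → ℝ, PolyBounded p ∧ K.IsValid F d n (κ n) (fun η _ _ => p η)

end Family

/-! ### Zero knowledge -/

/-- A malicious quantum verifier with quantum auxiliary input `ψ`. It may contact the provers in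
either order, choosing each message by a quantum measurement that depends on what it has seen so
far; the operators are the Kraus operators of the outcomes.  (Simultaneous messages are the case in
which the second message ignores the first answer.) -/
structure MaliciousVerifier (F : Type) [Fintype F] (n : ℕ) where
  S : Type
  [fin : Fintype S]
  [dec : DecidableEq S]
  ψ : S → ℂ
  norm_ψ : normSq ψ = 1
  /-- contact the first prover first, sending `B` -/
  first1 : Mat F n → Matrix S S ℂ
  /-- contact the second prover first, sending `ch` -/
  first2 : Bool → Matrix S S ℂ
  complete_first :
    ∑ B, (first1 B)ᴴ * first1 B + ∑ ch, (first2 ch)ᴴ * first2 ch = 1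
  /-- send `ch` to the second prover, after `B` and the answer `Y` of the first prover -/
  second2 : Mat F n → Mat F n → Bool → Matrix S S ℂ
  complete_second2 : ∀ B Y, ∑ ch, (second2 B Y ch)ᴴ * second2 B Y ch = 1
  /-- send `B` to the first prover, after `ch` and the answer `r` of the second prover -/
  second1 : Bool → Resp F n → Mat F n → Matrix S S ℂ
  complete_second1 : ∀ ch r, ∑ B, (second1 ch r B)ᴴ * second1 ch r B = 1

attribute [instance] MaliciousVerifier.fin MaliciousVerifier.dec

/-- A complete transcript; `firstIsP1` tells which prover was contacted first. -/
structure Transcript (F : Type) (n : ℕ) where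
  firstIsP1 : Bool
  B : Mat F n
  Y : Mat F n
  ch : Bool
  resp : Resp F n

/-- A simulator: a randomized machine without oracle and without witness, which plays both provers
towards the malicious verifier, for either order of the messages. -/
structure Simulator where
  first1 : Prog Empty
  second2 : Prog Empty
  first2 : Prog Empty
  second1 : Prog Empty

def runPlain {F : Type} [Field F] [Fintype F] (s : Prog Empty) (m : Mem F) :
    Branches (Mem F × Unit) :=
  s.run (fun o => o.elim) (m, ())

section ZK

variable {F : Type} [Field F] [Fintype F] {n : ℕ}

/-- The unnormalized final state of the verifier if the transcript is `t`; the verifier obtains the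
transcript `t` with probability `q`, given its own messages. -/
def MaliciousVerifier.view (V : MaliciousVerifier F n) (t : Transcript F n) (q : ℝ) :
    Matrix V.S V.S ℂ :=
  let v := if t.firstIsP1 then V.second2 t.B t.Y t.ch *ᵥ (V.first1 t.B *ᵥ V.ψ)
    else V.second1 t.ch t.resp t.B *ᵥ (V.first2 t.ch *ᵥ V.ψ)
  (q : ℂ) • Matrix.vecMulVec v (star v)

open Classical in
/-- Probability that the honest provers with witness `w` answer as in `t`. -/
def honestProb (G : SimpleGraph (Fin n)) (w : Equiv.Perm (Fin n)) (t : Transcript F n) : ℝ :=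
  (∑ Pi : Equiv.Perm (Fin n), ∑ A : Mat F n,
      if honestCom G Pi A t.B = t.Y ∧ honestResp w Pi A t.ch = t.resp then (1 : ℝ) else 0) /
    ((n ! : ℝ) * (Fintype.card (Mat F n) : ℝ))

/-- All branches of the simulator, given the messages of the verifier: the memory after its first
answer together with the memory after its second answer. -/
def Simulator.branches (S : Simulator) (η : ℕ) (G : SimpleGraph (Fin n)) (firstIsP1 : Bool)
    (B : Mat F n) (ch : Bool) : Branches (Mem F × Mem F) :=
  if firstIsP1 then
    Branches.bind (runPlain S.first1 ((initMem η G).putMat fRand B)) fun x =>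
      Branches.bind (runPlain S.second2 (x.1.putCh ch)) fun y => Branches.pure (x.1, y.1)
  else
    Branches.bind (runPlain S.first2 ((initMem η G).putCh ch)) fun x =>
      Branches.bind (runPlain S.second1 (x.1.putMat fRand B)) fun y => Branches.pure (x.1, y.1)

open Classical in
/-- Probability that the simulator answers as in `t`. -/
def Simulator.prob (S : Simulator) (η : ℕ) (G : SimpleGraph (Fin n)) (t : Transcript F n) : ℝ :=
  (S.branches η G t.firstIsP1 t.B t.ch).sum fun x =>
    if t.firstIsP1 then
      if x.1.getMat n fCom = t.Y ∧ x.2.HoldsResp t.resp then 1 else 0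
    else
      if x.1.HoldsResp t.resp ∧ x.2.getMat n fCom = t.Y then 1 else 0

end ZK

/-- Perfect zero knowledge against quantum verifiers: one polynomial-time simulator, which only
knows the graph and uses the verifier as a black box without rewinding it, produces exactly the
same joint state of transcript and verifier as the honest provers. -/
def IsPerfectZeroKnowledge (F : ℕ → ℕ → Type) [∀ η n, Field (F η n)] [∀ η n, Fintype (F η n)] :
    Prop :=
  ∃ S : Simulator,
    (∃ C k : ℕ, ∀ (n η : ℕ) (G : SimpleGraph (Fin n)) (o : Bool) (B : Mat (F η n) n) (ch : Bool),
      ∀ b ∈ S.branches η G o B ch, b.2.2.cost ≤ C * (n + η + 1) ^ k) ∧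
    ∀ (n η : ℕ) (G : SimpleGraph (Fin n)) (w : Equiv.Perm (Fin n)), IsHamCycle G w →
      ∀ (V : MaliciousVerifier (F η n) n) (t : Transcript (F η n) n),
        V.view t (S.prob η G t) = V.view t (honestProb G w t)

end RelHC

end

/-! Extraction. The extractor plays the verifier's first round with a uniform `B`, then asks the
second prover both challenges in random order, rewinding after each measurement. From a permutation
`p` answered to challenge 0 and a cycle `s` answered to challenge 1 it outputs `p⁻¹ * s * p`. If
both responses are accepted for the same `B`, `Y` and this is not a Hamiltonian cycle, then some
edge of `s` is a non-edge of `p(G)`. At that entry the two checks read `Y = A` and `Y = a + B`, so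
the responses determine an entry of `B` (`accepted_pair`). The second prover has no information on
`B` (`sum_pairWeight`), hence such pairs have probability at most `1/Q` for each order of the
challenges (`pairs_without_witness`).

It remains to bound below the probability that both responses are accepted. Let `P₀`, `P₁` be the
projections onto acceptance of the two challenges. If the average of their acceptance probabilities
is `V > 1/2`, then `‖P₀P₁v‖² + ‖P₁P₀v‖²` is on average at least `(2V - 1)²`. This follows from
`projections_in_succession`, an estimate that is linear in the probabilities once a parameter `c` is
fixed, so that it can be summed over `B` and `Y`. The extractor measures the whole response instead
of the single bit of acceptance; by Cauchy–Schwarz this loses a factor `N`, the number of accepted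
responses that can occur (`sum_pairs`). An accepted response is determined by its permutation, so `N
≤ n!`. Altogether `(2V - 1)² ≤ N (2 · success + 2/Q)`, and `ξ = √(n!/(2Q))` absorbs the term `2N/Q`
(`extraction`).

Zero knowledge. The simulator uses a random permutation of the standard `n`-cycle as if it were the
permuted witness. All `n`-cycles are conjugate, so this cycle is distributed like the honest one; a
uniform matrix hides the remaining entries. If the first prover is asked first, a uniform `Y` is
opened later by subtracting the required multiples of `B`; in the other order, uniform openings are
fixed first and the multiples of `B` are added later. Translations of the uniform matrix and of the
uniform permutation identify both distributions with the honest one (`simulated_sum_eq`).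

Both machines are explicit programs. Their output distributions are computed with loop invariants
(`Yields`, `Runs`); their running times follow from the syntactic criterion `Prog.Small` by
`Prog.poly_bound`, since no stored number ever exceeds the initial bound. -/

noncomputable section

namespace RelHC

/-! ### Branches -/

namespace Branches

variable {α β : Type}

theorem sum_pure (x : α) (g : α → ℝ) : (pure x).sum g = g x := by simp [pure, sum]

theorem sum_cons (p : ℝ × α) (l : Branches α) (g : α → ℝ) :
    sum (p :: l) g = p.1 * g p.2 + sum l g := by simp [sum]

theorem sum_append (l l' : Branches α) (g : α → ℝ) : sum (l ++ l') g = sum l g + sum l' g := by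
  simp [sum]

theorem sum_scale (c : ℝ) (l : Branches α) (g : α → ℝ) :
    sum (l.map fun q => (c * q.1, q.2)) g = c * sum l g := by
  induction l with
  | nil => simp [sum]
  | cons p l ih => rw [List.map_cons, sum_cons, sum_cons, ih]; ring

theorem bind_cons (p : ℝ × α) (l : Branches α) (f : α → Branches β) :
    bind (p :: l) f = ((f p.2).map fun q => (p.1 * q.1, q.2)) ++ bind l f := by
  simp [bind]

theorem sum_bind (l : Branches α) (f : α → Branches β) (g : β → ℝ) :
    (bind l f).sum g = l.sum fun x => (f x).sum g := by
  induction l with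
  | nil => simp [bind, sum]
  | cons p l ih => rw [bind_cons, sum_append, sum_scale, sum_cons, ih]

theorem pure_bind (x : α) (f : α → Branches β) : bind (pure x) f = f x := by
  simp [bind, pure]

theorem mem_bind {l : Branches α} {f : α → Branches β} {b : ℝ × β} (hb : b ∈ bind l f) :
    ∃ p ∈ l, ∃ q ∈ f p.2, b.2 = q.2 := by
  simp only [bind, List.mem_flatMap, List.mem_map] at hb
  obtain ⟨p, hp, q, hq, rfl⟩ := hb
  exact ⟨p, hp, q, hq, rfl⟩

theorem sum_map_toList {R : Type} [Fintype R] (w : ℝ) (f : R → α) (g : α → ℝ) :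
    sum ((Finset.univ : Finset R).toList.map fun r => (w, f r)) g = w * ∑ r, g (f r) := by
  rw [Finset.mul_sum, ← Finset.sum_map_toList]
  simp [sum, Function.comp_def]

/-- The branches consist of a single one, of weight one, whose value satisfies `P`. -/
def Yields (l : Branches α) (P : α → Prop) : Prop := ∃ x, l = pure x ∧ P x

/-- The branches are indexed by `R`, all with weight `w`; the value of branch `r` satisfies
`P r`. -/
def Runs (l : Branches α) (R : Type) [Fintype R] (w : ℝ) (P : R → α → Prop) : Prop :=
  ∃ f : R → α, (∀ r, P r (f r)) ∧ ∀ g, l.sum g = w * ∑ r, g (f r)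

theorem Yields.mono {l : Branches α} {P Q : α → Prop} (h : Yields l P) (hPQ : ∀ x, P x → Q x) :
    Yields l Q := by
  obtain ⟨x, hx, hP⟩ := h
  exact ⟨x, hx, hPQ x hP⟩

theorem yields_pure {x : α} {P : α → Prop} (h : P x) : Yields (pure x) P := ⟨x, rfl, h⟩

theorem Yields.bind {l : Branches α} {P : α → Prop} {k : α → Branches β} {Q : β → Prop}
    (h : Yields l P) (hk : ∀ x, P x → Yields (k x) Q) : Yields (bind l k) Q := by
  obtain ⟨x, rfl, hP⟩ := h
  rw [pure_bind]
  exact hk x hP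

/-- The rule for deterministic loops: `P k` is the invariant after `k` completed rounds. -/
theorem Yields.iter {f : ℕ → α → Branches α} (P : ℕ → α → Prop) {x : α} (N : ℕ) (h0 : P 0 x)
    (hs : ∀ k < N, ∀ y, P k y → Yields (f k y) (P (k + 1))) :
    Yields (iter f N x) (P N) := by
  induction N with
  | zero => exact yields_pure h0
  | succ k ih =>
    exact (ih fun j hj => hs j (by omega)).bind (hs k (by omega))

/-! ### Uniformly weighted random choices -/

variable {R S : Type} [Fintype R] [Fintype S]

theorem Runs.mono {l : Branches α} {w : ℝ} {P Q : R → α → Prop} (h : Runs l R w P)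
    (hPQ : ∀ r x, P r x → Q r x) : Runs l R w Q := by
  obtain ⟨f, hf, hg⟩ := h
  exact ⟨f, fun r => hPQ r _ (hf r), hg⟩

theorem Runs.reindex {l : Branches α} {w : ℝ} {P : R → α → Prop} (h : Runs l R w P)
    (e : S ≃ R) : Runs l S w fun s => P (e s) := by
  obtain ⟨f, hf, hg⟩ := h
  exact ⟨fun s => f (e s), fun s => hf _, fun g => by
    rw [hg, Equiv.sum_comp e fun r => g (f r)]⟩

/-- The weight `w'` of the second choice is the same for every `r`, so the pair of choices is again
uniformly weighted, by the product. All random choices in the machines are of this kind. -/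
theorem Runs.bind {l : Branches α} {w w' : ℝ} {P : R → α → Prop} {k : α → Branches β}
    {Q : R × S → β → Prop} (h : Runs l R w P)
    (hk : ∀ r x, P r x → Runs (k x) S w' fun s => Q (r, s)) :
    Runs (Branches.bind l k) (R × S) (w * w') Q := by
  obtain ⟨f, hf, hg⟩ := h
  choose f' hf' hg' using fun r => hk r _ (hf r)
  refine ⟨fun p => f' p.1 p.2, fun p => hf' _ _, fun g => ?_⟩
  rw [sum_bind, hg, Fintype.sum_prod_type]
  simp_rw [hg', ← Finset.mul_sum]
  ring

theorem Runs.bind_yields {l : Branches α} {w : ℝ} {P : R → α → Prop} {k : α → Branches β}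
    {Q : R → β → Prop} (h : Runs l R w P) (hk : ∀ r x, P r x → Yields (k x) (Q r)) :
    Runs (Branches.bind l k) R w Q := by
  obtain ⟨f, hf, hg⟩ := h
  choose f' hf' hg' using fun r => hk r _ (hf r)
  refine ⟨f', hg', fun g => ?_⟩
  rw [sum_bind, hg]
  simp_rw [hf', sum_pure]

theorem runs_map_toList {w : ℝ} {f : R → α} {P : R → α → Prop} (h : ∀ r, P r (f r)) :
    Runs ((Finset.univ : Finset R).toList.map fun r => (w, f r)) R w P :=
  ⟨f, h, fun g => sum_map_toList w f g⟩

theorem runs_map_range {N : ℕ} {w : ℝ} {f : ℕ → α} {P : Fin N → α → Prop}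
    (h : ∀ r : Fin N, P r (f r)) :
    Runs ((List.range N).map fun k => (w, f k)) (Fin N) w P := by
  refine ⟨fun r => f r, h, fun g => ?_⟩
  rw [Finset.mul_sum, Fin.sum_univ_eq_sum_range (fun k => w * g (f k)), sum, List.map_map]
  induction N with
  | zero => simp
  | succ N ih =>
    rw [List.range_succ, List.map_append, List.sum_append, Finset.sum_range_succ,
      ih (P := fun _ _ => True) fun _ => trivial]
    simp

/-- Branches of a loop whose `k`-th round makes an independent choice from `T k`. -/
theorem Runs.iter {f : ℕ → α → Branches α} {A T : ℕ → Type} [∀ k, Fintype (A k)]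
    [∀ k, Fintype (T k)] [Unique (A 0)] (e : ∀ k, A (k + 1) ≃ A k × T k) (w : ℕ → ℝ)
    (P : ∀ k, A k → α → Prop) {x : α} (N : ℕ) (h0 : P 0 default x)
    (hs : ∀ k < N, ∀ r y, P k r y →
      Runs (f k y) (T k) (w k) fun t => P (k + 1) ((e k).symm (r, t))) :
    Runs (iter f N x) (A N) (∏ k ∈ Finset.range N, w k) (P N) := by
  induction N with
  | zero =>
    refine ⟨fun _ => x, fun r => Unique.eq_default r ▸ h0, fun g => ?_⟩
    simp [Branches.iter, sum_pure]
  | succ k ih =>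
    have h := Runs.bind (Q := fun p => P (k + 1) ((e k).symm p))
      (ih fun j hj => hs j (by omega)) (hs k (by omega))
    have h' := h.reindex (e k)
    rw [Finset.prod_range_succ]
    exact h'.mono fun r x hx => by simpa using hx

/-- A loop in which each round makes an independent choice from `S`. -/
theorem Runs.iter_fun {f : ℕ → α → Branches α} (w : ℝ)
    (P : ∀ k, (Fin k → S) → α → Prop) {x : α} (N : ℕ) (h0 : P 0 default x)
    (hs : ∀ k < N, ∀ r y, P k r y →
      Runs (f k y) S w fun t => P (k + 1) (Fin.snoc (α := fun _ => S) r t)) :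
    Runs (Branches.iter f N x) (Fin N → S) (w ^ N) (P N) := by
  have h := Runs.iter (A := fun k => Fin k → S) (T := fun _ => S) (f := f) (x := x)
    (fun k => ((Equiv.prodComm _ _).trans (Fin.snocEquiv fun _ : Fin (k + 1) => S)).symm)
    (fun _ => w) P N h0 (fun k hk r y hy => by simpa [Fin.snocEquiv] using hs k hk r y hy)
  simpa using h

end Branches

/-! ### Memory frames -/

namespace Mem

variable {F : Type}

/-- The two memories agree on the arrays of numbers outside `S`. -/
def AgreeNat (S : Set ℕ) (m m' : Mem F) : Prop := ∀ a ∉ S, m'.nat a = m.nat a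

/-- The two memories agree on the arrays of field elements outside `S`. -/
def AgreeFld (S : Set ℕ) (m m' : Mem F) : Prop := ∀ a ∉ S, m'.fld a = m.fld a

theorem AgreeNat.refl (S : Set ℕ) (m : Mem F) : AgreeNat S m m := fun _ _ => rfl

theorem AgreeFld.refl (S : Set ℕ) (m : Mem F) : AgreeFld S m m := fun _ _ => rfl

theorem AgreeNat.trans {S : Set ℕ} {m m' m'' : Mem F} (h : AgreeNat S m m')
    (h' : AgreeNat S m' m'') : AgreeNat S m m'' := fun a ha => (h' a ha).trans (h a ha)

theorem AgreeNat.mono {S T : Set ℕ} {m m' : Mem F} (h : AgreeNat S m m') (hST : S ⊆ T) :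
    AgreeNat T m m' := fun a ha => h a fun h' => ha (hST h')

theorem tick_nat (m : Mem F) (k : ℕ) : (m.tick k).nat = m.nat := rfl

theorem tick_fld (m : Mem F) (k : ℕ) : (m.tick k).fld = m.fld := rfl

theorem setNat_fld (m : Mem F) (a i j x : ℕ) : (m.setNat a i j x).fld = m.fld := rfl

theorem setFld_nat (m : Mem F) (a i j : ℕ) (x : F) : (m.setFld a i j x).nat = m.nat := rfl

theorem setNat_nat (m : Mem F) (a i j x a' i' j' : ℕ) :
    (m.setNat a i j x).nat a' i' j' = if a' = a ∧ i' = i ∧ j' = j then x else m.nat a' i' j' := rfl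

theorem setFld_fld (m : Mem F) (a i j : ℕ) (x : F) (a' i' j' : ℕ) :
    (m.setFld a i j x).fld a' i' j' = if a' = a ∧ i' = i ∧ j' = j then x else m.fld a' i' j' := rfl

theorem setNat_nat_of_ne (m : Mem F) {a a' : ℕ} (i j x : ℕ) (h : a' ≠ a) :
    (m.setNat a i j x).nat a' = m.nat a' := by
  funext i' j'
  simp [setNat_nat, h]

theorem setFld_fld_of_ne (m : Mem F) {a a' : ℕ} (i j : ℕ) (x : F) (h : a' ≠ a) :
    (m.setFld a i j x).fld a' = m.fld a' := by
  funext i' j'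
  simp [setFld_fld, h]

end Mem

/-! ### Bounds on the running time -/

/-- All numbers in the memory are at most `M`. -/
def Mem.NatLE {F : Type} (M : ℕ) (m : Mem F) : Prop := ∀ a i j, m.nat a i j ≤ M

theorem Mem.NatLE.setNat {F : Type} {M : ℕ} {m : Mem F} (h : m.NatLE M) {a i j x : ℕ}
    (hx : x ≤ M) : (m.setNat a i j x).NatLE M := by
  intro a' i' j'
  rw [Mem.setNat_nat]
  split_ifs
  exacts [hx, h _ _ _]

theorem size_le_self (k : ℕ) : Nat.size k ≤ k := Nat.size_le.2 k.lt_two_pow_self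

/-- A common polynomial bound for two. -/
theorem poly_add_le (C k C' k' X : ℕ) (hX : 1 ≤ X) :
    C * X ^ k + C' * X ^ k' ≤ (C + C') * X ^ (k + k') := by
  have h1 : X ^ k ≤ X ^ (k + k') := Nat.pow_le_pow_right hX (by omega)
  have h2 : X ^ k' ≤ X ^ (k + k') := Nat.pow_le_pow_right hX (by omega)
  nlinarith [Nat.mul_le_mul_left C h1, Nat.mul_le_mul_left C' h2]

/-- Values have to be bounded together with costs, because a node is charged the bit length of its
value. An expression is a fixed tree, so its finitely many multiplications only increase the degree.
The constants depend on the expression alone. -/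
theorem NExpr.poly_bound (e : NExpr) : ∃ C k : ℕ, ∀ (F : Type) (X : ℕ) (m : Mem F), 1 ≤ X →
    m.NatLE X → e.eval m ≤ C * X ^ k ∧ e.cost m ≤ C * X ^ k := by
  have key : ∀ x y C k C' k' X : ℕ, 1 ≤ X → x ≤ C * X ^ k → y ≤ C' * X ^ k' →
      x + y ≤ (C + C') * X ^ (k + k') := fun x y C k C' k' X hX h h' =>
    (add_le_add h h').trans (poly_add_le C k C' k' X hX)
  have one : ∀ x X k : ℕ, 1 ≤ X → x ≤ x * X ^ k := fun x X k hX =>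
    Nat.le_mul_of_pos_right _ (Nat.pow_pos hX)
  induction e with
  | const c =>
    refine ⟨1 + c, 0, fun F X m hX hm => ?_⟩
    have := size_le_self c
    simp only [NExpr.eval, NExpr.cost, pow_zero, mul_one]
    omega
  | get a i j hi hj =>
    obtain ⟨C, k, hi⟩ := hi
    obtain ⟨C', k', hj⟩ := hj
    -- The node itself costs `1` plus the bit length of a stored number, hence at most `1 + X ≤ 2 *
    -- X`.
    refine ⟨1 + 1 + (C + C'), 0 + 1 + (k + k'), fun F X m hX hm => ?_⟩
    have h1 := hm a (i.eval m) (j.eval m)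
    have h2 := size_le_self (m.nat a (i.eval m) (j.eval m))
    have := key (1 + X) _ 2 1 _ _ X hX (by rw [pow_one]; omega)
      (key _ _ _ _ _ _ X hX (hi F X m hX hm).2 (hj F X m hX hm).2)
    simp only [NExpr.eval, NExpr.cost]
    rw [show 1 + 1 + (C + C') = 2 + (C + C') by ring, show 0 + 1 + (k + k') = 1 + (k + k') by ring]
    omega
  | add x y hx hy | sub x y hx hy =>
    obtain ⟨C, k, hi⟩ := hx
    obtain ⟨C', k', hj⟩ := hy
    refine ⟨1 + ((C + C') + (C + C')), 0 + ((k + k') + (k + k')), fun F X m hX hm => ?_⟩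
    have h1 := key _ _ _ _ _ _ X hX (hi F X m hX hm).1 (hj F X m hX hm).1
    have h2 := key _ _ _ _ _ _ X hX (hi F X m hX hm).2 (hj F X m hX hm).2
    have h3 := key 1 _ 1 0 _ _ X hX (by simp) (key _ _ _ _ _ _ X hX h1 h2)
    have := size_le_self (x.eval m + y.eval m)
    have := size_le_self (x.eval m - y.eval m)
    simp only [NExpr.eval, NExpr.cost]
    omega
  | mul x y hx hy =>
    obtain ⟨C, k, hi⟩ := hx
    obtain ⟨C', k', hj⟩ := hy
    refine ⟨1 + ((C * C') + (C + C')), 0 + ((k + k') + (k + k')), fun F X m hX hm => ?_⟩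
    have h1 : x.eval m * y.eval m ≤ (C * C') * X ^ (k + k') := by
      refine (Nat.mul_le_mul (hi F X m hX hm).1 (hj F X m hX hm).1).trans (le_of_eq ?_)
      ring
    have h2 := key _ _ _ _ _ _ X hX (hi F X m hX hm).2 (hj F X m hX hm).2
    have h3 := key 1 _ 1 0 _ _ X hX (by simp) (key _ _ _ _ _ _ X hX h1 h2)
    have := size_le_self (x.eval m * y.eval m)
    simp only [NExpr.eval, NExpr.cost]
    omega
  | lt x y hx hy | eq x y hx hy =>
    obtain ⟨C, k, hi⟩ := hx
    obtain ⟨C', k', hj⟩ := hy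
    refine ⟨2 + (C + C'), 0 + (k + k'), fun F X m hX hm => ?_⟩
    have h2 := key _ _ _ _ _ _ X hX (hi F X m hX hm).2 (hj F X m hX hm).2
    have h3 := key 2 _ 2 0 _ _ X hX (by simp) h2
    simp only [NExpr.eval, NExpr.cost]
    refine ⟨?_, by omega⟩
    split_ifs <;> omega

theorem FExpr.poly_bound (e : FExpr) : ∃ C k : ℕ, ∀ (F : Type) [Fintype F] (X : ℕ) (m : Mem F),
    1 ≤ X → m.NatLE X → fieldCost F ≤ X → e.cost m ≤ C * X ^ k := by
  have key : ∀ x y C k C' k' X : ℕ, 1 ≤ X → x ≤ C * X ^ k → y ≤ C' * X ^ k' →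
      x + y ≤ (C + C') * X ^ (k + k') := fun x y C k C' k' X hX h h' =>
    (add_le_add h h').trans (poly_add_le C k C' k' X hX)
  induction e with
  | zero | one => exact ⟨1, 1, fun F _ X m hX hm hF => by simpa [FExpr.cost] using hF⟩
  | get a i j =>
    obtain ⟨C, k, hi⟩ := i.poly_bound
    obtain ⟨C', k', hj⟩ := j.poly_bound
    refine ⟨1 + C + C', 1 + k + k', fun F _ X m hX hm hF => ?_⟩
    exact key _ _ _ _ _ _ X hX (key _ _ _ _ _ _ X hX (by simpa using hF) (hi F X m hX hm).2)
      (hj F X m hX hm).2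
  | add x y hx hy | sub x y hx hy | mul x y hx hy =>
    obtain ⟨C, k, hi⟩ := hx
    obtain ⟨C', k', hj⟩ := hy
    refine ⟨1 + C + C', 1 + k + k', fun F _ X m hX hm hF => ?_⟩
    exact key _ _ _ _ _ _ X hX (key _ _ _ _ _ _ X hX (by simpa using hF) (hi F X m hX hm hF))
      (hj F X m hX hm hF)

/-- The value of `e` is at most `M + c` in every memory whose numbers are at most `M ≥ 1`. -/
def NExpr.Small (c : ℕ) (e : NExpr) : Prop :=
  ∀ (F : Type) (M : ℕ) (m : Mem F), 1 ≤ M → m.NatLE M → e.eval m ≤ M + c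

/-- The program never stores a number that exceeds all the numbers already present. -/
def Prog.Small {Op : Type} : Prog Op → Prop
  | .skip => True
  | .assign _ _ _ e => e.Small 0
  | .fassign _ _ _ _ => True
  | .sample _ _ _ e => e.Small 1
  | .fsample _ _ _ => True
  | .seq s t => s.Small ∧ t.Small
  | .ite _ s t => s.Small ∧ t.Small
  | .loop _ e body => e.Small 1 ∧ body.Small
  | .call _ => True

/-- The invariant `I` carries the bound on the stored numbers, under which each round costs at most
`c`. -/
theorem Branches.iter_cost {α : Type} {f : ℕ → α → Branches α} (I : α → Prop) (cost : α → ℕ)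
    (c N : ℕ) (hf : ∀ k < N, ∀ x, I x → ∀ b ∈ f k x, I b.2 ∧ cost b.2 ≤ cost x + c) {x : α}
    (hx : I x) : ∀ b ∈ Branches.iter f N x, I b.2 ∧ cost b.2 ≤ cost x + N * c := by
  induction N with
  | zero =>
    intro b hb
    simp only [Branches.iter, Branches.pure, List.mem_singleton] at hb
    subst hb
    simpa using hx
  | succ N ih =>
    intro b hb
    obtain ⟨p, hp, q, hq, hbq⟩ := Branches.mem_bind hb
    have h1 := ih (fun k hk => hf k (by omega)) p hp
    have h2 := hf N (by omega) p.2 h1.1 q hq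
    rw [hbq]
    refine ⟨h2.1, h2.2.trans ?_⟩
    rw [Nat.succ_mul]
    omega

/-- The cost of a program is polynomial in the numbers present, the cost of field operations and
the cost of oracle calls. -/
theorem Prog.poly_bound {Op : Type} (p : Prog Op) (hp : p.Small) : ∃ C k : ℕ,
    ∀ (F E : Type) [Field F] [Fintype F] (h : Op → Mem F × E → Branches (Mem F × E)) (M X : ℕ),
      1 ≤ M → M ≤ X → fieldCost F ≤ X →
      (∀ o s, s.1.NatLE M → ∀ b ∈ h o s, b.2.1.NatLE M ∧ b.2.1.cost ≤ s.1.cost + X) →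
      ∀ s, s.1.NatLE M → ∀ b ∈ p.run h s, b.2.1.NatLE M ∧ b.2.1.cost ≤ s.1.cost + C * X ^ k := by
  have key : ∀ x y C k C' k' X : ℕ, 1 ≤ X → x ≤ C * X ^ k → y ≤ C' * X ^ k' →
      x + y ≤ (C + C') * X ^ (k + k') := fun x y C k C' k' X hX h h' =>
    (add_le_add h h').trans (poly_add_le C k C' k' X hX)
  have mono : ∀ {F : Type} {m : Mem F} {M X : ℕ}, m.NatLE M → M ≤ X → m.NatLE X :=
    fun hm hMX a i j => (hm a i j).trans hMX
  induction p with
  | skip =>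
    refine ⟨0, 0, fun F E _ _ h M X hM hMX hF hh s hs b hb => ?_⟩
    simp only [Prog.run, Branches.pure, List.mem_singleton] at hb
    subst hb
    simpa using hs
  | assign a i j e =>
    obtain ⟨C, k, hi⟩ := i.poly_bound
    obtain ⟨C', k', hj⟩ := j.poly_bound
    obtain ⟨D, l, he⟩ := e.poly_bound
    refine ⟨1 + C + C' + D, 0 + k + k' + l, fun F E _ _ h M X hM hMX hF hh s hs b hb => ?_⟩
    obtain ⟨m, x⟩ := s
    simp only [Prog.run, Branches.pure, List.mem_singleton] at hb
    subst hb
    have hX : 1 ≤ X := hM.trans hMX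
    have hs' := mono hs hMX
    refine ⟨Mem.NatLE.setNat hs (hp F M m hM hs), Nat.add_le_add_left ?_ _⟩
    exact key _ _ _ _ _ _ X hX (key _ _ _ _ _ _ X hX (key _ _ _ _ _ _ X hX (by simp)
      (hi F X m hX hs').2) (hj F X m hX hs').2) (he F X m hX hs').2
  | fassign a i j e =>
    obtain ⟨C, k, hi⟩ := i.poly_bound
    obtain ⟨C', k', hj⟩ := j.poly_bound
    obtain ⟨D, l, he⟩ := e.poly_bound
    refine ⟨1 + C + C' + D, 0 + k + k' + l, fun F E _ _ h M X hM hMX hF hh s hs b hb => ?_⟩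
    obtain ⟨m, x⟩ := s
    simp only [Prog.run, Branches.pure, List.mem_singleton] at hb
    subst hb
    have hX : 1 ≤ X := hM.trans hMX
    have hs' := mono hs hMX
    refine ⟨hs, Nat.add_le_add_left ?_ _⟩
    exact key _ _ _ _ _ _ X hX (key _ _ _ _ _ _ X hX (key _ _ _ _ _ _ X hX (by simp)
      (hi F X m hX hs').2) (hj F X m hX hs').2) (he F X m hX hs' hF)
  | sample a i j e =>
    obtain ⟨C, k, hi⟩ := i.poly_bound
    obtain ⟨C', k', hj⟩ := j.poly_bound
    obtain ⟨D, l, he⟩ := e.poly_bound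
    refine ⟨1 + C + C' + D, 0 + k + k' + l, fun F E _ _ h M X hM hMX hF hh s hs b hb => ?_⟩
    obtain ⟨m, x⟩ := s
    simp only [Prog.run, List.mem_map, List.mem_range] at hb
    obtain ⟨v, hv, rfl⟩ := hb
    have hX : 1 ≤ X := hM.trans hMX
    have hs' := mono hs hMX
    -- The sampled number is strictly below the value of `e`, which is at most `M + 1`; so it is at
    -- most `M`.
    have hv' := hp F M m hM hs
    refine ⟨Mem.NatLE.setNat hs (by omega), Nat.add_le_add_left ?_ _⟩
    exact key _ _ _ _ _ _ X hX (key _ _ _ _ _ _ X hX (key _ _ _ _ _ _ X hX (by simp)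
      (hi F X m hX hs').2) (hj F X m hX hs').2) (he F X m hX hs').2
  | fsample a i j =>
    obtain ⟨C, k, hi⟩ := i.poly_bound
    obtain ⟨C', k', hj⟩ := j.poly_bound
    refine ⟨1 + C + C' + 1, 0 + k + k' + 1, fun F E _ _ h M X hM hMX hF hh s hs b hb => ?_⟩
    obtain ⟨m, x⟩ := s
    simp only [Prog.run, List.mem_map] at hb
    obtain ⟨v, hv, rfl⟩ := hb
    have hX : 1 ≤ X := hM.trans hMX
    have hs' := mono hs hMX
    refine ⟨hs, Nat.add_le_add_left ?_ _⟩
    exact key _ _ _ _ _ _ X hX (key _ _ _ _ _ _ X hX (key _ _ _ _ _ _ X hX (by simp)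
      (hi F X m hX hs').2) (hj F X m hX hs').2) (by simpa using hF)
  | seq s t ihs iht =>
    obtain ⟨C, k, hs⟩ := ihs hp.1
    obtain ⟨C', k', ht⟩ := iht hp.2
    refine ⟨C + C', k + k', fun F E _ _ h M X hM hMX hF hh x hx b hb => ?_⟩
    obtain ⟨p, hp', q, hq, hbq⟩ := Branches.mem_bind hb
    have h1 := hs F E h M X hM hMX hF hh x hx p hp'
    have h2 := ht F E h M X hM hMX hF hh p.2 h1.1 q hq
    have := poly_add_le C k C' k' X (hM.trans hMX)
    rw [hbq]
    exact ⟨h2.1, by omega⟩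
  | ite c s t ihs iht =>
    obtain ⟨D, l, hc⟩ := c.poly_bound
    obtain ⟨C, k, hs⟩ := ihs hp.1
    obtain ⟨C', k', ht⟩ := iht hp.2
    refine ⟨1 + D + (C + C'), 0 + l + (k + k'), fun F E _ _ h M X hM hMX hF hh x hx b hb => ?_⟩
    obtain ⟨m, x⟩ := x
    have hX : 1 ≤ X := hM.trans hMX
    have hc' := key 1 _ 1 0 _ _ X hX (by simp) (hc F X m hX (mono hx hMX)).2
    have h0 := poly_add_le C k C' k' X hX
    have h3 := key _ _ _ _ _ _ X hX hc' h0
    rw [Prog.run] at hb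
    split_ifs at hb
    · have h1 := hs F E h M X hM hMX hF hh (m.tick (1 + c.cost m), x) hx b hb
      refine ⟨h1.1, h1.2.trans ?_⟩
      simp only [Mem.tick]
      omega
    · have h1 := ht F E h M X hM hMX hF hh (m.tick (1 + c.cost m), x) hx b hb
      refine ⟨h1.1, h1.2.trans ?_⟩
      simp only [Mem.tick]
      omega
  | loop a e body ih =>
    obtain ⟨D, l, he⟩ := e.poly_bound
    obtain ⟨C, k, hb'⟩ := ih hp.2
    -- `1 + D` accounts for evaluating the number of rounds. There are at most `D * X ^ l` rounds;
    -- each costs at most `2 * X` for the counter and `C * X ^ k` for the body, together at most `(2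
    -- + C) * X ^ (1 + k)`.
    refine ⟨(1 + D) + D * (2 + C), (0 + l) + (l + (1 + k)),
      fun F E _ _ h M X hM hMX hF hh x hx b hb => ?_⟩
    obtain ⟨m, x⟩ := x
    have hX : 1 ≤ X := hM.trans hMX
    have he' := he F X m hX (mono hx hMX)
    have hM' := hp.1 F M m hM hx
    rw [Prog.run] at hb
    have := Branches.iter_cost (fun s : Mem F × E => s.1.NatLE M) (fun s => s.1.cost)
      ((2 + C) * X ^ (1 + k)) (e.eval m) ?_ (x := (m.tick (1 + e.cost m), x)) hx b hb
    · refine ⟨this.1, this.2.trans ?_⟩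
      simp only [Mem.tick]
      rw [add_assoc]
      refine Nat.add_le_add_left (key _ _ _ _ _ _ X hX (key _ _ _ _ _ _ X hX (by simp) he'.2) ?_) _
      refine (Nat.mul_le_mul_right _ he'.1).trans (le_of_eq ?_)
      ring
    · intro v hv y hy b hb
      have hsz := size_le_self v
      -- The counter stays strictly below a value that is at most `M + 1`, so storing it respects
      -- the bound `M`.
      have h1 := hb' F E h M X hM hMX hF hh ((y.1.setNat a 0 0 v).tick (1 + v.size), y.2)
        (Mem.NatLE.setNat hy (by omega)) b hb
      refine ⟨h1.1, h1.2.trans ?_⟩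
      simp only [Mem.tick, Mem.setNat]
      rw [add_assoc]
      exact Nat.add_le_add_left (key _ _ 2 1 _ _ X hX (by rw [pow_one]; omega) le_rfl) _
  | call o =>
    refine ⟨1, 1, fun F E _ _ h M X hM hMX hF hh s hs b hb => ?_⟩
    simpa using hh o s hs b hb

theorem NExpr.small_const {c : ℕ} (hc : c ≤ 1) : (NExpr.const c).Small 0 :=
  fun _ _ _ hM _ => by simp only [NExpr.eval]; omega

theorem NExpr.small_get (a : ℕ) (i j : NExpr) : (NExpr.get a i j).Small 0 :=
  fun _ _ _ _ hm => hm _ _ _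

theorem NExpr.Small.succ {e : NExpr} (h : e.Small 0) : e.Small 1 :=
  fun F M m hM hm => (h F M m hM hm).trans (by omega)


/-! ### Building blocks of the extractor and the simulator -/

/-- The cell `(a, 0, 0)`. -/
abbrev NExpr.cell (a : ℕ) : NExpr := .get a (.const 0) (.const 0)

/-- Array of numbers whose rows are the permutations used by the machines, and the array with the
inverse of the first row. -/
abbrev aRows : ℕ := 10
abbrev aInv : ℕ := 11
/-- Cells for counters and for random numbers. -/
abbrev aRow : ℕ := 20
abbrev aCol : ℕ := 21
abbrev aTmp : ℕ := 22

/-- Run `s` for every vertex. -/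
def Prog.forVertices {Op : Type} (a : ℕ) (s : Prog Op) : Prog Op := .loop a (.cell aSize) s

/-- Fill the matrix `f` with random field elements. -/
def Prog.fillMat {Op : Type} (f : ℕ) : Prog Op :=
  .forVertices aRow (.forVertices aCol (.fsample f (.cell aRow) (.cell aCol)))

/-- Write a random permutation into row `0` of `aRows`. -/
def Prog.samplePerm {Op : Type} : Prog Op :=
  .forVertices aRow <|
    .seq (.sample aTmp (.const 0) (.const 0) (.add (.cell aRow) (.const 1))) <|
    .seq (.assign aRows (.const 0) (.cell aRow) (.get aRows (.const 0) (.cell aTmp)))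
      (.assign aRows (.const 0) (.cell aTmp) (.cell aRow))

/-! ### Uniform matrices and permutations -/

section

variable {Op F E : Type} [Field F] [Fintype F] (h : Op → Mem F × E → Branches (Mem F × E))

/-- The costs added by evaluating the bound and by setting the counter are left arbitrary, so that
invariants need not mention them. -/
theorem yields_forVertices (a : ℕ) (s : Prog Op) {n : ℕ} (P : ℕ → Mem F → Prop) {m : Mem F} {x : E}
    (hn : m.nat aSize 0 0 = n)
    (h0 : ∀ k, P 0 (m.tick k))
    (hs : ∀ (k : Fin n) m', P k m' → ∀ c, Branches.Yields
      (s.run h ((m'.setNat a 0 0 k).tick c, x)) fun y : Mem F × E => P (k + 1) y.1 ∧ y.2 = x) :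
    Branches.Yields ((Prog.forVertices a s).run h (m, x)) fun y : Mem F × E => P n y.1 ∧ y.2 = x := by
  have hn' : (NExpr.cell aSize).eval m = n := hn
  simp only [Prog.forVertices, Prog.run, hn']
  refine Branches.Yields.iter (fun k (y : Mem F × E) => P k y.1 ∧ y.2 = x) n ⟨h0 _, rfl⟩ ?_
  rintro k hk ⟨m', x'⟩ ⟨hP, rfl⟩
  exact hs ⟨k, hk⟩ m' hP _

theorem runs_fillMat (f : ℕ) {n : ℕ} {m : Mem F} {x : E} (hn : m.nat aSize 0 0 = n) :
    Branches.Runs ((Prog.fillMat f).run h (m, x)) (Mat F n) (1 / (Fintype.card F : ℝ) ^ (n * n))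
      fun B y => y.2 = x ∧ (∀ i j : Fin n, y.1.fld f i j = B i j) ∧
        Mem.AgreeFld {f} m y.1 ∧ Mem.AgreeNat {aRow, aCol} m y.1 := by
  -- The inner loop fills row `k` with independent entries. That it leaves the other rows alone is
  -- needed for the invariant of the outer loop.
  have key : ∀ (k : ℕ) (m' : Mem F), Mem.AgreeFld {f} m m' → Mem.AgreeNat {aRow, aCol} m m' →
      m'.nat aRow 0 0 = k →
      Branches.Runs ((Prog.forVertices aCol (.fsample f (.cell aRow) (.cell aCol))).run h (m', x))
        (Fin n → F) ((1 / (Fintype.card F : ℝ)) ^ n)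
        fun r y => y.2 = x ∧ (∀ j : Fin n, y.1.fld f k j = r j) ∧ Mem.AgreeFld {f} m y.1 ∧
          Mem.AgreeNat {aRow, aCol} m y.1 ∧
          ∀ i, i ≠ k → y.1.fld f i = m'.fld f i := by
    intro k m' hf hN hk
    have hn' : (NExpr.cell aSize).eval m' = n := by
      simp only [NExpr.eval]
      rw [hN aSize (by simp), hn]
    simp only [Prog.forVertices, Prog.run, hn']
    have := Branches.Runs.iter_fun (S := F) (1 / (Fintype.card F : ℝ))
      (f := fun l (y : Mem F × E) => (Prog.fsample f (.cell aRow) (.cell aCol)).run h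
        ((y.1.setNat aCol 0 0 l).tick (1 + l.size), y.2))
      (x := (m'.tick (1 + (NExpr.cell aSize).cost m'), x))
      (fun l r y => y.2 = x ∧ (∀ j : Fin l, y.1.fld f k j = r j) ∧ Mem.AgreeFld {f} m y.1 ∧
          Mem.AgreeNat {aRow, aCol} m y.1 ∧ y.1.nat aRow 0 0 = k ∧
          ∀ i, i ≠ k → y.1.fld f i = m'.fld f i) n
      ⟨rfl, fun j => j.elim0, hf, hN, hk, fun _ _ => rfl⟩ ?_
    · exact this.mono fun r y hy => ⟨hy.1, hy.2.1, hy.2.2.1, hy.2.2.2.1, hy.2.2.2.2.2⟩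
    · rintro l hl r ⟨m'', x'⟩ ⟨rfl, h1, h2, h3, h4, h5⟩
      dsimp only at h1 h2 h3 h4 h5
      refine Branches.runs_map_toList fun t => ⟨rfl, ?_, ?_, ?_, ?_, ?_⟩
      · intro j
        refine Fin.lastCases ?_ (fun j => ?_) j
        · simp [NExpr.eval, Mem.tick_nat, Mem.tick_fld, Mem.setFld_fld, Mem.setNat_nat, h4]
        · simp [NExpr.eval, Mem.tick_nat, Mem.tick_fld, Mem.setFld_fld, Mem.setNat_nat, h4,
            j.2.ne, Mem.setNat_fld, h1]
      · intro a ha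
        rw [Mem.tick_fld, Mem.setFld_fld_of_ne _ _ _ _ (by simpa using ha)]
        exact h2 a ha
      · intro a ha
        rw [Mem.tick_nat, Mem.setFld_nat, Mem.tick_nat, Mem.setNat_nat_of_ne _ _ _ _ (by simp at ha; tauto)]
        exact h3 a ha
      · simpa [Mem.tick_nat, Mem.setFld_nat, Mem.setNat_nat] using h4
      · intro i hi
        rw [← h5 i hi]
        funext j
        simp [NExpr.eval, Mem.tick_nat, Mem.tick_fld, Mem.setFld_fld, Mem.setNat_nat, h4, hi, Mem.setNat_fld]
  have hn' : (NExpr.cell aSize).eval m = n := hn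
  have := Branches.Runs.iter_fun (S := Fin n → F) ((1 / (Fintype.card F : ℝ)) ^ n)
    (f := fun l (y : Mem F × E) =>
      (Prog.forVertices aCol (.fsample f (.cell aRow) (.cell aCol))).run h
        ((y.1.setNat aRow 0 0 l).tick (1 + l.size), y.2))
    (x := (m.tick (1 + (NExpr.cell aSize).cost m), x))
    (fun l r y => y.2 = x ∧ (∀ (i : Fin l) (j : Fin n), y.1.fld f i j = r i j) ∧
      Mem.AgreeFld {f} m y.1 ∧ Mem.AgreeNat {aRow, aCol} m y.1) n
    ⟨rfl, fun j => j.elim0, Mem.AgreeFld.refl _ _, Mem.AgreeNat.refl _ _⟩ ?_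
  · rw [← pow_mul, one_div_pow] at this
    rw [Prog.fillMat, Prog.forVertices, Prog.run, hn']
    exact this
  · rintro l hl r ⟨m', x'⟩ ⟨rfl, h1, h2, h3⟩
    refine (key l _ ?_ ?_ ?_).mono ?_
    · exact h2
    · intro a ha
      rw [Mem.tick_nat, Mem.setNat_nat_of_ne _ _ _ _ (by simp at ha; tauto)]
      exact h3 a ha
    · simp [Mem.tick_nat, Mem.setNat_nat]
    · rintro t y ⟨h4, h5, h6, h7, h8⟩
      refine ⟨h4, ?_, h6, h7⟩
      intro i
      refine Fin.lastCases ?_ (fun i => ?_) i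
      · simpa using h5
      · intro j
        simp only [Fin.val_castSucc, Fin.snoc_castSucc]
        rw [h8 i i.2.ne]
        exact h1 i j

/-- Inserting a last element. -/
def permSnoc (k : ℕ) : Equiv.Perm (Fin k) × Fin (k + 1) ≃ Equiv.Perm (Fin (k + 1)) :=
  (Equiv.prodComm _ _).trans <|
    (Equiv.prodCongr finSuccEquivLast (Equiv.inv _)).trans <|
    Equiv.Perm.decomposeOption.symm.trans <|
    (finSuccEquivLast.symm.permCongr).trans (Equiv.inv _)

theorem permSnoc_apply_self (k : ℕ) (σ : Equiv.Perm (Fin k)) (t : Fin (k + 1)) :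
    permSnoc k (σ, t) t = Fin.last k := by
  simp only [permSnoc, Equiv.trans_apply]
  rw [Equiv.inv_apply, Equiv.Perm.inv_eq_iff_eq]
  simp [Equiv.permCongr_apply]

theorem permSnoc_apply_castSucc (k : ℕ) (σ : Equiv.Perm (Fin k)) (t : Fin (k + 1)) (i : Fin k)
    (hi : i.castSucc ≠ t) : permSnoc k (σ, t) i.castSucc = (σ i).castSucc := by
  simp only [permSnoc, Equiv.trans_apply]
  rw [Equiv.inv_apply, Equiv.Perm.inv_eq_iff_eq]
  have h1 : some i ≠ finSuccEquivLast t := fun h => hi <| by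
    rw [← finSuccEquivLast_castSucc, finSuccEquivLast.apply_eq_iff_eq] at h
    exact h
  simp [Equiv.permCongr_apply, Equiv.swap_apply_of_ne_of_ne, h1]

theorem permSnoc_apply_last (k : ℕ) (σ : Equiv.Perm (Fin k)) (t : Fin k) :
    permSnoc k (σ, t.castSucc) (Fin.last k) = (σ t).castSucc := by
  simp only [permSnoc, Equiv.trans_apply]
  rw [Equiv.inv_apply, Equiv.Perm.inv_eq_iff_eq]
  simp [Equiv.permCongr_apply]

/-- This is the inside-out Fisher–Yates shuffle. Round `k` draws `t ≤ k`, moves the entry at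
position `t` to position `k` and writes `k` at position `t`; this is exactly the bijection `permSnoc
k`. The weights `1 / (k + 1)` multiply to `1 / n!`. -/
theorem runs_samplePerm {n : ℕ} {m : Mem F} {x : E} (hn : m.nat aSize 0 0 = n) :
    Branches.Runs (Prog.samplePerm.run h (m, x)) (Equiv.Perm (Fin n)) (1 / (n ! : ℝ))
      fun Pi y => y.2 = x ∧ (∀ i : Fin n, y.1.nat aRows 0 i = Pi i) ∧
        y.1.fld = m.fld ∧ Mem.AgreeNat {aRow, aTmp, aRows} m y.1 := by
  have hn' : (NExpr.cell aSize).eval m = n := hn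
  have := Branches.Runs.iter (A := fun k => Equiv.Perm (Fin k)) (T := fun k => Fin (k + 1))
    (f := fun l (y : Mem F × E) =>
      (Prog.seq (.sample aTmp (.const 0) (.const 0) (.add (.cell aRow) (.const 1))) <|
       .seq (.assign aRows (.const 0) (.cell aRow) (.get aRows (.const 0) (.cell aTmp)))
      (.assign aRows (.const 0) (.cell aTmp) (.cell aRow))).run h
        ((y.1.setNat aRow 0 0 l).tick (1 + l.size), y.2))
    (x := (m.tick (1 + (NExpr.cell aSize).cost m), x))
    (fun k => (permSnoc k).symm) (fun k => 1 / ((k + 1 : ℕ) : ℝ))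
    (fun l Pi y => y.2 = x ∧ (∀ i : Fin l, y.1.nat aRows 0 i = Pi i) ∧
      y.1.fld = m.fld ∧ Mem.AgreeNat {aRow, aTmp, aRows} m y.1) n
    ⟨rfl, fun j => j.elim0, rfl, Mem.AgreeNat.refl _ _⟩ ?_
  · have hw : ∏ k ∈ Finset.range n, (1 / ((k + 1 : ℕ) : ℝ)) = 1 / (n ! : ℝ) := by
      rw [← Finset.prod_range_add_one_eq_factorial]
      push_cast
      simp
    rw [hw] at this
    rw [Prog.samplePerm, Prog.forVertices, Prog.run, hn']
    exact this
  · rintro k hk σ ⟨m', x'⟩ ⟨rfl, h1, h2, h3⟩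
    have hs : Branches.Runs ((Prog.sample (Op := Op) aTmp (.const 0) (.const 0)
        (.add (.cell aRow) (.const 1))).run h ((m'.setNat aRow 0 0 k).tick (1 + k.size), x'))
        (Fin (k + 1)) (1 / ((k + 1 : ℕ) : ℝ)) fun t y => y.2 = x' ∧ y.1.nat aTmp 0 0 = t ∧
          y.1.nat aRow 0 0 = k ∧ y.1.nat aRows = m'.nat aRows ∧ y.1.fld = m.fld ∧
          Mem.AgreeNat {aRow, aTmp, aRows} m y.1 := by
      have he : (NExpr.add (.cell aRow) (.const 1)).eval
          ((m'.setNat aRow 0 0 k).tick (1 + k.size)) = k + 1 := by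
        simp [NExpr.eval, Mem.tick_nat, Mem.setNat_nat]
      simp only [Prog.run, he]
      refine Branches.runs_map_range fun t => ⟨rfl, ?_, ?_, ?_, h2, ?_⟩
      · simp [NExpr.eval, Mem.tick_nat, Mem.setNat_nat]
      · simp [NExpr.eval, Mem.tick_nat, Mem.setNat_nat]
      · funext i j
        simp [Mem.tick_nat, Mem.setNat_nat]
      · intro a ha
        rw [← h3 a ha]
        simp only [Set.mem_insert_iff, Set.mem_singleton_iff, not_or] at ha
        funext i j
        simp [Mem.tick_nat, Mem.setNat_nat, ha]
    refine Branches.Runs.bind_yields hs ?_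
    rintro t ⟨m'', x''⟩ ⟨rfl, h4, h5, h6, h7, h8⟩
    dsimp only at h4 h5 h6 h7 h8 h1
    simp only [Prog.run, Branches.pure_bind]
    refine Branches.yields_pure ⟨rfl, ?_, h7, ?_⟩
    · intro i
      by_cases hit : i = t
      · subst hit
        rw [Equiv.symm_symm, permSnoc_apply_self]
        simp [NExpr.eval, Mem.tick_nat, Mem.setNat_nat, h4, h5]
      · have hit' : (i : ℕ) ≠ t := fun h' => hit (Fin.ext h')
        revert hit hit'
        -- Away from position `t`, the last position holds the old entry at `t` (here `t` is not
        -- itself last), and all other positions are unchanged.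
        refine Fin.lastCases (fun hit hit' => ?_) (fun i hit hit' => ?_) i
        · revert hit hit' h4
          refine Fin.lastCases (fun _ h => absurd rfl h) (fun t h4 hit hit' => ?_) t
          rw [Equiv.symm_symm, permSnoc_apply_last]
          simp at h4 hit'
          simp [NExpr.eval, Mem.tick_nat, Mem.setNat_nat, h4, h5, h6, hit', h1]
        · rw [Equiv.symm_symm, permSnoc_apply_castSucc _ _ _ _ hit]
          simp at hit'
          simp [NExpr.eval, Mem.tick_nat, Mem.setNat_nat, h4, h5, h6, hit', h1, i.2.ne]
    · intro a ha
      rw [← h8 a ha]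
      simp only [Set.mem_insert_iff, Set.mem_singleton_iff, not_or] at ha
      funext i j
      simp [Mem.tick_nat, Mem.setNat_nat, ha]

end


/-! ### The simulator -/

/-- Entry of row `0` of `aRows`. -/
abbrev NExpr.row0 (i : NExpr) : NExpr := .get aRows (.const 0) i

/-- The successor of the row counter, cyclically. -/
abbrev NExpr.cycSucc : NExpr :=
  .mul (.lt (.add (.cell aRow) (.const 1)) (.cell aSize)) (.add (.cell aRow) (.const 1))

/-- For all `u` and `v`, with images `u'` and `v'` under row `0` of `aRows`, store `e₁` or `e₂` in
the entry `(u', v')` of `f`, depending on the condition `c`. -/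
def Prog.maskLoop {Op : Type} (f : ℕ) (c : NExpr) (e₁ e₂ : FExpr) : Prog Op :=
  .forVertices aRow <| .forVertices aCol <|
    .ite c (.fassign f (.row0 (.cell aRow)) (.row0 (.cell aCol)) e₁)
      (.fassign f (.row0 (.cell aRow)) (.row0 (.cell aCol)) e₂)

/-- Entry of the matrix `f` for the counters in the double loop. -/
abbrev FExpr.entry (f : ℕ) : FExpr := .get f (.row0 (.cell aRow)) (.row0 (.cell aCol))

/-- Entry of the matrix `f` for the edge starting in the image of the row counter. -/
abbrev FExpr.cycEntry (f : ℕ) : FExpr := .get f (.row0 (.cell aRow)) (.row0 .cycSucc)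

/-- Response to the challenge `true`: the image of the standard cycle. -/
def Prog.answerCycle {Op : Type} : Prog Op :=
  .seq (.assign aKind (.const 0) (.const 0) (.const 1)) <| .forVertices aRow <|
    .seq (.assign aPerm (.const 0) (.row0 (.cell aRow)) (.row0 .cycSucc))
      (.fassign fOpen (.const 0) (.row0 (.cell aRow)) (.sub (.cycEntry fCom) (.cycEntry fRand)))

/-- Adjacency of the two counters. -/
abbrev NExpr.adj : NExpr := .get aAdj (.cell aRow) (.cell aCol)

/-- Response to the challenge `false`. -/
def Prog.answerAll {Op : Type} : Prog Op :=
  .seq (.assign aKind (.const 0) (.const 0) (.const 0)) <|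
  .seq (.forVertices aRow (.assign aPerm (.const 0) (.cell aRow) (.row0 (.cell aRow)))) <|
    .maskLoop fOpen .adj (.sub (.entry fCom) (.entry fRand)) (.entry fCom)

def Prog.answer {Op : Type} : Prog Op := .ite (.cell aCh) .answerCycle .answerAll

/-- Add the message of the verifier to the opened entries. -/
def Prog.commit {Op : Type} : Prog Op :=
  .ite (.cell aCh)
    (.maskLoop fCom (.eq (.cell aCol) .cycSucc) (.add (.entry fCom) (.entry fRand)) (.entry fCom))
    (.maskLoop fCom .adj (.add (.entry fCom) (.entry fRand)) (.entry fCom))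

def simulator : Simulator where
  first1 := .fillMat fCom
  second2 := .seq .samplePerm .answer
  first2 := .seq (.fillMat fCom) (.seq .samplePerm .answer)
  second1 := .commit

theorem NExpr.eval_const {F : Type} (m : Mem F) (c : ℕ) : (NExpr.const c).eval m = c := rfl

/-- The comparison is a factor `0` or `1`, so the product wraps the successor of the last vertex
around to `0`. -/
theorem eval_cycSucc {F : Type} {n : ℕ} (m : Mem F) (hn : m.nat aSize 0 0 = n) (u : Fin n)
    (hu : m.nat aRow 0 0 = u) : NExpr.cycSucc.eval m = finRotate n u := by
  simp only [NExpr.eval, hn, hu]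
  cases n with
  | zero => exact u.elim0
  | succ n =>
    rw [coe_finRotate]
    have := u.2
    by_cases hl : u = Fin.last n
    · simp [hl]
    · have : (u : ℕ) ≠ n := fun h => hl (Fin.ext h)
      rw [if_pos (by omega), if_neg hl]
      simp

theorem permAdj_apply {F : Type} [Field F] {n : ℕ} (G : SimpleGraph (Fin n)) (Pi : Equiv.Perm (Fin n)) (u v : Fin n)
    [Decidable (G.Adj u v)] : permAdj F G Pi (Pi u) (Pi v) = if G.Adj u v then 1 else 0 := by
  simp [permAdj, SimpleGraph.adjMatrix_apply]

/-! ### Correctness of the simulator's subprograms -/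

section Specs

variable {Op F E : Type} [Field F] [Fintype F] (h : Op → Mem F × E → Branches (Mem F × E))
  {n : ℕ} {m : Mem F} {x : E}

/-- Each pair `(u, v)` writes only the entry `(Pi u, Pi v)`, and `Pi` is injective; so this entry
still has its original value when the pair is reached. The last premise of `hc` records this, which
allows the new value to be computed from the matrix being overwritten. -/
theorem yields_maskLoop (f : ℕ) (c : NExpr) (e₁ e₂ : FExpr) (hn : m.nat aSize 0 0 = n)
    {Pi : Equiv.Perm (Fin n)} (hPi : ∀ i : Fin n, m.nat aRows 0 i = Pi i)
    (mask : Fin n → Fin n → Prop) [∀ u v, Decidable (mask u v)] (X Z : Fin n → Fin n → F)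
    (hc : ∀ (u v : Fin n) (m' : Mem F), Mem.AgreeNat {aRow, aCol} m m' →
      Mem.AgreeFld {f} m m' → m'.nat aRow 0 0 = u → m'.nat aCol 0 0 = v →
      m'.fld f (Pi u) (Pi v) = m.fld f (Pi u) (Pi v) →
      (c.eval m' ≠ 0 ↔ mask u v) ∧ e₁.eval m' = X u v ∧ e₂.eval m' = Z u v) :
    Branches.Yields ((Prog.maskLoop f c e₁ e₂).run h (m, x)) fun y : Mem F × E =>
      ((∀ u v, y.1.fld f (Pi u) (Pi v) = if mask u v then X u v else Z u v) ∧
        Mem.AgreeFld {f} m y.1 ∧ Mem.AgreeNat {aRow, aCol} m y.1) ∧ y.2 = x := by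
  refine (yields_forVertices h aRow _ (n := n) (fun k y =>
    (∀ u v, y.fld f (Pi u) (Pi v) = if (u : ℕ) < k then (if mask u v then X u v else Z u v)
        else m.fld f (Pi u) (Pi v)) ∧
      Mem.AgreeFld {f} m y ∧ Mem.AgreeNat {aRow, aCol} m y) hn ?_ ?_).mono ?_
  · intro k
    exact ⟨by simp [Mem.tick_fld], Mem.AgreeFld.refl _ _, Mem.AgreeNat.refl _ _⟩
  · rintro u m' ⟨h1, h2, h3⟩ t
    refine (yields_forVertices h aCol _ (n := n) (fun k y =>
      (∀ u' v', y.fld f (Pi u') (Pi v') =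
        if (u' : ℕ) < u ∨ (u' = u ∧ (v' : ℕ) < k) then (if mask u' v' then X u' v' else Z u' v')
        else m.fld f (Pi u') (Pi v')) ∧ y.nat aRow 0 0 = u ∧
      Mem.AgreeFld {f} m y ∧ Mem.AgreeNat {aRow, aCol} m y) ?_ ?_ ?_).mono ?_
    · simp only [Mem.tick_nat]
      rw [Mem.setNat_nat_of_ne _ _ _ _ (by simp), h3 aSize (by simp), hn]
    · intro k
      refine ⟨fun u' v' => ?_, ?_, h2, ?_⟩
      · simpa [Mem.tick_fld, Mem.setNat_fld] using h1 u' v'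
      · simp [Mem.tick_nat, Mem.setNat_nat]
      · intro a ha
        simp only [Mem.tick_nat]
        rw [Mem.setNat_nat_of_ne _ _ _ _ (by simp at ha; tauto), h3 a ha]
    · rintro v m'' ⟨h4, h5, h6, h7⟩ s
      set q := (m''.setNat aCol 0 0 v).tick s with hq
      have q1 : q.nat aRow 0 0 = u := by simpa [hq, Mem.tick_nat, Mem.setNat_nat] using h5
      have q2 : q.nat aCol 0 0 = v := by simp [hq, Mem.tick_nat, Mem.setNat_nat]
      have q3 : Mem.AgreeNat {aRow, aCol} m q := fun a ha => by
        rw [hq, Mem.tick_nat, Mem.setNat_nat_of_ne _ _ _ _ (by simp at ha; tauto), h7 a ha]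
      have q4 : q.fld = m''.fld := rfl
      have q5 : ∀ t', (q.tick t').nat aRows 0 u = Pi u := fun t' => by
        rw [Mem.tick_nat, q3 aRows (by simp), hPi]
      have q6 : ∀ t', (q.tick t').nat aRows 0 v = Pi v := fun t' => by
        rw [Mem.tick_nat, q3 aRows (by simp), hPi]
      have q7 : Mem.AgreeFld {f} m q := h6
      clear_value q
      have hc' := hc u v q q3 q7 q1 q2 (by rw [q4, h4]; simp)
      -- The condition is evaluated before the branching is charged and the assigned expression
      -- afterwards, so `hc` is needed for both memories.
      have hc'' := fun t' => hc u v (q.tick t') q3 q7 q1 q2 (by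
        rw [Mem.tick_fld, q4, h4]; simp)
      have hfin : ∀ (e : FExpr) (t' : ℕ), e.eval (q.tick t') =
          (if mask u v then X u v else Z u v) → Branches.Yields ((Prog.fassign f
            (.row0 (.cell aRow)) (.row0 (.cell aCol)) e).run h (q.tick t', x))
            fun y : Mem F × E => ((∀ u' v', y.1.fld f (Pi u') (Pi v') =
              if (u' : ℕ) < u ∨ (u' = u ∧ (v' : ℕ) < v + 1)
              then (if mask u' v' then X u' v' else Z u' v')
              else m.fld f (Pi u') (Pi v')) ∧ y.1.nat aRow 0 0 = u ∧
              Mem.AgreeFld {f} m y.1 ∧ Mem.AgreeNat {aRow, aCol} m y.1) ∧ y.2 = x := by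
        intro e t' he
        simp only [Prog.run, NExpr.eval]
        refine Branches.yields_pure ⟨⟨fun u' v' => ?_, q1, ?_, q3⟩, rfl⟩
        · have r1 : (q.tick t').nat aRow 0 0 = u := q1
          have r2 : (q.tick t').nat aCol 0 0 = v := q2
          simp only [Mem.tick_fld, Mem.setFld_fld, r1, r2, q5, q6, he, Fin.val_inj,
            Pi.injective.eq_iff, q4, h4, true_and]
          by_cases hu : u' = u
          · by_cases hv : v' = v
            · simp [hu, hv]
            · have : (v' : ℕ) ≠ v := fun h' => hv (Fin.ext h')
              have : (v' : ℕ) < v + 1 ↔ (v' : ℕ) < v := by omega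
              simp [hu, hv, this]
          · simp [hu]
        · intro a ha
          rw [Mem.tick_fld, Mem.setFld_fld_of_ne _ _ _ _ (by simpa using ha)]
          exact q7 a ha
      rw [Prog.run]
      split_ifs with hm
      · exact hfin _ _ (by rw [(hc'' _).2.1, if_pos (hc'.1.1 hm)])
      · exact hfin _ _ (by rw [(hc'' _).2.2, if_neg (mt hc'.1.2 hm)])
    · rintro ⟨y, x'⟩ ⟨⟨h4, h5, h6, h7⟩, rfl⟩
      refine ⟨⟨fun u' v' => ?_, h6, h7⟩, rfl⟩
      rw [h4]
      have : ((u' : ℕ) < u ∨ (u' = u ∧ (v' : ℕ) < n)) ↔ (u' : ℕ) < u + 1 := by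
        have := v'.2
        rw [Fin.ext_iff]
        omega
      simp only [this]
  · rintro ⟨y, x'⟩ ⟨⟨h4, h5, h6⟩, rfl⟩
    exact ⟨⟨fun u v => by rw [h4, if_pos u.2], h5, h6⟩, rfl⟩

/-- Response of the simulator if the entries are committed to by `X` and the verifier has sent
`B`. -/
def simResp (G : SimpleGraph (Fin n)) (Pi : Equiv.Perm (Fin n)) (X B : Mat F n) : Bool → Resp F n
  | false => .openAll Pi (X - B ⊙ permAdj F G Pi)
  | true => .openCycle (Pi * finRotate n * Pi⁻¹) fun u =>
      X u ((Pi * finRotate n * Pi⁻¹) u) - B u ((Pi * finRotate n * Pi⁻¹) u)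

open Classical in
-- The answer subtracts the message of the verifier wherever the check will add it. The same program
-- serves both orders: if the first prover has not been contacted yet, the message array is still
-- zero and the stored matrix itself is opened. The agreement clauses keep the data that the later
-- commitment needs.
theorem yields_answer (hn : m.nat aSize 0 0 = n) {G : SimpleGraph (Fin n)}
    (hG : ∀ u v : Fin n, m.nat aAdj u v ≠ 0 ↔ G.Adj u v)
    {Pi : Equiv.Perm (Fin n)} (hPi : ∀ i : Fin n, m.nat aRows 0 i = Pi i) {ch : Bool}
    (hch : m.nat aCh 0 0 = if ch then 1 else 0) :
    Branches.Yields (Prog.answer.run h (m, x)) fun y =>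
      (y.1.HoldsResp (simResp G Pi (m.getMat n fCom) (m.getMat n fRand) ch) ∧
        Mem.AgreeFld {fOpen} m y.1 ∧ Mem.AgreeNat {aRow, aCol, aKind, aPerm} m y.1) ∧
        y.2 = x := by
  rw [Prog.answer, Prog.run]
  have hch' : (NExpr.cell aCh).eval m = if ch then 1 else 0 := hch
  rw [hch']
  generalize 1 + (NExpr.cell aCh).cost m = t
  cases ch
  · simp only [Bool.false_eq_true, if_false, ne_eq, not_true_eq_false]
    rw [Prog.answerAll]
    simp only [Prog.run, Branches.pure_bind]
    refine (yields_forVertices h aRow _ (n := n) (fun k (y : Mem F) => (∀ u : Fin n, (u : ℕ) < k →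
      y.nat aPerm 0 u = Pi u) ∧ y.nat aKind 0 0 = 0 ∧ y.fld = m.fld ∧
      Mem.AgreeNat {aRow, aCol, aKind, aPerm} m y) ?_ ?_ ?_).bind ?_
    · simp [NExpr.eval, Mem.tick_nat, Mem.setNat_nat, hn]
    · intro k
      refine ⟨fun u hu => absurd hu (by omega), ?_, rfl, fun a ha => ?_⟩
      · simp [NExpr.eval, Mem.tick_nat, Mem.setNat_nat]
      · simp only [Mem.tick_nat]
        rw [Mem.setNat_nat_of_ne _ _ _ _ (by simp at ha; tauto), Mem.tick_nat]
    · rintro k m' ⟨h1, h2, h3, h4⟩ s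
      simp only [Prog.run]
      refine Branches.yields_pure ⟨⟨fun u hu => ?_, ?_, h3, fun a ha => ?_⟩, rfl⟩
      · have := h4 aRows (by simp)
        by_cases huk : u = k
        · simp [NExpr.eval, Mem.tick_nat, Mem.setNat_nat, this, hPi, huk]
        · have huk' : (u : ℕ) ≠ k := fun h => huk (Fin.ext h)
          simp [NExpr.eval, Mem.tick_nat, Mem.setNat_nat, huk', h1 u (by omega)]
      · simpa [NExpr.eval, Mem.tick_nat, Mem.setNat_nat] using h2
      · rw [← h4 a ha]
        simp only [Set.mem_insert_iff, Set.mem_singleton_iff, not_or] at ha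
        funext i j
        simp [Mem.tick_nat, Mem.setNat_nat, ha]
    · rintro ⟨m', x'⟩ ⟨⟨h1, h2, h3, h4⟩, rfl⟩
      dsimp only at h1 h2 h3 h4
      refine (yields_maskLoop h fOpen _ _ _ (by rw [h4 aSize (by simp), hn])
        (Pi := Pi) (by rw [h4 aRows (by simp)]; exact hPi) (fun u v => G.Adj u v)
        (fun u v => m.fld fCom (Pi u) (Pi v) - m.fld fRand (Pi u) (Pi v))
        (fun u v => m.fld fCom (Pi u) (Pi v)) ?_).mono ?_
      · intro u v m'' q1 q2 q3 q4 _
        have r1 := (q1 aAdj (by simp)).trans (h4 aAdj (by simp))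
        have r2 := (q1 aRows (by simp)).trans (h4 aRows (by simp))
        have r3 := q2 fCom (by simp)
        have r4 := q2 fRand (by simp)
        refine ⟨?_, ?_, ?_⟩
        · simp only [NExpr.eval, q3, q4, r1, hG]
        · simp only [FExpr.eval, NExpr.eval, q3, q4, r2, hPi, r3, r4, h3]
        · simp only [FExpr.eval, NExpr.eval, q3, q4, r2, hPi, r3, h3]
      · rintro ⟨y, x''⟩ ⟨⟨q1, q2, q3⟩, rfl⟩
        refine ⟨⟨⟨?_, ?_, ?_⟩, ?_, ?_⟩, rfl⟩
        · rw [q3 aKind (by simp)]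
          exact h2
        · intro i
          rw [q3 aPerm (by simp)]
          exact h1 i i.2
        · intro i j
          obtain ⟨u, rfl⟩ := Pi.surjective i
          obtain ⟨v, rfl⟩ := Pi.surjective j
          refine (q1 u v).trans ?_
          change _ = m.fld fCom (Pi u) (Pi v) - m.fld fRand (Pi u) (Pi v) *
            permAdj F G Pi (Pi u) (Pi v)
          rw [permAdj_apply]
          split_ifs <;> simp
        · intro a ha
          rw [q2 a ha, h3]
        · exact h4.trans (q3.mono (by simp [Set.insert_subset_iff]))
  · simp only [if_true, ne_eq, one_ne_zero, not_false_eq_true]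
    rw [Prog.answerCycle]
    simp only [Prog.run, Branches.pure_bind]
    refine (yields_forVertices h aRow _ (n := n) (fun k (y : Mem F) => (∀ u : Fin n, (u : ℕ) < k →
      y.nat aPerm 0 (Pi u) = Pi (finRotate n u) ∧ y.fld fOpen 0 (Pi u) =
        m.fld fCom (Pi u) (Pi (finRotate n u)) - m.fld fRand (Pi u) (Pi (finRotate n u))) ∧
      y.nat aKind 0 0 = 1 ∧ Mem.AgreeFld {fOpen} m y ∧
      Mem.AgreeNat {aRow, aCol, aKind, aPerm} m y) ?_ ?_ ?_).mono ?_
    · simp [NExpr.eval, Mem.tick_nat, Mem.setNat_nat, hn]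
    · intro k
      refine ⟨fun u hu => absurd hu (by omega), ?_, Mem.AgreeFld.refl _ _, fun a ha => ?_⟩
      · simp [NExpr.eval, Mem.tick_nat, Mem.setNat_nat]
      · simp only [Mem.tick_nat]
        rw [Mem.setNat_nat_of_ne _ _ _ _ (by simp at ha; tauto), Mem.tick_nat]
    · rintro k m' ⟨h1, h2, h3, h4⟩ s
      simp only [Prog.run, Branches.pure_bind]
      have hev : ∀ q : Mem F, Mem.AgreeNat {aRow, aCol, aKind, aPerm} m q → q.nat aRow 0 0 = k →
          (NExpr.row0 (.cell aRow)).eval q = Pi k ∧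
          (NExpr.row0 .cycSucc).eval q = Pi (finRotate n k) := by
        -- Two memories are relevant: the one before the assignment to the cycle and the one after
        -- it, in which the opening is computed. Neither the row counter nor the permutation changes
        -- in between.
        intro q hq hk
        have r1 := hq aRows (by simp)
        have := eval_cycSucc q (n := n) (by rw [hq aSize (by simp), hn]) k hk
        refine ⟨by simp only [NExpr.eval, hk, r1, hPi], ?_⟩
        rw [NExpr.eval, this, r1, NExpr.eval, hPi]
      have hq1 : Mem.AgreeNat {aRow, aCol, aKind, aPerm} m
          ((m'.setNat aRow 0 0 k).tick s) := fun a ha => by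
        simp only [Mem.tick_nat]
        rw [Mem.setNat_nat_of_ne _ _ _ _ (by simp at ha; tauto), h4 a ha]
      have e1 := hev _ hq1 (by simp [Mem.tick_nat, Mem.setNat_nat])
      simp only [e1.1, e1.2, NExpr.eval_const]
      generalize (1 + _ + _ + _) = s'
      have hq2 : Mem.AgreeNat {aRow, aCol, aKind, aPerm} m
          (((((m'.setNat aRow 0 0 k).tick s).setNat aPerm 0 (Pi k)
            (Pi (finRotate n k))).tick s')) := fun a ha => by
        simp only [Mem.tick_nat]
        rw [Mem.setNat_nat_of_ne _ _ _ _ (by simp at ha; tauto)]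
        exact hq1 a ha
      have e2 := hev _ hq2 (by simp [Mem.tick_nat, Mem.setNat_nat])
      refine Branches.yields_pure ⟨⟨fun u hu => ?_, ?_, fun a ha => ?_, ?_⟩, rfl⟩
      · simp only [FExpr.eval, e2.1, e2.2]
        simp only [Mem.tick_nat, Mem.tick_fld, Mem.setNat_nat, Mem.setFld_fld, Mem.setFld_nat,
          Mem.setNat_fld, h3 fCom (by simp), h3 fRand (by simp)]
        by_cases huk : u = k
        · simp [huk]
        · have huk' : (u : ℕ) ≠ k := fun h => huk (Fin.ext h)
          have := h1 u (by omega)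
          simp [Fin.val_inj, huk, this]
      · simpa [Mem.tick_nat, Mem.setNat_nat, Mem.setFld_nat] using h2
      · simp only [Mem.tick_fld]
        rw [Mem.setFld_fld_of_ne _ _ _ _ (by simpa using ha)]
        exact h3 a ha
      · exact hq2
    · rintro ⟨y, x'⟩ ⟨⟨h1, h2, h3, h4⟩, rfl⟩
      refine ⟨⟨⟨h2, fun i => ?_, fun i => ?_⟩, h3, h4⟩, rfl⟩
      · have := (h1 (Pi⁻¹ i) (Pi⁻¹ i).2).1
        simpa using this
      · have := (h1 (Pi⁻¹ i) (Pi⁻¹ i).2).2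
        simpa [Mem.getMat] using this

/-- Entries opened by the simulator. -/
def simMask (G : SimpleGraph (Fin n)) (Pi : Equiv.Perm (Fin n)) : Bool → Mat F n
  | false => permAdj F G Pi
  | true => fun i j => if j = (Pi * finRotate n * Pi⁻¹) i then 1 else 0

open Classical in
-- After challenge 1 only the entries on the opened cycle get the multiple of `B`. The others are
-- uniform and were never revealed, so it does not matter which of them belong to edges.
theorem yields_commit (hn : m.nat aSize 0 0 = n) {G : SimpleGraph (Fin n)}
    (hG : ∀ u v : Fin n, m.nat aAdj u v ≠ 0 ↔ G.Adj u v)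
    {Pi : Equiv.Perm (Fin n)} (hPi : ∀ i : Fin n, m.nat aRows 0 i = Pi i) {ch : Bool}
    (hch : m.nat aCh 0 0 = if ch then 1 else 0) :
    Branches.Yields (Prog.commit.run h (m, x)) fun y =>
      y.1.getMat n fCom = m.getMat n fCom +
        m.getMat n fRand ⊙ simMask G Pi ch := by
  rw [Prog.commit, Prog.run]
  have hch' : (NExpr.cell aCh).eval m = if ch then 1 else 0 := hch
  rw [hch']
  generalize 1 + (NExpr.cell aCh).cost m = t
  have key : ∀ (c : NExpr) (mask : Fin n → Fin n → Prop),
      (∀ (u v : Fin n) (m' : Mem F), Mem.AgreeNat {aRow, aCol} m m' →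
        m'.nat aRow 0 0 = u → m'.nat aCol 0 0 = v → (c.eval m' ≠ 0 ↔ mask u v)) →
      (∀ u v, simMask (F := F) G Pi ch (Pi u) (Pi v) = if mask u v then 1 else 0) →
      Branches.Yields ((Prog.maskLoop fCom c (.add (.entry fCom) (.entry fRand))
        (.entry fCom)).run h (m.tick t, x)) fun y : Mem F × E =>
          y.1.getMat n fCom = m.getMat n fCom +
            m.getMat n fRand ⊙ simMask G Pi ch := by
    intro c mask hc hmask
    refine (yields_maskLoop h (m := m.tick t) fCom _ _ _ hn (Pi := Pi) hPi mask
        (fun u v => m.fld fCom (Pi u) (Pi v) + m.fld fRand (Pi u) (Pi v))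
        (fun u v => m.fld fCom (Pi u) (Pi v)) ?_).mono ?_
    · intro u v m'' q1 q2 q3 q4 q5
      have r2 := q1 aRows (by simp)
      have r4 := q2 fRand (by simp)
      refine ⟨hc u v m'' q1 q3 q4, ?_, ?_⟩
      · simp only [FExpr.eval, NExpr.eval, q3, q4, r2, hPi, r4, q5, Mem.tick_nat, Mem.tick_fld]
      · simp only [FExpr.eval, NExpr.eval, q3, q4, r2, hPi, q5, Mem.tick_nat, Mem.tick_fld]
    · rintro ⟨y, x'⟩ ⟨⟨q1, -, -⟩, rfl⟩
      funext i j
      obtain ⟨u, rfl⟩ := Pi.surjective i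
      obtain ⟨v, rfl⟩ := Pi.surjective j
      refine (q1 u v).trans ?_
      change _ = m.fld fCom (Pi u) (Pi v) + m.fld fRand (Pi u) (Pi v) *
        simMask G Pi ch (Pi u) (Pi v)
      rw [hmask u v]
      split_ifs <;> simp
  cases ch
  · simp only [Bool.false_eq_true, if_false, ne_eq, not_true_eq_false]
    refine key _ (fun u v => G.Adj u v) (fun u v m' q1 q2 q3 => ?_) (fun u v => ?_)
    · simp only [NExpr.eval, q2, q3, q1 aAdj (by simp), hG]
    · exact permAdj_apply G Pi u v
  · simp only [if_true, ne_eq, one_ne_zero, not_false_eq_true]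
    refine key _ (fun u v => v = finRotate n u) (fun u v m' q1 q2 q3 => ?_) (fun u v => ?_)
    · rw [NExpr.eval, eval_cycSucc m' (n := n) (by rw [q1 aSize (by simp), hn]) u q2]
      simp only [NExpr.eval, q3, Fin.val_inj]
      split_ifs with h'
      · exact ⟨fun _ => h', fun _ => one_ne_zero⟩
      · exact ⟨fun h0 => absurd rfl h0, fun h0 => absurd h0 h'⟩
    · simp [simMask]

end Specs


/-! ### Perfect zero knowledge -/

/-- The two kinds of response carry different tags, and all their entries are stored. Hence a memory
known to hold the simulated response holds the response of a given transcript only if the two are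
equal. -/
theorem Mem.HoldsResp.unique {F : Type} {n : ℕ} {m : Mem F} {r r' : Resp F n}
    (h : m.HoldsResp r) (h' : m.HoldsResp r') : r = r' := by
  cases r with
  | openAll p A =>
    cases r' with
    | openAll p' A' =>
      obtain ⟨-, h1, h2⟩ := h
      obtain ⟨-, h3, h4⟩ := h'
      congr 1
      · ext i
        rw [← h1, ← h3]
      · funext i j
        rw [← h2, ← h4]
    | openCycle p' a' => exact absurd (h.1.symm.trans h'.1) (by norm_num)
  | openCycle p a =>
    cases r' with
    | openAll p' A' => exact absurd (h.1.symm.trans h'.1) (by norm_num)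
    | openCycle p' a' =>
      obtain ⟨-, h1, h2⟩ := h
      obtain ⟨-, h3, h4⟩ := h'
      congr 1
      · ext i
        rw [← h1, ← h3]
      · funext i
        rw [← h2, ← h4]

/-! ### Equality of the simulated and the honest distribution -/

section

variable {F : Type} {n : ℕ}

theorem initMem_size [Field F] (η : ℕ) (G : SimpleGraph (Fin n)) (i j : ℕ) :
    (initMem (F := F) η G).nat aSize i j = n := rfl

theorem initMem_adj [Field F] (η : ℕ) (G : SimpleGraph (Fin n)) (u v : Fin n) :
    (initMem (F := F) η G).nat aAdj u v ≠ 0 ↔ G.Adj u v := by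
  simp [initMem]

theorem initMem_natLE [Field F] (η : ℕ) (G : SimpleGraph (Fin n)) :
    (initMem (F := F) η G).NatLE (n + η + 1) := by
  intro a i j
  simp only [initMem]
  split_ifs <;> omega

theorem Mem.putMat_apply (m : Mem F) (a : ℕ) (B : Mat F n) (i j : Fin n) :
    (m.putMat a B).fld a i j = B i j := by
  simp [Mem.putMat]

theorem Mem.getMat_putMat (m : Mem F) (a : ℕ) (B : Mat F n) : (m.putMat a B).getMat n a = B := by
  funext i j
  exact m.putMat_apply a B i j

theorem Mem.putCh_cell (m : Mem F) (ch : Bool) :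
    (m.putCh ch).nat aCh 0 0 = if ch then 1 else 0 := by
  simp [Mem.putCh, Mem.setNat_nat]

theorem Mem.putCh_of_ne (m : Mem F) (ch : Bool) {a : ℕ} (h : a ≠ aCh) :
    (m.putCh ch).nat a = m.nat a := Mem.setNat_nat_of_ne _ _ _ _ h

theorem Mem.NatLE.putCh {M : ℕ} {m : Mem F} (hm : m.NatLE M) (hM : 1 ≤ M) (ch : Bool) :
    (m.putCh ch).NatLE M := hm.setNat (by split_ifs <;> omega)

theorem card_mat [Fintype F] : Fintype.card (Mat F n) = Fintype.card F ^ (n * n) := by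
  rw [show Fintype.card (Mat F n) = Fintype.card (Fin n → Fin n → F) from
    Fintype.card_congr (Equiv.refl _)]
  simp [pow_mul]

variable [Field F]

/-- Relabelling by `Pi` sends the edge `(u, w u)` of `G` to an edge of `Pi(G)` on the permuted
cycle. -/
theorem permAdj_conj {G : SimpleGraph (Fin n)} {w : Equiv.Perm (Fin n)} (hw : ∀ u, G.Adj u (w u))
    (Pi : Equiv.Perm (Fin n)) (u : Fin n) : permAdj F G Pi u ((Pi * w * Pi⁻¹) u) = 1 := by
  classical
  obtain ⟨u, rfl⟩ := Pi.surjective u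
  simp [Equiv.Perm.mul_apply, permAdj_apply, hw]

/-- Permutations that are a single cycle on all vertices form one conjugacy class. This is what lets
the simulator replace the unknown witness by the standard cycle. -/
theorem finRotate_conj {w : Equiv.Perm (Fin n)} (hw : IsFullCycle w) :
    ∃ t : Equiv.Perm (Fin n), t * finRotate n * t⁻¹ = w := by
  obtain ⟨hn, h1, h2⟩ := hw
  obtain ⟨k, rfl⟩ : ∃ k, n = k + 2 := ⟨n - 2, by omega⟩
  rw [← isConj_iff]
  refine isCycle_finRotate.isConj h1 ?_
  rw [h2, support_finRotate]

theorem honestCom_eq (G : SimpleGraph (Fin n)) (Pi : Equiv.Perm (Fin n)) (A B : Mat F n) :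
    honestCom G Pi A B = A + B ⊙ permAdj F G Pi := rfl

variable [Fintype F]

theorem simulator_runs_true (η : ℕ) (G : SimpleGraph (Fin n)) (B : Mat F n) (ch : Bool) :
    Branches.Runs (simulator.branches η G true B ch) (Mat F n × Equiv.Perm (Fin n))
      (1 / (Fintype.card F : ℝ) ^ (n * n) * (1 / (n ! : ℝ))) fun r x =>
        x.1.getMat n fCom = r.1 ∧ x.2.HoldsResp (simResp G r.2 r.1 B ch) := by
  simp only [Simulator.branches, if_true, simulator, runPlain]
  have hsz : ((initMem (F := F) η G).putMat fRand B).nat aSize 0 0 = n := rfl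
  refine (runs_fillMat _ fCom hsz).bind ?_
  rintro X ⟨m, _⟩ ⟨-, h1, h2, h3⟩
  dsimp only at h1 h2 h3
  have hsz' : (m.putCh ch).nat aSize 0 0 = n := by
    rw [Mem.putCh_of_ne _ _ (by simp), h3 aSize (by simp), hsz]
  refine Branches.Runs.bind_yields (P := fun Pi y => y.1.HoldsResp (simResp G Pi X B ch)) ?_
    fun Pi y hy => Branches.yields_pure ⟨?_, hy⟩
  · simp only [Prog.run]
    refine Branches.Runs.bind_yields (runs_samplePerm _ hsz') ?_
    rintro Pi ⟨m', _⟩ ⟨-, h4, h5, h6⟩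
    dsimp only at h4 h5 h6
    refine (yields_answer _ ?_ (G := G) ?_ h4 (ch := ch) ?_).mono ?_
    · rw [h6 aSize (by simp), hsz']
    · intro u v
      rw [h6 aAdj (by simp), Mem.putCh_of_ne _ _ (by simp), h3 aAdj (by simp)]
      exact initMem_adj (F := F) η G u v
    · rw [h6 aCh (by simp), Mem.putCh_cell]
    · rintro ⟨y, _⟩ ⟨⟨h7, -, -⟩, -⟩
      have e1 : m'.getMat n fCom = X := by
        funext i j
        simp only [Mem.getMat, h5]
        exact h1 i j
      have e2 : m'.getMat n fRand = B := by
        funext i j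
        simp only [Mem.getMat, h5]
        change m.fld fRand i j = _
        rw [h2 fRand (by simp)]
        exact Mem.putMat_apply _ _ _ _ _
      rw [e1, e2] at h7
      exact h7
  · funext i j
    exact h1 i j

theorem simulator_runs_false (η : ℕ) (G : SimpleGraph (Fin n)) (B : Mat F n) (ch : Bool) :
    Branches.Runs (simulator.branches η G false B ch) (Mat F n × Equiv.Perm (Fin n))
      (1 / (Fintype.card F : ℝ) ^ (n * n) * (1 / (n ! : ℝ))) fun r x =>
        x.1.HoldsResp (simResp G r.2 r.1 0 ch) ∧
        x.2.getMat n fCom = r.1 + B ⊙ simMask G r.2 ch := by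
  simp only [Simulator.branches, Bool.false_eq_true, if_false, simulator, runPlain]
  have hsz : ((initMem (F := F) η G).putCh ch).nat aSize 0 0 = n := by
    rw [Mem.putCh_of_ne _ _ (by simp)]
    exact initMem_size (F := F) η G 0 0
  refine Branches.Runs.bind_yields (P := fun r y =>
    y.1.HoldsResp (simResp G r.2 r.1 0 ch) ∧ y.1.getMat n fCom = r.1 ∧
      y.1.nat aSize 0 0 = n ∧ (∀ u v : Fin n, y.1.nat aAdj u v ≠ 0 ↔ G.Adj u v) ∧
      (∀ i : Fin n, y.1.nat aRows 0 i = r.2 i) ∧ y.1.nat aCh 0 0 = if ch then 1 else 0) ?_ ?_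
  · simp only [Prog.run]
    refine (runs_fillMat _ fCom hsz).bind ?_
    rintro X ⟨m, _⟩ ⟨-, h1, h2, h3⟩
    dsimp only at h1 h2 h3
    have hsz' : m.nat aSize 0 0 = n := by rw [h3 aSize (by simp), hsz]
    refine Branches.Runs.bind_yields (runs_samplePerm _ hsz') ?_
    rintro Pi ⟨m', _⟩ ⟨-, h4, h5, h6⟩
    dsimp only at h4 h5 h6
    have hsz'' : m'.nat aSize 0 0 = n := by rw [h6 aSize (by simp), hsz']
    have hadj : ∀ u v : Fin n, m'.nat aAdj u v ≠ 0 ↔ G.Adj u v := by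
      intro u v
      rw [h6 aAdj (by simp), h3 aAdj (by simp), Mem.putCh_of_ne _ _ (by simp)]
      exact initMem_adj (F := F) η G u v
    have hch : m'.nat aCh 0 0 = if ch then 1 else 0 := by
      rw [h6 aCh (by simp), h3 aCh (by simp), Mem.putCh_cell]
    refine (yields_answer _ hsz'' hadj h4 hch).mono ?_
    rintro ⟨y, _⟩ ⟨⟨h7, h8, h9⟩, -⟩
    dsimp only at h7 h8 h9
    have e1 : m'.getMat n fCom = X := by
      funext i j
      simp only [Mem.getMat, h5]
      exact h1 i j
    -- No message to the first prover has been stored yet, and the field memory starts at zero.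
    have e2 : m'.getMat n fRand = 0 := by
      funext i j
      simp only [Mem.getMat, h5]
      rw [h2 fRand (by simp)]
      rfl
    rw [e1, e2] at h7
    refine ⟨h7, ?_, ?_, ?_, ?_, ?_⟩
    · rw [← e1]
      funext i j
      simp only [Mem.getMat, h8 fCom (by simp)]
    · rw [h9 aSize (by simp), hsz'']
    · rw [h9 aAdj (by simp)]
      exact hadj
    · rw [h9 aRows (by simp)]
      exact h4
    · rw [h9 aCh (by simp), hch]
  · rintro ⟨X, Pi⟩ ⟨m, _⟩ ⟨h1, h2, h3, h4, h5, h6⟩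
    dsimp only at h1 h2 h3 h4 h5 h6
    refine (yields_commit _ (m := m.putMat fRand B) h3 h4 h5 h6).bind ?_
    rintro ⟨y, _⟩ hy
    refine Branches.yields_pure ⟨h1, ?_⟩
    dsimp only at hy ⊢
    rw [hy, Mem.getMat_putMat, ← h2]
    rfl

open Classical in
/-- The simulated answers have the same distribution as the honest ones. -/
theorem simulated_sum_eq {G : SimpleGraph (Fin n)} {w : Equiv.Perm (Fin n)} (hw : IsHamCycle G w)
    (o : Bool) (B Y : Mat F n) (ch : Bool) (r : Resp F n) :
    (∑ Pi : Equiv.Perm (Fin n), ∑ X : Mat F n,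
      if o then (if X = Y ∧ simResp G Pi X B ch = r then (1 : ℝ) else 0)
      else (if simResp G Pi X 0 ch = r ∧ X + B ⊙ simMask G Pi ch = Y then (1 : ℝ) else 0)) =
    ∑ Pi : Equiv.Perm (Fin n), ∑ A : Mat F n,
      if honestCom G Pi A B = Y ∧ honestResp w Pi A ch = r then (1 : ℝ) else 0 := by
  obtain ⟨t, ht⟩ := finRotate_conj hw.1
  cases ch
  · refine Finset.sum_congr rfl fun Pi _ => ?_
    cases o
    · refine Finset.sum_congr rfl fun X _ => ?_
      have : simResp G Pi X 0 false = honestResp w Pi X false := by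
        simp [simResp, honestResp]
      simp only [Bool.false_eq_true, if_false]
      refine if_congr ?_ rfl rfl
      rw [this, honestCom_eq, and_comm]
      rfl
    -- The simulator's uniform commitment is `X = A + B ⊙ permAdj F G Pi`, with `A` the honest
    -- matrix.
    · refine (Equiv.sum_comp (Equiv.addRight (B ⊙ permAdj F G Pi)) _).symm.trans ?_
      refine Finset.sum_congr rfl fun A _ => ?_
      simp only [if_true]
      refine if_congr ?_ rfl rfl
      simp [simResp, honestResp, honestCom_eq]
  -- The simulator's permutation `Pi * t` carries the standard cycle to the same cycle to which the
  -- honest `Pi` carries `w`.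
  · refine (Equiv.sum_comp (Equiv.mulRight t) _).symm.trans ?_
    refine Finset.sum_congr rfl fun Pi _ => ?_
    have hc : Pi * t * finRotate n * (Pi * t)⁻¹ = Pi * w * Pi⁻¹ := by
      rw [← ht]
      group
    have hM := permAdj_conj (F := F) hw.2 Pi
    have hE : ∀ u, simMask (F := F) G (Pi * t) true u ((Pi * w * Pi⁻¹) u) = 1 := fun u => by
      rw [simMask, hc]
      exact if_pos rfl
    cases o
    -- The translation vanishes on the opened entries, where both masks are `1`. It only corrects
    -- the unopened entries, at which the simulator omits the multiple of `B`.
    · refine (Equiv.sum_comp (Equiv.addRight (B ⊙ permAdj F G Pi -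
        B ⊙ simMask G (Pi * t) true)) _).symm.trans ?_
      refine Finset.sum_congr rfl fun A _ => ?_
      have h1 : simResp G (Pi * t) (A + (B ⊙ permAdj F G Pi - B ⊙ simMask G (Pi * t) true)) 0
          true = honestResp w Pi A true := by
        simp only [simResp, honestResp, hc, Matrix.add_apply, Matrix.sub_apply,
          Matrix.hadamard_apply, hM, hE, Matrix.zero_apply]
        simp
      simp only [Bool.false_eq_true, if_false]
      refine if_congr ?_ rfl rfl
      rw [Equiv.coe_addRight, Equiv.coe_mulRight, h1, add_assoc, sub_add_cancel, and_comm,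
        honestCom_eq]
    · refine (Equiv.sum_comp (Equiv.addRight (B ⊙ permAdj F G Pi)) _).symm.trans ?_
      refine Finset.sum_congr rfl fun A _ => ?_
      have h1 : simResp G (Pi * t) (A + B ⊙ permAdj F G Pi) B true = honestResp w Pi A true := by
        simp only [simResp, honestResp, hc, Matrix.add_apply, Matrix.hadamard_apply, hM]
        simp
      simp only [if_true]
      refine if_congr ?_ rfl rfl
      rw [Equiv.coe_addRight, Equiv.coe_mulRight, h1, honestCom_eq]

theorem simulator_prob_eq {G : SimpleGraph (Fin n)} {w : Equiv.Perm (Fin n)}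
    (hw : IsHamCycle G w) (η : ℕ) (t : Transcript F n) :
    simulator.prob η G t = honestProb G w t := by
  classical
  obtain ⟨o, B, Y, ch, r⟩ := t
  have hres : ∀ (m : Mem F) (r' : Resp F n), m.HoldsResp r' → (m.HoldsResp r ↔ r' = r) :=
    fun m r' h => ⟨fun h' => h.unique h', fun h' => h' ▸ h⟩
  have key := simulated_sum_eq hw o B Y ch r
  simp only [Simulator.prob, honestProb]
  rw [← key, card_mat]
  rw [Nat.cast_pow, div_eq_mul_inv _ ((n ! : ℝ) * _), mul_inv, ← one_div, ← one_div]
  cases o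
  · obtain ⟨f, hf, hs⟩ := simulator_runs_false η G B ch
    rw [hs, Fintype.sum_prod_type, Finset.sum_comm]
    simp only [Bool.false_eq_true, if_false]
    rw [mul_comm (1 / (n ! : ℝ)), mul_comm (∑ _, _)]
    congr 1
    refine Finset.sum_congr rfl fun Pi _ => Finset.sum_congr rfl fun X _ => ?_
    have h1 := hf (X, Pi)
    simp only [hres _ _ h1.1, h1.2]
  · obtain ⟨f, hf, hs⟩ := simulator_runs_true η G B ch
    rw [hs, Fintype.sum_prod_type, Finset.sum_comm]
    simp only [if_true]
    rw [mul_comm (1 / (n ! : ℝ)), mul_comm (∑ _, _)]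
    congr 1
    refine Finset.sum_congr rfl fun Pi _ => Finset.sum_congr rfl fun X _ => ?_
    have h1 := hf (X, Pi)
    simp only [hres _ _ h1.2, h1.1]

end

/-! #### Running time of the simulator -/

theorem small_fillMat {Op : Type} (f : ℕ) : (Prog.fillMat (Op := Op) f).Small :=
  ⟨(NExpr.small_get _ _ _).succ, (NExpr.small_get _ _ _).succ, trivial⟩

theorem small_samplePerm {Op : Type} : (Prog.samplePerm (Op := Op)).Small :=
  ⟨(NExpr.small_get _ _ _).succ, fun _ _ _ _ hm => Nat.add_le_add_right (hm _ _ _) 1,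
    NExpr.small_get _ _ _, NExpr.small_get _ _ _⟩

theorem small_maskLoop {Op : Type} (f : ℕ) (c : NExpr) (e₁ e₂ : FExpr) :
    (Prog.maskLoop (Op := Op) f c e₁ e₂).Small :=
  ⟨(NExpr.small_get _ _ _).succ, (NExpr.small_get _ _ _).succ, trivial, trivial⟩

theorem small_answer {Op : Type} : (Prog.answer (Op := Op)).Small :=
  ⟨⟨NExpr.small_const le_rfl, (NExpr.small_get _ _ _).succ, NExpr.small_get _ _ _, trivial⟩,
    NExpr.small_const zero_le_one, ⟨(NExpr.small_get _ _ _).succ, NExpr.small_get _ _ _⟩,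
    small_maskLoop _ _ _ _⟩

theorem small_commit {Op : Type} : (Prog.commit (Op := Op)).Small :=
  ⟨small_maskLoop _ _ _ _, small_maskLoop _ _ _ _⟩

/-- The cost of field operations and messages is polynomial. -/
theorem overhead_poly (F : ℕ → ℕ → Type) [∀ η n, Fintype (F η n)] (hsize : ∃ C k : ℕ, ∀ η n,
    Nat.size (Fintype.card (F η n)) ≤ C * (n + η + 1) ^ k) :
    ∃ D l : ℕ, ∀ η n, (n + η + 1) + fieldCost (F η n) + msgCost (F η n) n ≤
      D * (n + η + 1) ^ l := by
  obtain ⟨C, k, h⟩ := hsize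
  refine ⟨(1 + (1 + C * C)) + 3 * ((1 + C * C) + 1), (1 + (0 + 2 * k)) + (2 + ((0 + 2 * k) + 1)),
    fun η n => ?_⟩
  have key : ∀ x y C k C' k' X : ℕ, 1 ≤ X → x ≤ C * X ^ k → y ≤ C' * X ^ k' →
      x + y ≤ (C + C') * X ^ (k + k') := fun x y C k C' k' X hX h h' =>
    (add_le_add h h').trans (poly_add_le C k C' k' X hX)
  set N := n + η + 1 with hN
  have hN1 : 1 ≤ N := by omega
  have hf : fieldCost (F η n) ≤ (1 + C * C) * N ^ (0 + 2 * k) := by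
    refine key _ _ _ _ _ _ N hN1 (by simp) ?_
    refine (Nat.pow_le_pow_left (h η n) 2).trans (le_of_eq ?_)
    rw [mul_pow, ← pow_mul, mul_comm k 2, sq C]
  refine key _ _ _ _ _ _ N hN1 (key _ _ _ _ _ _ N hN1 (by simp) hf) ?_
  have h2 := key _ _ _ _ 1 1 N hN1 hf (show Nat.size n ≤ 1 * N ^ 1 by
    have := size_le_self n
    rw [pow_one]; omega)
  have h1 : 1 + n + n ^ 2 ≤ 3 * N ^ 2 := by
    have : n ≤ N := by omega
    nlinarith
  refine (Nat.mul_le_mul h1 h2).trans (le_of_eq ?_)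
  rw [mul_mul_mul_comm, ← pow_add]

section

variable (F : ℕ → ℕ → Type) [∀ η n, Field (F η n)] [∀ η n, Fintype (F η n)]

/-- A view depends on the prover side only through the probability of the two answers given the two
messages. Equality of these probabilities therefore gives equality of the quantum states for every
verifier, whatever its auxiliary input and adaptivity. -/
theorem simulator_perfect (hsize : ∃ C k : ℕ, ∀ η n,
    Nat.size (Fintype.card (F η n)) ≤ C * (n + η + 1) ^ k) : IsPerfectZeroKnowledge F := by
  refine ⟨simulator, ?_, fun n η G w hw V t => by rw [simulator_prob_eq hw]⟩
  obtain ⟨D, l, hD⟩ := overhead_poly F hsize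
  obtain ⟨C₁, k₁, h₁⟩ := (Prog.fillMat (Op := Empty) fCom).poly_bound (small_fillMat _)
  obtain ⟨C₂, k₂, h₂⟩ := (Prog.seq (Op := Empty) .samplePerm .answer).poly_bound
    ⟨small_samplePerm, small_answer⟩
  obtain ⟨C₃, k₃, h₃⟩ := (Prog.seq (Op := Empty) (.fillMat fCom)
    (.seq .samplePerm .answer)).poly_bound ⟨small_fillMat _, small_samplePerm, small_answer⟩
  obtain ⟨C₄, k₄, h₄⟩ := (Prog.commit (Op := Empty)).poly_bound small_commit
  -- The bounds of all four programs are added, although each order of messages runs only two. The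
  -- common bound `D * M ^ l` on memory contents and overhead is then substituted into the resulting
  -- polynomial.
  refine ⟨(C₁ + C₂ + (C₃ + C₄)) * D ^ (k₁ + k₂ + (k₃ + k₄)), l * (k₁ + k₂ + (k₃ + k₄)),
    fun n η G o B ch b hb => ?_⟩
  set M := n + η + 1 with hM
  have hX := hD η n
  rw [← hM] at hX
  set X := D * M ^ l with hXdef
  have hMX : M ≤ X := by omega
  have hM1 : 1 ≤ M := by omega
  have hX1 : 1 ≤ X := hM1.trans hMX
  have hfX : fieldCost (F η n) ≤ X := by omega
  have hpow : (C₁ + C₂ + (C₃ + C₄)) * D ^ (k₁ + k₂ + (k₃ + k₄)) *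
      M ^ (l * (k₁ + k₂ + (k₃ + k₄))) =
      (C₁ + C₂ + (C₃ + C₄)) * X ^ (k₁ + k₂ + (k₃ + k₄)) := by
    rw [hXdef, mul_pow, pow_mul]
    ring
  have e12 := poly_add_le C₁ k₁ C₂ k₂ X hX1
  have e34 := poly_add_le C₃ k₃ C₄ k₄ X hX1
  have e := poly_add_le (C₁ + C₂) (k₁ + k₂) (C₃ + C₄) (k₃ + k₄) X hX1
  rw [hpow]
  have h0 := initMem_natLE (F := F η n) η G
  cases o
  · simp only [Simulator.branches, Bool.false_eq_true, if_false, simulator, runPlain] at hb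
    obtain ⟨x, hx, y, hy, hbe⟩ := Branches.mem_bind hb
    obtain ⟨z, hz, q, hq, hye⟩ := Branches.mem_bind hy
    simp only [Branches.pure, List.mem_singleton] at hq
    have i1 := h₃ _ _ _ M X hM1 hMX hfX (fun o => o.elim) _ (h0.putCh hM1 ch) x hx
    have i2 := h₄ _ _ _ M X hM1 hMX hfX (fun o => o.elim) (x.2.1.putMat fRand B, ()) i1.1 z hz
    have i3 : ((initMem (F := F η n) η G).putCh ch).cost = 0 := rfl
    have i4 : (x.2.1.putMat fRand B).cost = x.2.1.cost := rfl
    rw [hbe, hye, hq]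
    dsimp only at i1 i2 ⊢
    omega
  · simp only [Simulator.branches, if_true, simulator, runPlain] at hb
    obtain ⟨x, hx, y, hy, hbe⟩ := Branches.mem_bind hb
    obtain ⟨z, hz, q, hq, hye⟩ := Branches.mem_bind hy
    simp only [Branches.pure, List.mem_singleton] at hq
    have i1 := h₁ _ _ _ M X hM1 hMX hfX (fun o => o.elim)
      ((initMem (F := F η n) η G).putMat fRand B, ()) h0 x hx
    have i2 := h₂ _ _ _ M X hM1 hMX hfX (fun o => o.elim) (x.2.1.putCh ch, ())
      (i1.1.putCh hM1 ch) z hz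
    have i3 : ((initMem (F := F η n) η G).putMat fRand B).cost = 0 := rfl
    have i4 : (x.2.1.putCh ch).cost = x.2.1.cost := rfl
    rw [hbe, hye, hq]
    dsimp only at i1 i2 ⊢
    omega

end


/-! ### Two projective measurements in succession -/

section Quantum

/-- Cauchy–Schwarz. The factor `s.card` is the origin of the loss `numAcceptable`. -/
theorem normSq_sum_le {ι R : Type} [Fintype ι] (s : Finset R) (x : R → ι → ℂ) :
    normSq (∑ r ∈ s, x r) ≤ s.card * ∑ r ∈ s, normSq (x r) := by
  simp only [normSq]
  rw [Finset.sum_comm, Finset.mul_sum]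
  refine Finset.sum_le_sum fun i _ => ?_
  rw [Finset.sum_apply]
  exact (pow_le_pow_left₀ (norm_nonneg _) (norm_sum_le _ _) 2).trans sq_sum_le_card_mul_sum_sq

variable {ι R S : Type} [Fintype ι] [Fintype R] [Fintype S]

theorem normSq_eq_norm (v : ι → ℂ) : normSq v = ‖WithLp.toLp 2 v‖ ^ 2 := by
  rw [EuclideanSpace.norm_sq_eq]
  rfl

theorem normSq_nonneg (v : ι → ℂ) : 0 ≤ normSq v := Finset.sum_nonneg fun _ _ => by positivity

theorem normSq_eq_dotProduct (v : ι → ℂ) : (normSq v : ℂ) = star v ⬝ᵥ v := by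
  simp only [normSq, dotProduct, Pi.star_apply, Complex.ofReal_sum]
  refine Finset.sum_congr rfl fun i _ => ?_
  rw [Complex.star_def, mul_comm, Complex.mul_conj, Complex.normSq_eq_norm_sq]

theorem normSq_mulVec (M : Matrix ι ι ℂ) (v : ι → ℂ) :
    (normSq (M *ᵥ v) : ℂ) = star v ⬝ᵥ ((Mᴴ * M) *ᵥ v) := by
  rw [normSq_eq_dotProduct, Matrix.star_mulVec, ← Matrix.dotProduct_mulVec, Matrix.mulVec_mulVec]

variable [DecidableEq ι]

theorem normSq_isometry {U : Matrix ι ι ℂ} (hU : Uᴴ * U = 1) (v : ι → ℂ) :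
    normSq (U *ᵥ v) = normSq v := by
  have h := normSq_mulVec U v
  rw [hU, Matrix.one_mulVec, ← normSq_eq_dotProduct] at h
  exact_mod_cast h

namespace IsProjectiveMeasurement

variable {W : R → Matrix ι ι ℂ} {X : S → Matrix ι ι ℂ}

/-- Pythagoras: the projections are mutually orthogonal, so their partial sum is again a projection.
-/
theorem sum_normSq_subset (hW : IsProjectiveMeasurement W) (s : Finset R) (v : ι → ℂ) :
    ∑ r ∈ s, normSq (W r *ᵥ v) = normSq ((∑ r ∈ s, W r) *ᵥ v) := by
  classical
  obtain ⟨h1, h2, h3, -⟩ := hW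
  have hsq : (∑ r ∈ s, W r)ᴴ * (∑ r ∈ s, W r) = ∑ r ∈ s, W r := by
    rw [Matrix.conjTranspose_sum, Finset.sum_mul]
    refine Finset.sum_congr rfl fun r hr => ?_
    rw [(h1 r).eq, Finset.mul_sum, Finset.sum_eq_single r]
    · exact h2 r
    · exact fun b _ hb => h3 r b hb.symm
    · exact fun h => absurd hr h
  have : ((∑ r ∈ s, normSq (W r *ᵥ v) : ℝ) : ℂ) = (normSq ((∑ r ∈ s, W r) *ᵥ v) : ℂ) := by
    rw [normSq_mulVec, hsq, Complex.ofReal_sum, Matrix.sum_mulVec, dotProduct_sum]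
    refine Finset.sum_congr rfl fun r _ => ?_
    rw [normSq_mulVec, (h1 r).eq, h2]
  exact_mod_cast this

theorem sum_normSq (hW : IsProjectiveMeasurement W) (v : ι → ℂ) :
    ∑ r, normSq (W r *ᵥ v) = normSq v := by
  rw [hW.sum_normSq_subset, hW.2.2.2, Matrix.one_mulVec]

theorem normSq_subset_le (hW : IsProjectiveMeasurement W) (s : Finset R) (v : ι → ℂ) :
    normSq ((∑ r ∈ s, W r) *ᵥ v) ≤ normSq v := by
  rw [← hW.sum_normSq_subset, ← hW.sum_normSq v]
  exact Finset.sum_le_univ_sum_of_nonneg fun r => normSq_nonneg _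

theorem normSq_sub_subset (hW : IsProjectiveMeasurement W) (s : Finset R) (v : ι → ℂ) :
    normSq (v - (∑ r ∈ s, W r) *ᵥ v) = normSq v - normSq ((∑ r ∈ s, W r) *ᵥ v) := by
  classical
  have h : v - (∑ r ∈ s, W r) *ᵥ v = (∑ r ∈ sᶜ, W r) *ᵥ v := by
    have h' := congrArg (· *ᵥ v) (Finset.sum_add_sum_compl s W)
    simp only [hW.2.2.2, Matrix.add_mulVec, Matrix.one_mulVec] at h'
    exact sub_eq_iff_eq_add'.2 h'.symm
  rw [h, ← hW.sum_normSq_subset, ← hW.sum_normSq_subset, ← hW.sum_normSq v,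
    ← Finset.sum_add_sum_compl s]
  ring

theorem conj (hW : IsProjectiveMeasurement W) {U : Matrix ι ι ℂ} (hU : U * Uᴴ = 1)
    (hU' : Uᴴ * U = 1) : IsProjectiveMeasurement fun r => Uᴴ * W r * U := by
  obtain ⟨h1, h2, h3, h4⟩ := hW
  have key : ∀ r s, Uᴴ * W r * U * (Uᴴ * W s * U) = Uᴴ * (W r * W s) * U := by
    intro r s
    calc _ = Uᴴ * W r * (U * Uᴴ) * W s * U := by simp only [Matrix.mul_assoc]
      _ = _ := by rw [hU]; simp only [Matrix.mul_assoc, Matrix.one_mul]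
  refine ⟨fun r => ?_, fun r => ?_, fun r s hrs => ?_, ?_⟩
  · exact Matrix.isHermitian_conjTranspose_mul_mul U (h1 r)
  · rw [key, h2]
  · rw [key, h3 r s hrs, Matrix.mul_zero, Matrix.zero_mul]
  · rw [← Finset.sum_mul, ← Finset.mul_sum, h4, Matrix.mul_one, hU']

theorem one_kronecker {κ : Type} [Fintype κ] [DecidableEq κ] (hW : IsProjectiveMeasurement W) :
    IsProjectiveMeasurement fun r => (1 : Matrix κ κ ℂ) ⊗ₖ W r := by
  obtain ⟨h1, h2, h3, h4⟩ := hW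
  refine ⟨fun r => ?_, fun r => ?_, fun r s hrs => ?_, ?_⟩
  · rw [Matrix.IsHermitian, Matrix.conjTranspose_kronecker, (h1 r).eq, Matrix.conjTranspose_one]
  · rw [← Matrix.mul_kronecker_mul, h2, Matrix.one_mul]
  · rw [← Matrix.mul_kronecker_mul, h3 r s hrs, Matrix.kronecker_zero]
  · rw [← Matrix.one_kronecker_one, ← h4]
    ext ⟨i, j⟩ ⟨k, l⟩
    simp only [Matrix.sum_apply, Matrix.kronecker_apply, Finset.mul_sum]

theorem kronecker_one {κ : Type} [Fintype κ] [DecidableEq κ] (hW : IsProjectiveMeasurement W) :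
    IsProjectiveMeasurement fun r => W r ⊗ₖ (1 : Matrix κ κ ℂ) := by
  obtain ⟨h1, h2, h3, h4⟩ := hW
  refine ⟨fun r => ?_, fun r => ?_, fun r s hrs => ?_, ?_⟩
  · rw [Matrix.IsHermitian, Matrix.conjTranspose_kronecker, (h1 r).eq, Matrix.conjTranspose_one]
  · rw [← Matrix.mul_kronecker_mul, h2, Matrix.one_mul]
  · rw [← Matrix.mul_kronecker_mul, h3 r s hrs, Matrix.zero_kronecker]
  · rw [← Matrix.one_kronecker_one, ← h4]
    ext ⟨i, j⟩ ⟨k, l⟩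
    simp only [Matrix.sum_apply, Matrix.kronecker_apply, Finset.sum_mul]

/-- If the outcomes in `s` and in `t` are both likely, so are pairs of such outcomes in a
sequence of two measurements in either order. -/
theorem projections_in_succession (hW : IsProjectiveMeasurement W)
    (hX : IsProjectiveMeasurement X) (s : Finset R) (t : Finset S) (v : ι → ℂ) {c : ℝ}
    (hc : 0 ≤ c) :
    2 * c * (normSq ((∑ r ∈ s, W r) *ᵥ v) + normSq ((∑ r ∈ t, X r) *ᵥ v) - normSq v) -
        c ^ 2 * normSq v ≤
      normSq ((∑ r ∈ t, X r) *ᵥ ((∑ r ∈ s, W r) *ᵥ v)) +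
        normSq ((∑ r ∈ s, W r) *ᵥ ((∑ r ∈ t, X r) *ᵥ v)) := by
  set P := ∑ r ∈ s, W r with hP
  set Q := ∑ r ∈ t, X r with hQ
  -- Split `v` into `A v` and the rest; `B` does not increase the norm of the rest.
  have tri : ∀ A B : Matrix ι ι ℂ, (∀ u, normSq (B *ᵥ u) ≤ normSq u) →
      ‖WithLp.toLp 2 (B *ᵥ v)‖ ≤ ‖WithLp.toLp 2 (B *ᵥ (A *ᵥ v))‖ + ‖WithLp.toLp 2 (v - A *ᵥ v)‖ := by
    intro A B hB
    have h1 : ‖WithLp.toLp 2 (B *ᵥ (v - A *ᵥ v))‖ ≤ ‖WithLp.toLp 2 (v - A *ᵥ v)‖ := by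
      refine le_of_sq_le_sq ?_ (norm_nonneg _)
      rw [← normSq_eq_norm, ← normSq_eq_norm]
      exact hB _
    have h2 : WithLp.toLp 2 (B *ᵥ v) =
        WithLp.toLp 2 (B *ᵥ (A *ᵥ v)) + WithLp.toLp 2 (B *ᵥ (v - A *ᵥ v)) := by
      rw [← WithLp.toLp_add, ← Matrix.mulVec_add, add_sub_cancel]
    rw [h2]
    exact (norm_add_le _ _).trans (by linarith)
  have a1 := tri P Q fun u => hX.normSq_subset_le t u
  have a2 := tri Q P fun u => hW.normSq_subset_le s u
  have b1 := hW.normSq_sub_subset s v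
  have b2 := hX.normSq_sub_subset t v
  rw [← hP] at b1
  rw [← hQ] at b2
  simp only [normSq_eq_norm] at b1 b2 ⊢
  -- From `y ≥ q - e` one gets `y (q + e) ≥ q² - e²`. Then `y² ≥ c y (q + e) - c² (q + e)² / 4`, and
  -- `(q + e)² ≤ 2 (q² + e²)`. In the sum over the two orders of measurement the individual
  -- probabilities in the `c²` terms cancel, leaving `c² * normSq v`.
  have main : ∀ y q e : ℝ, 0 ≤ q → 0 ≤ e → q ≤ y + e →
      c * (q ^ 2 - e ^ 2) - c ^ 2 * (q ^ 2 + e ^ 2) / 2 ≤ y ^ 2 := by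
    intro y q e hq he h
    have h1 : q ^ 2 - e ^ 2 ≤ y * (q + e) := by nlinarith
    have h2 : c * (q ^ 2 - e ^ 2) ≤ c * (y * (q + e)) := mul_le_mul_of_nonneg_left h1 hc
    nlinarith [sq_nonneg (y - c * (q + e) / 2), mul_nonneg (sq_nonneg c) (sq_nonneg (q - e))]
  have m1 := main _ _ _ (norm_nonneg _) (norm_nonneg _) a1
  have m2 := main _ _ _ (norm_nonneg _) (norm_nonneg _) a2
  rw [b1] at m1
  rw [b2] at m2
  nlinarith

end IsProjectiveMeasurement

end Quantum

open Classical in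
-- The left side projects coherently onto a set of outcomes, the right side measures the individual
-- outcome. Expanding the projection gives at most `N` nonzero vectors, to which Cauchy–Schwarz
-- applies.
theorem IsProjectiveMeasurement.sum_pairs {ι R S : Type} [Fintype ι] [DecidableEq ι]
    [Fintype S] {W : R → Matrix ι ι ℂ} {X : S → Matrix ι ι ℂ} (hX : IsProjectiveMeasurement X) (s : Finset R) (t : Finset S)
    (v : ι → ℂ) {N : ℕ} (hN : (s.filter fun r => W r ≠ 0).card ≤ N) :
    normSq ((∑ r ∈ t, X r) *ᵥ ((∑ r ∈ s, W r) *ᵥ v)) ≤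
      N * ∑ r ∈ s, ∑ q ∈ t, normSq (X q *ᵥ (W r *ᵥ v)) := by
  have h1 : (∑ r ∈ t, X r) *ᵥ ((∑ r ∈ s, W r) *ᵥ v) =
      ∑ r ∈ s.filter (fun r => W r ≠ 0), (∑ q ∈ t, X q) *ᵥ (W r *ᵥ v) := by
    rw [Matrix.sum_mulVec s, Matrix.mulVec_sum, Finset.sum_filter]
    refine Finset.sum_congr rfl fun r _ => ?_
    split_ifs with h
    · rfl
    · rw [not_not.1 h]
      simp
  rw [h1]
  refine (normSq_sum_le _ _).trans ?_
  refine mul_le_mul (by exact_mod_cast hN) ?_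
    (Finset.sum_nonneg fun _ _ => normSq_nonneg _) (Nat.cast_nonneg _)
  simp only [hX.sum_normSq_subset]
  exact Finset.sum_le_sum_of_subset_of_nonneg (Finset.filter_subset _ _)
    fun _ _ _ => normSq_nonneg _


/-! ### Pairs of accepted responses -/

theorem conjTranspose_mul_self_unitary {ι : Type} [Fintype ι] [DecidableEq ι]
    (U : Matrix.unitaryGroup ι ℂ) : (U : Matrix ι ι ℂ)ᴴ * U = 1 :=
  Matrix.mem_unitaryGroup_iff'.1 U.2

theorem mul_conjTranspose_self_unitary {ι : Type} [Fintype ι] [DecidableEq ι]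
    (U : Matrix.unitaryGroup ι ℂ) : (U : Matrix ι ι ℂ) * (U : Matrix ι ι ℂ)ᴴ = 1 :=
  Matrix.mem_unitaryGroup_iff.1 U.2

/-- The permutation or cycle contained in a response. -/
def Resp.perm {F : Type} {n : ℕ} : Resp F n → Equiv.Perm (Fin n)
  | .openAll p _ => p
  | .openCycle s _ => s

/-- The candidate for a witness computed from the responses to both challenges. -/
def witnessOf {F : Type} {n : ℕ} (r₀ r₁ : Resp F n) : Equiv.Perm (Fin n) :=
  r₀.perm⁻¹ * r₁.perm * r₀.perm

/-- The same with the responses in the order of the challenges `c`, `!c`. -/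
def witnessOfPair {F : Type} {n : ℕ} (c : Bool) (r s : Resp F n) : Equiv.Perm (Fin n) :=
  if c then witnessOf s r else witnessOf r s

theorem IsFullCycle.conj {n : ℕ} {s : Equiv.Perm (Fin n)} (hs : IsFullCycle s)
    (p : Equiv.Perm (Fin n)) : IsFullCycle (p⁻¹ * s * p) := by
  obtain ⟨h1, h2, h3⟩ := hs
  refine ⟨h1, by simpa using h2.conj (g := p⁻¹), ?_⟩
  rw [Finset.eq_univ_iff_forall] at h3 ⊢
  intro i
  have := h3 (p i)
  rw [Equiv.Perm.mem_support] at this ⊢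
  intro h
  apply this
  simp only [Equiv.Perm.mul_apply] at h
  rwa [Equiv.Perm.inv_eq_iff_eq] at h

/-- Two accepted responses that do not give a witness determine an entry of the message to the
first prover. -/
theorem accepted_pair {F : Type} [Field F] {n : ℕ} (G : SimpleGraph (Fin n)) (r₀ r₁ : Resp F n)
    (hw : ¬ IsHamCycle G (witnessOf r₀ r₁)) :
    (∀ B Y, Accepts G B Y false r₀ → ¬ Accepts G B Y true r₁) ∨
      ∃ i j x, ∀ B Y, Accepts G B Y false r₀ → Accepts G B Y true r₁ → B i j = x := by
  by_cases h : ∀ B Y, Accepts G B Y false r₀ → ¬ Accepts G B Y true r₁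
  · exact Or.inl h
  right
  push Not at h
  obtain ⟨B₀, Y₀, h0, h1⟩ := h
  cases r₀ with
  | openCycle p a => exact h0.elim
  | openAll p A =>
    cases r₁ with
    | openAll s a => exact h1.elim
    | openCycle s a =>
      have : ∃ u, ¬ G.Adj u ((p⁻¹ * s * p) u) := by
        by_contra hcon
        push Not at hcon
        exact hw ⟨h1.1.conj p, hcon⟩
      obtain ⟨u, hu⟩ := this
      -- At a non-edge of the permuted graph the first check reads `Y = A`, the second `Y = a + B`;
      -- the difference of the openings is the entry of `B`.
      refine ⟨p u, s (p u), A (p u) (s (p u)) - a (p u), fun B Y hB hB' => ?_⟩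
      have e1 := hB (p u) (s (p u))
      have e2 := hB'.2 (p u)
      have e3 : permAdj F G p (p u) (s (p u)) = 0 := by
        classical
        have := permAdj_apply (F := F) G p u ((p⁻¹ * s * p) u)
        rw [if_neg hu] at this
        simpa [Equiv.Perm.mul_apply] using this
      rw [e3, mul_zero, add_zero] at e1
      rw [← e1, e2]
      ring

open Classical in
-- Translations by constant matrices permute the fibres of an entry, so all `Fintype.card F` fibres
-- have the same size.
theorem card_entry_eq {F : Type} [Field F] [Fintype F] {n : ℕ} (i j : Fin n) (x : F) :
    Fintype.card F * (Finset.univ.filter fun B : Mat F n => B i j = x).card =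
      Fintype.card (Mat F n) := by
  have hx : ∀ y : F, (Finset.univ.filter fun B : Mat F n => B i j = y).card =
      (Finset.univ.filter fun B : Mat F n => B i j = x).card := by
    intro y
    refine Finset.card_bij (fun B _ => B + Matrix.of fun _ _ => x - y) ?_ ?_ ?_
    · intro B hB
      simp only [Finset.mem_filter, Finset.mem_univ, true_and] at hB ⊢
      rw [Matrix.add_apply, Matrix.of_apply, hB]
      ring
    · intro B _ B' _ h
      exact add_right_cancel h
    · intro B hB
      simp only [Finset.mem_filter, Finset.mem_univ, true_and] at hB
      refine ⟨B - Matrix.of fun _ _ => x - y, ?_, sub_add_cancel _ _⟩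
      simp only [Finset.mem_filter, Finset.mem_univ, true_and]
      rw [Matrix.sub_apply, Matrix.of_apply, hB]
      ring
  have := Finset.card_eq_sum_card_fiberwise (f := fun B : Mat F n => B i j) (s := Finset.univ)
    (t := Finset.univ) (fun _ _ => Finset.mem_univ _)
  rw [Finset.card_univ] at this
  rw [this, Finset.sum_congr rfl fun y _ => hx y, Finset.sum_const, Finset.card_univ, smul_eq_mul]

/-! ### Acceptance and rewinding as operators on the joint state -/

namespace Provers

variable {F : Type} [Fintype F] {n : ℕ} (P : Provers F n)

/-- The operator on the joint state for the response `r` to the challenge `ch`. -/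
def proj (ch : Bool) (r : Resp F n) : Matrix (P.S1 × P.S2) (P.S1 × P.S2) ℂ :=
  (1 : Matrix P.S1 P.S1 ℂ) ⊗ₖ
    ((P.U2 ch : Matrix P.S2 P.S2 ℂ)ᴴ * P.W2 r * (P.U2 ch : Matrix P.S2 P.S2 ℂ))

theorem proj_measurement (ch : Bool) : IsProjectiveMeasurement (P.proj ch) :=
  (P.meas2.conj (mul_conjTranspose_self_unitary _)
    (conjTranspose_mul_self_unitary _)).one_kronecker

theorem on2_on2 (M N : Matrix P.S2 P.S2 ℂ) (v : P.S1 × P.S2 → ℂ) :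
    P.on2 M (P.on2 N v) = P.on2 (M * N) v := by
  rw [on2, on2, on2, Matrix.mulVec_mulVec, ← Matrix.mul_kronecker_mul, Matrix.one_mul]

theorem on1_on1 (M N : Matrix P.S1 P.S1 ℂ) (v : P.S1 × P.S2 → ℂ) :
    P.on1 M (P.on1 N v) = P.on1 (M * N) v := by
  rw [on1, on1, on1, Matrix.mulVec_mulVec, ← Matrix.mul_kronecker_mul, Matrix.one_mul]

theorem on2_isometry {U : Matrix P.S2 P.S2 ℂ} (hU : Uᴴ * U = 1) (v : P.S1 × P.S2 → ℂ) :
    normSq (P.on2 U v) = normSq v := by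
  refine normSq_isometry ?_ v
  rw [Matrix.conjTranspose_kronecker, ← Matrix.mul_kronecker_mul, hU, Matrix.conjTranspose_one,
    Matrix.one_mul, Matrix.one_kronecker_one]

theorem on1_isometry {U : Matrix P.S1 P.S1 ℂ} (hU : Uᴴ * U = 1) (v : P.S1 × P.S2 → ℂ) :
    normSq (P.on1 U v) = normSq v := by
  refine normSq_isometry ?_ v
  rw [Matrix.conjTranspose_kronecker, ← Matrix.mul_kronecker_mul, hU, Matrix.conjTranspose_one,
    Matrix.one_mul, Matrix.one_kronecker_one]

/-- The right side is what the extractor performs: activate, measure, undo. -/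
theorem proj_mulVec (ch : Bool) (r : Resp F n) (v : P.S1 × P.S2 → ℂ) : P.proj ch r *ᵥ v =
    P.on2 (P.U2 ch : Matrix P.S2 P.S2 ℂ)ᴴ (P.on2 (P.W2 r) (P.on2 (P.U2 ch) v)) := by
  rw [on2_on2, on2_on2]
  rfl

/-- Undoing the activation after the measurement does not change probabilities. Thus the verifier's
acceptance can be expressed by the same projections that describe rewinding. -/
theorem normSq_proj (ch : Bool) (r : Resp F n) (v : P.S1 × P.S2 → ℂ) :
    normSq (P.on2 (P.W2 r * (P.U2 ch : Matrix P.S2 P.S2 ℂ)) v) = normSq (P.proj ch r *ᵥ v) := by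
  have h : ((P.U2 ch : Matrix P.S2 P.S2 ℂ)ᴴ)ᴴ * (P.U2 ch : Matrix P.S2 P.S2 ℂ)ᴴ = 1 := by
    rw [Matrix.conjTranspose_conjTranspose]
    exact mul_conjTranspose_self_unitary _
  rw [proj_mulVec, P.on2_isometry h, on2_on2]

/-- The provers act on different tensor factors. -/
theorem proj_on1 (ch : Bool) (r : Resp F n) (M : Matrix P.S1 P.S1 ℂ) (v : P.S1 × P.S2 → ℂ) :
    P.proj ch r *ᵥ P.on1 M v = P.on1 M (P.proj ch r *ᵥ v) := by
  simp only [proj, on1, Matrix.mulVec_mulVec, ← Matrix.mul_kronecker_mul, Matrix.one_mul,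
    Matrix.mul_one]

theorem sum_normSq_on1 (B : Mat F n) (v : P.S1 × P.S2 → ℂ) :
    ∑ Y, normSq (P.on1 (P.W1 Y * (P.U1 B : Matrix P.S1 P.S1 ℂ)) v) = normSq v := by
  simp only [← on1_on1]
  rw [← P.on1_isometry (conjTranspose_mul_self_unitary (P.U1 B)) v]
  exact (P.meas1.kronecker_one (κ := P.S2)).sum_normSq _

/-- The joint state after the first prover has answered `Y` to `B`. -/
def afterCom (B Y : Mat F n) : P.S1 × P.S2 → ℂ :=
  P.on1 (P.W1 Y * (P.U1 B : Matrix P.S1 P.S1 ℂ)) P.Φ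

/-- Probability weight of the responses `r` and `s` to the challenges `c` and `!c`. -/
def pairWeight (B Y : Mat F n) (c : Bool) (r s : Resp F n) : ℝ :=
  normSq (P.proj (!c) s *ᵥ (P.proj c r *ᵥ P.afterCom B Y))

theorem pairWeight_nonneg (B Y : Mat F n) (c : Bool) (r s : Resp F n) :
    0 ≤ P.pairWeight B Y c r s := normSq_nonneg _

/-- No-signalling: summed over the answers of the first prover, the statistics of the second do not
depend on `B`. -/
theorem sum_pairWeight (B : Mat F n) (c : Bool) (r s : Resp F n) :
    ∑ Y, P.pairWeight B Y c r s = normSq (P.proj (!c) s *ᵥ (P.proj c r *ᵥ P.Φ)) := by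
  simp only [pairWeight, afterCom, proj_on1]
  exact P.sum_normSq_on1 B _

theorem sum_normSq_pairs (c : Bool) :
    ∑ r, ∑ s, normSq (P.proj (!c) s *ᵥ (P.proj c r *ᵥ P.Φ)) = 1 := by
  simp only [(P.proj_measurement (!c)).sum_normSq, (P.proj_measurement c).sum_normSq, P.norm_Φ]

variable [Field F] (G : SimpleGraph (Fin n))

open Classical in
/-- The accepted responses. -/
def accepted (B Y : Mat F n) (ch : Bool) : Finset (Resp F n) :=
  Finset.univ.filter fun r => Accepts G B Y ch r

theorem mem_accepted {G : SimpleGraph (Fin n)} {B Y : Mat F n} {ch : Bool} {r : Resp F n} :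
    r ∈ accepted G B Y ch ↔ Accepts G B Y ch r := by
  simp [accepted]

theorem acceptProb_eq : P.acceptProb G * ((Fintype.card (Mat F n) : ℝ) * 2) =
    ∑ B, ∑ Y, ∑ ch, normSq ((∑ r ∈ accepted G B Y ch, P.proj ch r) *ᵥ P.afterCom B Y) := by
  classical
  have hc : (0 : ℝ) < Fintype.card (Mat F n) := by exact_mod_cast Fintype.card_pos
  rw [acceptProb, div_mul_cancel₀ _ (by positivity)]
  refine Finset.sum_congr rfl fun B _ => ?_
  rw [Finset.sum_comm]
  refine Finset.sum_congr rfl fun Y _ => Finset.sum_congr rfl fun ch _ => ?_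
  rw [← (P.proj_measurement ch).sum_normSq_subset, accepted, Finset.sum_filter]
  refine Finset.sum_congr rfl fun r _ => ?_
  rw [normSq_proj]
  rfl

open Classical in
theorem card_accepted_le (B Y : Mat F n) (ch : Bool) :
    ((accepted G B Y ch).filter fun r => P.proj ch r ≠ 0).card ≤ P.numAcceptable G := by
  refine le_trans (Finset.card_le_card ?_) (Finset.le_sup (f := fun x : Mat F n × Mat F n × Bool =>
    (Finset.univ.filter fun resp : Resp F n =>
      Accepts G x.1 x.2.1 x.2.2 resp ∧ P.W2 resp ≠ 0).card) (Finset.mem_univ (B, Y, ch)))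
  intro r hr
  simp only [Finset.mem_filter, mem_accepted, Finset.mem_univ, true_and] at hr ⊢
  refine ⟨hr.1, fun h => hr.2 ?_⟩
  rw [proj, h, Matrix.mul_zero, Matrix.zero_mul, Matrix.kronecker_zero]

/-- For given `B`, `Y` and challenge, the equations of the check determine every opening from the
permutation or cycle. Hence `Resp.perm` is injective on accepted responses. -/
theorem numAcceptable_le : P.numAcceptable G ≤ n ! := by
  classical
  refine Finset.sup_le fun x _ => ?_
  have hn : n ! = (Finset.univ : Finset (Equiv.Perm (Fin n))).card := by
    rw [Finset.card_univ, Fintype.card_perm, Fintype.card_fin]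
  rw [hn]
  refine Finset.card_le_card_of_injOn Resp.perm (fun _ _ => Finset.mem_univ _) ?_
  intro r hr s hs h
  simp only [Finset.coe_filter, Finset.mem_univ, true_and, Set.mem_ofPred_eq] at hr hs
  obtain ⟨B, Y, ch⟩ := x
  have hr := hr.1
  have hs := hs.1
  dsimp only at hr hs
  cases ch <;> cases r <;> cases s <;> simp only [Accepts, Resp.perm] at hr hs h
  · subst h
    congr 1
    funext i j
    exact add_right_cancel ((hr i j).symm.trans (hs i j))
  · subst h
    congr 1
    funext i
    exact add_right_cancel ((hr.2 i).symm.trans (hs.2 i))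

/-- Responses to both challenges are accepted with at least the square of the advantage, up to
the number of acceptable responses. -/
theorem pairs_accepted (hV : 1 / 2 ≤ P.acceptProb G) :
    (Fintype.card (Mat F n) : ℝ) * (2 * P.acceptProb G - 1) ^ 2 ≤ P.numAcceptable G *
      ∑ B, ∑ Y, ∑ c, ∑ r ∈ accepted G B Y c, ∑ s ∈ accepted G B Y (!c),
        P.pairWeight B Y c r s := by
  classical
  -- The parameter `c` of `projections_in_succession` is taken to be `l`, the maximizer of `2 * c *
  -- l - c ^ 2`. It is the same for all `B` and `Y`, so the estimates can be summed.
  set l := 2 * P.acceptProb G - 1 with hl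
  have hl0 : 0 ≤ l := by linarith
  have key : ∀ B Y, 2 * l * (∑ ch, normSq ((∑ r ∈ accepted G B Y ch, P.proj ch r) *ᵥ
      P.afterCom B Y) - normSq (P.afterCom B Y)) - l ^ 2 * normSq (P.afterCom B Y) ≤
      P.numAcceptable G * ∑ c, ∑ r ∈ accepted G B Y c, ∑ s ∈ accepted G B Y (!c),
        P.pairWeight B Y c r s := by
    intro B Y
    have h1 := (P.proj_measurement true).projections_in_succession (P.proj_measurement false)
      (accepted G B Y true) (accepted G B Y false) (P.afterCom B Y) hl0
    have h2 := (P.proj_measurement false).sum_pairs (W := P.proj true) (accepted G B Y true)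
      (accepted G B Y false) (P.afterCom B Y) (P.card_accepted_le G B Y true)
    have h3 := (P.proj_measurement true).sum_pairs (W := P.proj false) (accepted G B Y false)
      (accepted G B Y true) (P.afterCom B Y) (P.card_accepted_le G B Y false)
    simp only [Fintype.sum_bool, mul_add, Bool.not_true, Bool.not_false, pairWeight]
    linarith
  have hsum := Finset.sum_le_sum fun B (_ : B ∈ (Finset.univ : Finset (Mat F n))) =>
    Finset.sum_le_sum fun Y (_ : Y ∈ (Finset.univ : Finset (Mat F n))) => key B Y
  simp only [← Finset.mul_sum, Finset.sum_sub_distrib] at hsum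
  have hΦ : ∀ B, ∑ Y, normSq (P.afterCom B Y) = 1 := fun B =>
    (P.sum_normSq_on1 B P.Φ).trans P.norm_Φ
  simp only [hΦ, ← P.acceptProb_eq G, Finset.sum_const, Finset.card_univ, nsmul_eq_mul,
    mul_one] at hsum
  refine le_trans (le_of_eq ?_) hsum
  rw [hl]
  ring

open Classical in
/-- Accepted pairs that do not give a witness are rare, since the second prover does not know the
message to the first one. -/
theorem pairs_without_witness (c : Bool) :
    ∑ B, ∑ Y, ∑ r ∈ accepted G B Y c, ∑ s ∈ accepted G B Y (!c),
      (if IsHamCycle G (witnessOfPair c r s) then 0 else P.pairWeight B Y c r s) ≤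
    (Fintype.card (Mat F n) : ℝ) / Fintype.card F := by
  have hQ : (0 : ℝ) < Fintype.card F := by exact_mod_cast Fintype.card_pos
  let D : ℝ := (Fintype.card (Mat F n) : ℝ) / Fintype.card F
  have hD : 0 ≤ D := by positivity
  -- Extending the summand by zero makes the ranges of `r` and `s` independent of `B` and `Y`, so
  -- that the sums can be exchanged.
  let f : Mat F n → Mat F n → Resp F n → Resp F n → ℝ := fun B Y r s =>
    if Accepts G B Y c r ∧ Accepts G B Y (!c) s ∧ ¬ IsHamCycle G (witnessOfPair c r s) then
      P.pairWeight B Y c r s else 0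
  have h1 : ∀ B Y, ∑ r ∈ accepted G B Y c, ∑ s ∈ accepted G B Y (!c),
      (if IsHamCycle G (witnessOfPair c r s) then 0 else P.pairWeight B Y c r s) =
      ∑ r, ∑ s, f B Y r s := by
    intro B Y
    rw [accepted, Finset.sum_filter]
    refine Finset.sum_congr rfl fun r _ => ?_
    rw [accepted, Finset.sum_filter]
    by_cases hr : Accepts G B Y c r
    · rw [if_pos hr]
      refine Finset.sum_congr rfl fun s _ => ?_
      by_cases hs : Accepts G B Y (!c) s <;>
        by_cases hw : IsHamCycle G (witnessOfPair c r s) <;> simp [f, hr, hs, hw]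
    · simp [f, hr]
  have h2 : ∀ r s, ∑ B, ∑ Y, f B Y r s ≤
      D * normSq (P.proj (!c) s *ᵥ (P.proj c r *ᵥ P.Φ)) := by
    intro r s
    by_cases hw : IsHamCycle G (witnessOfPair c r s)
    · simp only [f, hw, not_true_eq_false, and_false, if_false, Finset.sum_const_zero]
      exact mul_nonneg hD (normSq_nonneg _)
    -- The determined entry of `B` depends on the two responses only, not on the order in which they
    -- were obtained.
    have h3 : (∀ B Y, Accepts G B Y c r → ¬ Accepts G B Y (!c) s) ∨
        ∃ i j x, ∀ B Y, Accepts G B Y c r → Accepts G B Y (!c) s → B i j = x := by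
      cases c
      · exact accepted_pair G r s hw
      · rcases accepted_pair G s r hw with h | ⟨i, j, x, h⟩
        · exact Or.inl fun B Y h1 h2 => h B Y h2 h1
        · exact Or.inr ⟨i, j, x, fun B Y h1 h2 => h B Y h2 h1⟩
    rcases h3 with h3 | ⟨i, j, x, h3⟩
    · have : ∀ B Y, f B Y r s = 0 := fun B Y => if_neg fun h => h3 B Y h.1 h.2.1
      simp only [this, Finset.sum_const_zero]
      exact mul_nonneg hD (normSq_nonneg _)
    · have h4 : ∀ B Y, f B Y r s ≤ if B i j = x then P.pairWeight B Y c r s else 0 := by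
        intro B Y
        by_cases hB : B i j = x
        · rw [if_pos hB]
          simp only [f]
          split_ifs
          exacts [le_rfl, P.pairWeight_nonneg _ _ _ _ _]
        · rw [if_neg hB]
          exact le_of_eq (if_neg fun h => hB (h3 B Y h.1 h.2.1))
      -- Summing over `Y` removes the dependence on `B` except for the condition on one entry, which
      -- a fraction `1/Q` of all `B` satisfies.
      have h5 : ∀ B, ∑ Y, f B Y r s ≤
          if B i j = x then normSq (P.proj (!c) s *ᵥ (P.proj c r *ᵥ P.Φ)) else 0 := by
        intro B
        refine (Finset.sum_le_sum fun Y _ => h4 B Y).trans (le_of_eq ?_)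
        split_ifs
        · exact P.sum_pairWeight B c r s
        · exact Finset.sum_const_zero
      refine (Finset.sum_le_sum fun B _ => h5 B).trans (le_of_eq ?_)
      rw [← Finset.sum_filter, Finset.sum_const, nsmul_eq_mul]
      congr 1
      rw [eq_div_iff hQ.ne', mul_comm]
      exact_mod_cast card_entry_eq i j x
  calc _ = ∑ r, ∑ s, ∑ B, ∑ Y, f B Y r s := by
        simp only [h1]
        rw [Finset.sum_congr rfl fun B _ => Finset.sum_comm, Finset.sum_comm]
        refine Finset.sum_congr rfl fun r _ => ?_
        rw [Finset.sum_congr rfl fun B _ => Finset.sum_comm, Finset.sum_comm]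
    _ ≤ ∑ r, ∑ s, D * normSq (P.proj (!c) s *ᵥ (P.proj c r *ᵥ P.Φ)) :=
        Finset.sum_le_sum fun r _ => Finset.sum_le_sum fun s _ => h2 r s
    _ = D := by
        simp only [← Finset.mul_sum]
        rw [P.sum_normSq_pairs, mul_one]

open Classical in
/-- Lower bound for the probability that the responses to both challenges give a witness. -/
theorem pairs_with_witness (hV : 1 / 2 ≤ P.acceptProb G) :
    (Fintype.card (Mat F n) : ℝ) * (2 * P.acceptProb G - 1) ^ 2 ≤ P.numAcceptable G *
      (∑ B, ∑ Y, ∑ c, ∑ r, ∑ s, (if IsHamCycle G (witnessOfPair c r s) then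
        P.pairWeight B Y c r s else 0) + 2 * ((Fintype.card (Mat F n) : ℝ) / Fintype.card F)) := by
  refine (P.pairs_accepted G hV).trans (mul_le_mul_of_nonneg_left ?_ (Nat.cast_nonneg _))
  have hbad : ∑ B, ∑ Y, ∑ c, ∑ r ∈ accepted G B Y c, ∑ s ∈ accepted G B Y (!c),
      (if IsHamCycle G (witnessOfPair c r s) then 0 else P.pairWeight B Y c r s) ≤
      2 * ((Fintype.card (Mat F n) : ℝ) / Fintype.card F) := by
    simp only [Fintype.sum_bool, Finset.sum_add_distrib]
    have h1 := P.pairs_without_witness G true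
    have h2 := P.pairs_without_witness G false
    linarith
  refine le_trans ?_ (add_le_add_right hbad _)
  simp only [← Finset.sum_add_distrib]
  refine Finset.sum_le_sum fun B _ => Finset.sum_le_sum fun Y _ => Finset.sum_le_sum fun c _ => ?_
  have h0 : ∀ r s, 0 ≤ if IsHamCycle G (witnessOfPair c r s) then
      P.pairWeight B Y c r s else 0 := fun r s => by
    split_ifs
    exacts [P.pairWeight_nonneg _ _ _ _ _, le_rfl]
  calc _ = ∑ r ∈ accepted G B Y c, ∑ s ∈ accepted G B Y (!c),
        (if IsHamCycle G (witnessOfPair c r s) then P.pairWeight B Y c r s else 0) +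
        ∑ r ∈ accepted G B Y c, ∑ s ∈ accepted G B Y (!c),
        (if IsHamCycle G (witnessOfPair c r s) then 0 else P.pairWeight B Y c r s) := by
        simp only [← Finset.sum_add_distrib]
        refine Finset.sum_congr rfl fun r _ => Finset.sum_congr rfl fun s _ => ?_
        split_ifs <;> simp
    _ ≤ _ := by
        -- Pairs that are not accepted may also give a witness. They are kept in the bound, since
        -- the extractor does not check acceptance.
        refine add_le_add_left ?_ _
        refine (Finset.sum_le_sum fun r _ =>
          Finset.sum_le_univ_sum_of_nonneg fun s => h0 r s).trans ?_
        exact Finset.sum_le_univ_sum_of_nonneg fun r => Finset.sum_nonneg fun s _ => h0 r s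

end Provers


/-! ### The extractor -/

/-- Query the second prover, store the permutation of its answer in the row of `aRows` given by
the challenge, and rewind. -/
def Prog.ask : Prog ExtOp :=
  .seq (.call .act2) <| .seq (.call .measure2) <|
    .seq (.forVertices aRow
      (.assign aRows (.cell aCh) (.cell aRow) (.get aPerm (.const 0) (.cell aRow))))
      (.call .undo2)

/-- Compute the witness from the two rows. -/
def Prog.combine : Prog ExtOp :=
  .seq (.forVertices aRow (.assign aInv (.const 0) (.row0 (.cell aRow)) (.cell aRow))) <|
    .forVertices aRow (.assign aOut (.const 0) (.cell aRow)
      (.get aInv (.const 0) (.get aRows (.const 1) (.row0 (.cell aRow)))))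

def extractor : Extractor :=
  .seq (.fillMat fRand) <| .seq (.call .act1) <| .seq (.call .measure1) <|
    .seq (.sample aCh (.const 0) (.const 0) (.const 2)) <|
    .seq .ask <| .seq (.assign aCh (.const 0) (.const 0) (.sub (.const 1) (.cell aCh))) <|
    .seq .ask .combine

theorem small_extractor : extractor.Small :=
  have small_ask : Prog.ask.Small :=
    ⟨trivial, trivial, ⟨(NExpr.small_get _ _ _).succ, NExpr.small_get _ _ _⟩, trivial⟩
  ⟨small_fillMat _, trivial, trivial, fun _ _ _ hM _ => by simp only [NExpr.eval]; omega,
    small_ask, fun _ _ _ hM _ => by simp only [NExpr.eval]; omega, small_ask,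
    ⟨(NExpr.small_get _ _ _).succ, NExpr.small_get _ _ _⟩,
    (NExpr.small_get _ _ _).succ, NExpr.small_get _ _ _⟩

section

/-! ### Effect of the oracle calls on memory and state -/

variable {F : Type} {n : ℕ}

theorem Mem.putPerm_aPerm (m : Mem F) (p : Equiv.Perm (Fin n)) (i : Fin n) :
    (m.putPerm p).nat aPerm 0 i = p i := by
  simp [Mem.putPerm]

theorem Mem.putPerm_of_ne (m : Mem F) (p : Equiv.Perm (Fin n)) {a : ℕ} (h : a ≠ aPerm) :
    (m.putPerm p).nat a = m.nat a := by
  funext i j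
  simp [Mem.putPerm, h]

theorem Mem.NatLE.putPerm {M : ℕ} {m : Mem F} (hm : m.NatLE M) (hn : n ≤ M)
    (p : Equiv.Perm (Fin n)) : (m.putPerm p).NatLE M := by
  intro a i j
  simp only [Mem.putPerm]
  split_ifs
  · exact (p _).2.le.trans hn
  · exact hm _ _ _

theorem Mem.putResp_aPerm (m : Mem F) (r : Resp F n) (i : Fin n) :
    (m.putResp r).nat aPerm 0 i = r.perm i := by
  cases r <;> exact Mem.putPerm_aPerm _ _ _

theorem Mem.putResp_of_ne (m : Mem F) (r : Resp F n) {a : ℕ} (h : a ≠ aPerm) (h' : a ≠ aKind) :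
    (m.putResp r).nat a = m.nat a := by
  cases r <;> exact (Mem.putPerm_of_ne _ _ h).trans (Mem.setNat_nat_of_ne _ _ _ _ h')

theorem Mem.NatLE.putResp {M : ℕ} {m : Mem F} (hm : m.NatLE M) (hn : n ≤ M) (hM : 1 ≤ M)
    (r : Resp F n) : (m.putResp r).NatLE M := by
  cases r
  · exact (hm.setNat (Nat.zero_le _)).putPerm hn _
  · exact (hm.setNat hM).putPerm hn _

theorem Mem.putResp_cost (m : Mem F) (r : Resp F n) : (m.putResp r).cost = m.cost := by
  cases r <;> rfl

variable [Field F] [Fintype F]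

theorem extHandler_bound (P : Provers F n) {M X : ℕ} (hn : n ≤ M) (hM : 1 ≤ M)
    (hX : msgCost F n ≤ X) (o : ExtOp) (s : Mem F × (P.S1 × P.S2 → ℂ)) (hs : s.1.NatLE M) :
    ∀ b ∈ extHandler P o s, b.2.1.NatLE M ∧ b.2.1.cost ≤ s.1.cost + X := by
  obtain ⟨m, v⟩ := s
  intro b hb
  cases o <;> simp only [extHandler, Branches.pure, List.mem_singleton, List.mem_map] at hb
  case measure1 =>
    obtain ⟨Y, -, rfl⟩ := hb
    exact ⟨hs, Nat.add_le_add_left hX _⟩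
  case measure2 =>
    obtain ⟨r, -, rfl⟩ := hb
    exact ⟨hs.putResp hn hM r, by
      simp only [Mem.tick, Mem.putResp_cost]; exact Nat.add_le_add_left hX _⟩
  all_goals
    subst hb
    exact ⟨hs, Nat.add_le_add_left hX _⟩

/-- Number of the row that belongs to a challenge. -/
abbrev rowOf (ch : Bool) : ℕ := if ch then 1 else 0

/-- Storing the answer leaves the challenge cell untouched, so the unitary that is undone is the one
that was applied and the net effect on the state is `P.proj ch r`. Only the row of this challenge is
overwritten, which preserves the answer to the other one. -/
theorem runs_ask (P : Provers F n) {m : Mem F} {v : P.S1 × P.S2 → ℂ}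
    (hn : m.nat aSize 0 0 = n) {ch : Bool} (hch : m.nat aCh 0 0 = rowOf ch) :
    Branches.Runs (Prog.ask.run (extHandler P) (m, v)) (Resp F n) 1 fun r y =>
      y.2 = P.proj ch r *ᵥ v ∧ (∀ i : Fin n, y.1.nat aRows (rowOf ch) i = r.perm i) ∧
      (∀ k, k ≠ rowOf ch → y.1.nat aRows k = m.nat aRows k) ∧
      y.1.nat aSize 0 0 = n ∧ y.1.nat aCh 0 0 = rowOf ch := by
  have hget : ∀ m' : Mem F, m'.nat aCh 0 0 = rowOf ch → m'.getCh = ch := by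
    intro m' h
    simp only [Mem.getCh, h]
    cases ch <;> rfl
  simp only [Prog.ask, Prog.run, extHandler, Branches.pure_bind]
  refine Branches.Runs.bind_yields (Branches.runs_map_toList (P := fun r
    (y : Mem F × (P.S1 × P.S2 → ℂ)) => y.2 = P.on2 (P.W2 r) (P.on2 (P.U2 ch) v) ∧
    (∀ i : Fin n, y.1.nat aPerm 0 i = (r.perm i : ℕ)) ∧
    y.1.nat aRows = m.nat aRows ∧ y.1.nat aSize 0 0 = n ∧ y.1.nat aCh 0 0 = rowOf ch) ?_) ?_
  · intro r
    refine ⟨?_, fun i => Mem.putResp_aPerm _ _ _, Mem.putResp_of_ne _ _ (by simp) (by simp), ?_, ?_⟩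
    · rw [hget m hch]
    · simp only [Mem.tick_nat]
      rw [Mem.putResp_of_ne _ _ (by simp) (by simp), Mem.tick_nat, hn]
    · simp only [Mem.tick_nat]
      rw [Mem.putResp_of_ne _ _ (by simp) (by simp), Mem.tick_nat, hch]
  · rintro r ⟨m', v'⟩ ⟨h1, h2, h3, h4, h5⟩
    dsimp only at h1 h2 h3 h4 h5
    refine (yields_forVertices (extHandler P) aRow _ (n := n) (fun k y =>
      (∀ i : Fin n, (i : ℕ) < k → y.nat aRows (rowOf ch) i = r.perm i) ∧
      (∀ k, k ≠ rowOf ch → y.nat aRows k = m.nat aRows k) ∧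
      Mem.AgreeNat {aRow, aRows} m' y) h4 ?_ ?_).bind ?_
    · exact fun k => ⟨fun i hi => absurd hi (by omega), fun k _ => by rw [Mem.tick_nat, h3],
        Mem.AgreeNat.refl _ _⟩
    · rintro k y ⟨h6, h7, h8⟩ s
      have e1 : ((y.setNat aRow 0 0 k).tick s).nat aCh 0 0 = rowOf ch := by
        rw [Mem.tick_nat, Mem.setNat_nat_of_ne _ _ _ _ (by simp), h8 aCh (by simp), h5]
      have e2 : ((y.setNat aRow 0 0 k).tick s).nat aPerm 0 k = r.perm k := by
        rw [Mem.tick_nat, Mem.setNat_nat_of_ne _ _ _ _ (by simp), h8 aPerm (by simp), h2]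
      have e3 : ((y.setNat aRow 0 0 k).tick s).nat aRow 0 0 = k := by
        simp [Mem.tick_nat, Mem.setNat_nat]
      simp only [Prog.run, NExpr.eval, e1, e2, e3]
      refine Branches.yields_pure ⟨⟨fun i hi => ?_, fun l hl => ?_, fun a ha => ?_⟩, rfl⟩
      · simp only [Mem.tick_nat, Mem.setNat_nat]
        by_cases hik : i = k
        · simp [hik]
        · have : (i : ℕ) ≠ k := fun h => hik (Fin.ext h)
          simpa [this] using h6 i (by omega)
      · rw [← h7 l hl]
        funext j
        simp [Mem.tick_nat, Mem.setNat_nat, hl]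
      · rw [← h8 a ha]
        simp only [Set.mem_insert_iff, Set.mem_singleton_iff, not_or] at ha
        funext i j
        simp [Mem.tick_nat, Mem.setNat_nat, ha]
    · rintro ⟨y, u⟩ ⟨⟨h6, h7, h8⟩, rfl⟩
      dsimp only at h6 h7 h8 h1
      have e1 : y.nat aCh 0 0 = rowOf ch := by rw [h8 aCh (by simp), h5]
      refine Branches.yields_pure ⟨?_, fun i => h6 i i.2, h7, ?_, e1⟩
      · dsimp only
        rw [hget y e1, h1, P.proj_mulVec]
      · rw [Mem.tick_nat, h8 aSize (by simp), h4]

theorem yields_combine (P : Provers F n) {m : Mem F} {v : P.S1 × P.S2 → ℂ}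
    (hn : m.nat aSize 0 0 = n) {r₀ r₁ : Resp F n}
    (h0 : ∀ i : Fin n, m.nat aRows 0 i = r₀.perm i)
    (h1 : ∀ i : Fin n, m.nat aRows 1 i = r₁.perm i) :
    Branches.Yields (Prog.combine.run (extHandler P) (m, v)) fun y =>
      (∀ i : Fin n, y.1.nat aOut 0 i = witnessOf r₀ r₁ i) ∧ y.2 = v := by
  simp only [Prog.combine, Prog.run]
  refine (yields_forVertices (extHandler P) aRow _ (n := n) (fun k y =>
    (∀ i : Fin n, (i : ℕ) < k → y.nat aInv 0 (r₀.perm i) = i) ∧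
    Mem.AgreeNat {aRow, aInv} m y) hn ?_ ?_).bind ?_
  · exact fun k => ⟨fun i hi => absurd hi (by omega), Mem.AgreeNat.refl _ _⟩
  · rintro k y ⟨h6, h8⟩ s
    have e1 : ((y.setNat aRow 0 0 k).tick s).nat aRows 0 k = r₀.perm k := by
      rw [Mem.tick_nat, Mem.setNat_nat_of_ne _ _ _ _ (by simp), h8 aRows (by simp), h0]
    have e3 : ((y.setNat aRow 0 0 k).tick s).nat aRow 0 0 = k := by
      simp [Mem.tick_nat, Mem.setNat_nat]
    simp only [Prog.run, NExpr.eval, e1, e3]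
    refine Branches.yields_pure ⟨⟨fun i hi => ?_, fun a ha => ?_⟩, rfl⟩
    · simp only [Mem.tick_nat, Mem.setNat_nat]
      by_cases hik : i = k
      · simp [hik]
      · have : (i : ℕ) ≠ k := fun h => hik (Fin.ext h)
        simpa [Fin.val_inj, hik] using h6 i (by omega)
    · rw [← h8 a ha]
      simp only [Set.mem_insert_iff, Set.mem_singleton_iff, not_or] at ha
      funext i j
      simp [Mem.tick_nat, Mem.setNat_nat, ha]
  · rintro ⟨m', u⟩ ⟨⟨h2, h3⟩, rfl⟩
    dsimp only at h2 h3
    refine (yields_forVertices (extHandler P) aRow _ (n := n) (fun k y =>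
      (∀ i : Fin n, (i : ℕ) < k → y.nat aOut 0 i = witnessOf r₀ r₁ i) ∧
      Mem.AgreeNat {aRow, aOut} m' y) (by rw [h3 aSize (by simp), hn]) ?_ ?_).mono ?_
    · exact fun k => ⟨fun i hi => absurd hi (by omega), Mem.AgreeNat.refl _ _⟩
    · rintro k y ⟨h6, h8⟩ s
      have e1 : ((y.setNat aRow 0 0 k).tick s).nat aRows = m.nat aRows := by
        rw [Mem.tick_nat, Mem.setNat_nat_of_ne _ _ _ _ (by simp), h8 aRows (by simp),
          h3 aRows (by simp)]
      have e2 : ((y.setNat aRow 0 0 k).tick s).nat aInv = m'.nat aInv := by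
        rw [Mem.tick_nat, Mem.setNat_nat_of_ne _ _ _ _ (by simp), h8 aInv (by simp)]
      have e3 : ((y.setNat aRow 0 0 k).tick s).nat aRow 0 0 = k := by
        simp [Mem.tick_nat, Mem.setNat_nat]
      -- The array of inverses was filled at the values of `r₀.perm`; the position read here is the
      -- value at `witnessOf r₀ r₁ k`.
      have e4 : m'.nat aInv 0 (r₁.perm (r₀.perm k)) = witnessOf r₀ r₁ k := by
        have := h2 (witnessOf r₀ r₁ k) (Fin.is_lt _)
        rw [← this]
        congr 2
        simp [witnessOf, Equiv.Perm.mul_apply]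
      simp only [Prog.run, NExpr.eval, e1, e2, e3, h0, h1, e4]
      refine Branches.yields_pure ⟨⟨fun i hi => ?_, fun a ha => ?_⟩, rfl⟩
      · simp only [Mem.tick_nat, Mem.setNat_nat]
        by_cases hik : i = k
        · simp [hik]
        · have : (i : ℕ) ≠ k := fun h => hik (Fin.ext h)
          simpa [this] using h6 i (by omega)
      · rw [← h8 a ha]
        simp only [Set.mem_insert_iff, Set.mem_singleton_iff, not_or] at ha
        funext i j
        simp [Mem.tick_nat, Mem.setNat_nat, ha]
    · rintro ⟨y, x⟩ ⟨⟨h4, -⟩, rfl⟩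
      exact ⟨fun i => h4 i i.2, rfl⟩

/-- Only the choices of `B` and of the first challenge carry a weight different from `1`. The
probabilities of the measurement outcomes are contained in the norm of the unnormalized state. -/
theorem runs_extractor (P : Provers F n) (η : ℕ) (G : SimpleGraph (Fin n)) :
    Branches.Runs (extractor.branches η G P)
      (Mat F n × Mat F n × Bool × Resp F n × Resp F n)
      (1 / (Fintype.card F : ℝ) ^ (n * n) * (1 * (1 / ((2 : ℕ) : ℝ) * (1 * 1)))) fun x y =>
        (∀ i : Fin n, y.1.nat aOut 0 i = witnessOfPair x.2.2.1 x.2.2.2.1 x.2.2.2.2 i) ∧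
        y.2 = P.proj (!x.2.2.1) x.2.2.2.2 *ᵥ (P.proj x.2.2.1 x.2.2.2.1 *ᵥ
          P.afterCom x.1 x.2.1) := by
  simp only [Extractor.branches, extractor, Prog.run]
  refine (runs_fillMat _ fRand (initMem_size (F := F) η G 0 0)).bind ?_
  rintro B ⟨m, v⟩ ⟨rfl, h1, -, h2⟩
  dsimp only at h1 h2
  have hB : m.getMat n fRand = B := by
    funext i j
    exact h1 i j
  have hsz : m.nat aSize 0 0 = n := by
    rw [h2 aSize (by simp)]
    exact initMem_size (F := F) η G 0 0
  simp only [extHandler, Branches.pure_bind]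
  refine Branches.Runs.bind (Branches.runs_map_toList (P := fun Y y =>
    y.2 = P.afterCom B Y ∧ y.1.nat aSize 0 0 = n) fun Y => ⟨?_, hsz⟩) ?_
  · dsimp only
    rw [P.on1_on1, hB]
    rfl
  rintro Y ⟨m, v⟩ ⟨rfl, hsz⟩
  dsimp only at hsz
  simp only [NExpr.eval]
  refine Branches.Runs.bind (R := Bool) (P := fun c y => y.2 = P.afterCom B Y ∧
    y.1.nat aSize 0 0 = n ∧ y.1.nat aCh 0 0 = rowOf c) ?_ ?_
  · have := Branches.runs_map_range (N := 2) (w := (1 : ℝ) / ((2 : ℕ) : ℝ))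
      (f := fun k => ((m.setNat aCh 0 0 k).tick (1 + NExpr.cost m (.const 0) +
        NExpr.cost m (.const 0) + NExpr.cost m (.const 2)), P.afterCom B Y))
      (P := fun k y => y.2 = P.afterCom B Y ∧ y.1.nat aSize 0 0 = n ∧ y.1.nat aCh 0 0 = k)
      fun k => ⟨rfl, hsz, by simp [Mem.tick_nat, Mem.setNat_nat]⟩
    refine (this.reindex finTwoEquiv.symm).mono ?_
    rintro c y ⟨h1, h2, h3⟩
    refine ⟨h1, h2, h3.trans ?_⟩
    cases c <;> rfl
  rintro c ⟨m, v⟩ ⟨rfl, hsz, hc⟩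
  dsimp only at hsz hc
  refine (runs_ask P hsz hc).bind ?_
  rintro r ⟨m, v⟩ ⟨rfl, h3, -, hsz, hc⟩
  dsimp only at h3 hsz hc
  simp only [hc]
  refine Branches.Runs.bind_yields (runs_ask P (ch := !c) ?_ ?_) ?_
  · rw [Mem.tick_nat, Mem.setNat_nat_of_ne _ _ _ _ (by simp), hsz]
  · cases c <;> simp [Mem.tick_nat, Mem.setNat_nat, rowOf]
  · rintro s ⟨m', v⟩ ⟨rfl, h4, h5, hsz', -⟩
    dsimp only at h4 h5 hsz'
    have h6 : ∀ i : Fin n, m'.nat aRows (rowOf c) i = r.perm i := by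
      intro i
      rw [h5 _ (by cases c <;> simp [rowOf]), Mem.tick_nat, Mem.setNat_nat_of_ne _ _ _ _ (by simp), h3]
    -- Row `0` holds the permutation and row `1` the cycle, whichever challenge was asked first.
    cases c
    · exact yields_combine P hsz' h6 h4
    · exact yields_combine P hsz' h4 h6

open Classical in
theorem successProb_ge (P : Provers F n) (η : ℕ) (G : SimpleGraph (Fin n)) :
    1 / (2 * (Fintype.card (Mat F n) : ℝ)) * ∑ B, ∑ Y, ∑ c, ∑ r, ∑ s,
      (if IsHamCycle G (witnessOfPair c r s) then P.pairWeight B Y c r s else 0) ≤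
      extractor.successProb η G P := by
  obtain ⟨f, hf, hs⟩ := runs_extractor P η G
  rw [Extractor.successProb, hs, card_mat]
  simp only [Fintype.sum_prod_type]
  have hw : (1 : ℝ) / (2 * ((Fintype.card F ^ (n * n) : ℕ) : ℝ)) =
      1 / (Fintype.card F : ℝ) ^ (n * n) * (1 * (1 / ((2 : ℕ) : ℝ) * (1 * 1))) := by
    push_cast
    field_simp
  rw [hw]
  refine mul_le_mul_of_nonneg_left ?_ (by positivity)
  refine Finset.sum_le_sum fun B _ => Finset.sum_le_sum fun Y _ => Finset.sum_le_sum fun c _ =>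
    Finset.sum_le_sum fun r _ => Finset.sum_le_sum fun s _ => ?_
  obtain ⟨h1, h2⟩ := hf (B, Y, c, r, s)
  by_cases hham : IsHamCycle G (witnessOfPair c r s)
  · rw [if_pos hham, if_pos ⟨_, hham, h1⟩, h2]
    exact le_rfl
  · rw [if_neg hham]
    split_ifs
    exacts [normSq_nonneg _, le_rfl]

theorem successProb_nonneg (P : Provers F n) (η : ℕ) (G : SimpleGraph (Fin n)) :
    0 ≤ extractor.successProb η G P := by
  classical
  refine le_trans (mul_nonneg (by positivity) ?_) (successProb_ge P η G)
  refine Finset.sum_nonneg fun B _ => Finset.sum_nonneg fun Y _ => Finset.sum_nonneg fun c _ =>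
    Finset.sum_nonneg fun r _ => Finset.sum_nonneg fun s _ => ?_
  split_ifs
  exacts [P.pairWeight_nonneg _ _ _ _ _, le_rfl]

/-- The bound on the knowledge error. -/
def knowledgeGap (F : Type) [Fintype F] (n : ℕ) : ℝ :=
  Real.sqrt ((n ! : ℝ) / (2 * (Fintype.card F : ℝ)))

theorem extraction (P : Provers F n) (η : ℕ) (G : SimpleGraph (Fin n))
    (hV : 1 / 2 + knowledgeGap F n < P.acceptProb G) :
    (P.acceptProb G - (1 / 2 + knowledgeGap F n)) ^ 2 ≤
      P.numAcceptable G * extractor.successProb η G P := by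
  classical
  have hQ : (0 : ℝ) < Fintype.card F := by exact_mod_cast Fintype.card_pos
  have hM : (0 : ℝ) < Fintype.card (Mat F n) := by exact_mod_cast Fintype.card_pos
  have hg : 0 ≤ knowledgeGap F n := Real.sqrt_nonneg _
  have hg2 : knowledgeGap F n ^ 2 = (n ! : ℝ) / (2 * (Fintype.card F : ℝ)) :=
    Real.sq_sqrt (by positivity)
  have hN : (P.numAcceptable G : ℝ) ≤ (n ! : ℝ) := by exact_mod_cast P.numAcceptable_le G
  have h1 := P.pairs_with_witness G (by linarith)
  have h2 := successProb_ge P η G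
  set S := ∑ B, ∑ Y, ∑ c, ∑ r, ∑ s,
    (if IsHamCycle G (witnessOfPair c r s) then P.pairWeight B Y c r s else 0)
  set N : ℝ := (P.numAcceptable G : ℝ)
  set V := P.acceptProb G
  set ξ := knowledgeGap F n
  set M : ℝ := (Fintype.card (Mat F n) : ℝ)
  set Q : ℝ := (Fintype.card F : ℝ)
  have hN0 : 0 ≤ N := Nat.cast_nonneg _
  have h3 : (2 * V - 1) ^ 2 ≤ N * (2 * (1 / (2 * M) * S) + 2 / Q) := by
    have : N * (2 * (1 / (2 * M) * S) + 2 / Q) = N * (S + 2 * (M / Q)) / M := by field_simp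
    rw [this, le_div_iff₀ hM]
    linarith
  -- The definition of `knowledgeGap` is chosen to make this hold for the largest possible value
  -- `n!` of `N`.
  have h4 : N * (2 / Q) ≤ 4 * ξ ^ 2 := by
    have : 4 * ξ ^ 2 = n ! * (2 / Q) := by
      rw [hg2]
      field_simp
      ring
    rw [this]
    exact mul_le_mul_of_nonneg_right hN (by positivity)
  have h5 : N * (1 / (2 * M) * S) ≤ N * extractor.successProb η G P :=
    mul_le_mul_of_nonneg_left h2 hN0
  -- With `δ = V - 1/2 - ξ > 0`, `(2V - 1)² - 4ξ² = 4δ² + 8δξ ≥ 4δ²`. So `4δ²` is at most twice `N`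
  -- times the success probability, which is even stronger than the claim.
  nlinarith

end

/-! ### The proof of knowledge -/

theorem honest_accepted {F : Type} [Field F] [Fintype F] {n : ℕ} {G : SimpleGraph (Fin n)}
    {w : Equiv.Perm (Fin n)} (hw : IsHamCycle G w) : honestAcceptProb (F := F) G w = 1 := by
  classical
  have hM : (0 : ℝ) < Fintype.card (Mat F n) := by exact_mod_cast Fintype.card_pos
  have key : ∀ (Pi : Equiv.Perm (Fin n)) (A B : Mat F n) (ch : Bool),
      Accepts G B (honestCom G Pi A B) ch (honestResp w Pi A ch) := by
    intro Pi A B ch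
    cases ch
    · exact fun i j => rfl
    · refine ⟨by simpa using hw.1.conj Pi⁻¹, fun u => ?_⟩
      simp only [honestCom, permAdj_conj hw.2 Pi u, mul_one]
  simp only [honestAcceptProb, key, if_true, Finset.sum_const, Finset.card_univ, nsmul_eq_mul,
    Fintype.card_perm, Fintype.card_fin, Fintype.card_bool]
  field_simp
  norm_num

section

variable (F : ℕ → ℕ → Type) [∀ η n, Field (F η n)] [∀ η n, Fintype (F η n)]

theorem extractor_polyTime (hsize : ∃ C k : ℕ, ∀ η n,
    Nat.size (Fintype.card (F η n)) ≤ C * (n + η + 1) ^ k) : extractor.IsPolyTime F := by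
  obtain ⟨D, l, hD⟩ := overhead_poly F hsize
  obtain ⟨C, k, h⟩ := extractor.poly_bound small_extractor
  refine ⟨C * D ^ k, l * k, fun n η G P b hb => ?_⟩
  have hX := hD η n
  have := (h (F η n) _ (extHandler P) (n + η + 1) (D * (n + η + 1) ^ l) (by omega) (by omega)
    (by omega) (fun o s hs => extHandler_bound P (by omega) (by omega) (by omega) o s hs)
    _ (initMem_natLE η G) b hb).2
  rw [mul_pow, ← pow_mul, ← mul_assoc] at this
  exact this.trans (le_of_eq (Nat.zero_add _))

/-- The square root halves the exponent: decay of `1/Q` against `η ^ (2 * k)` gives decay of the gap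
against `η ^ k`. -/
theorem negligible_knowledgeGap (n : ℕ)
    (hneg : Negligible fun η => 1 / (Fintype.card (F η n) : ℝ)) :
    Negligible fun η => knowledgeGap (F η n) n := by
  intro k
  have h := (Real.continuous_sqrt.tendsto 0).comp ((hneg (2 * k)).const_mul ((n ! : ℝ) / 2)
    |>.trans (by rw [mul_zero]))
  rw [Real.sqrt_zero] at h
  refine h.congr fun η => ?_
  simp only [Function.comp_apply, knowledgeGap]
  rw [← Real.sqrt_sq (pow_nonneg (Nat.cast_nonneg η) k : (0 : ℝ) ≤ (η : ℝ) ^ k),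
    ← Real.sqrt_mul (by positivity)]
  congr 1
  rw [← pow_mul, mul_comm k 2]
  field_simp

end

end RelHC

end

/-! ### Assembly: both loss factors from one extraction estimate -/

theorem mainTheorem12 (F : ℕ → ℕ → Type) [∀ η n, Field (F η n)] [∀ η n, Fintype (F η n)]
    (hsize : ∃ C k : ℕ, ∀ η n, Nat.size (Fintype.card (F η n)) ≤ C * (n + η + 1) ^ k)
    (hneg : ∀ n, RelHC.Negligible fun η => 1 / (Fintype.card (F η n) : ℝ)) :
    ∃ ξ : ℕ → ℕ → ℝ,
      (∀ n, RelHC.Negligible (ξ n)) ∧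
      (∀ n η, 0 ≤ ξ n η ∧
        ξ n η ≤ Real.sqrt ((n ! : ℝ) / (2 * (Fintype.card (F η n) : ℝ)))) ∧
      (∃ (K : RelHC.Extractor) (d : ℕ),
        RelHC.IsQPoK F K d (fun n η => 1 / 2 + ξ n η) ∧
        ∃ p : ℕ → ℝ, RelHC.PolyBounded p ∧ ∀ n,
          K.IsValid F d n (fun η => 1 / 2 + ξ n η)
            (fun η G P => p η * (P.numAcceptable G : ℝ))) ∧
      RelHC.IsPerfectZeroKnowledge F := by
  have hvalid : ∀ (n η : ℕ) (G : SimpleGraph (Fin n)) (P : RelHC.Provers (F η n) n),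
      1 / 2 + RelHC.knowledgeGap (F η n) n < P.acceptProb G → ∀ L : ℝ,
      (P.numAcceptable G : ℝ) ≤ L →
      1 / L * (P.acceptProb G - (1 / 2 + RelHC.knowledgeGap (F η n) n)) ^ 2 ≤
        RelHC.extractor.successProb η G P := by
    intro n η G P hV L hL
    have h := RelHC.extraction P η G hV
    have hs := RelHC.successProb_nonneg P η G
    have hpos : 0 < (P.acceptProb G - (1 / 2 + RelHC.knowledgeGap (F η n) n)) ^ 2 :=
      pow_pos (by linarith) 2
    have h' := h.trans (mul_le_mul_of_nonneg_right hL hs)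
    -- An advantage above the knowledge error is positive, which excludes `L = 0`; otherwise `1 / L`
    -- would be a default value.
    have hL0 : 0 < L := pos_of_mul_pos_left (hpos.trans_le h') hs
    rw [one_div, inv_mul_le_iff₀ hL0]
    exact h'
  -- For fixed `n` the loss factor is the constant `n!`; in the refined bound it is the number of
  -- acceptable responses, with `p = 1`.
  refine ⟨fun n η => RelHC.knowledgeGap (F η n) n,
    fun n => RelHC.negligible_knowledgeGap F n (hneg n),
    fun n η => ⟨Real.sqrt_nonneg _, le_rfl⟩,
    ⟨RelHC.extractor, 2, ⟨two_pos, RelHC.extractor_polyTime F hsize,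
      fun n η G w hw => RelHC.honest_accepted hw, fun n => ⟨fun _ => (n ! : ℝ), ?_, ?_⟩⟩,
      fun _ => 1, ?_, fun n η G P hV => ?_⟩,
    RelHC.simulator_perfect F hsize⟩
  · exact ⟨fun _ => Nat.cast_pos.2 n.factorial_pos, n !, 0, fun _ => by simp⟩
  · intro η G P hV
    exact hvalid n η G P hV _ (Nat.cast_le.2 (P.numAcceptable_le G))
  · exact ⟨fun _ => one_pos, 1, 0, fun _ => by simp⟩
  · exact hvalid n η G P hV _ (one_mul _).ge
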